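/- **Setting.** Let $A=\mathbb F_q[T]$, $k_\infty=\mathbb F_q((1/T))$ with $|T|=q$ and $\deg x=\log_q|x|$, let $\mathrm{sgn}$ be the leading coefficient of the expansion in $1/T$, and let $\mathbf C_\infty$ be the completion of an algebraic closure of $k_\infty$. Let $f\in k_\infty$ be a quadratic unit with minimal polynomial $X^2-aX-b$, where $a\in A$ is monic of degree $d$, $b\in\mathbb F_q^\times$, and $|f|>|f^*|$ for the conjugate $f^*=a-f$. Put $\sqrt D=f-f^*$ and define ${\tt Q}_0=1$, ${\tt Q}_1=a$, ${\tt Q}_{n+1}=a{\tt Q}_n+b{\tt Q}_{n-1}$. Put $A_{\infty_1}=\mathbb F_q[f,fT,\dots,fT^{d-1}]$ and $\mathfrak a_i=(f,fT,\dots,fT^i)\subset A_{\infty_1}$ for $0\le i\le d-1$. For $N\ge 1$ and $0\le l\le d-1$ let $\varepsilon_{N,l}=q^{-dN-l}$ and $\Lambda_{\varepsilon}(f)=\{x\in A: |xf-x^\perp|<\varepsilon \text{ for some }x^\perp\in A\}$. **Periods.** Let $\pi\in k_\infty$ with $\mathrm{sgn}(\pi)=1$ be $f^{-1/d}$ if $d$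 is prime to $p=\mathrm{char}\,\mathbb F_q$, and $(fT)^{-1/(d+1)}$ otherwise; put $\langle x\rangle =x\pi^{\deg x}/\mathrm{sgn}(x)$. For $S=\mathfrak a_i$ or $S=\Lambda_\varepsilon(f)$, a period $\xi\in\mathbf C_\infty$ of $S$ is a solution of $\xi^{q-1}=\eta^{-1}\pi^{-t}u^{q-1}$, where (all products and sums being over $0\ne x\in S$) $\eta=\lim_M\prod_{\deg x=M}\mathrm{sgn}(x)$, $t=(q-1)Z_S'(1)$ for the rational function $Z_S(u)=\sum_x u^{\deg x}$, and $u=\lim_M\prod_{\deg x\le M}\langle x\rangle$. Let $\xi_i$ be a period of $\mathfrak a_i$ and $\xi_{N,l}$ a period of $\Lambda_{\varepsilon_{N,l}}(f)$, the $(q-1)$-th roots being taken coherently: $\xi_{N,l}/\xi_{d-1-l}\in k_\infty$ has sign $1$. **Exponentials and isogenies.** Write $\exp_\Lambda(z)=z\prod_{0\ne\lambda\in\Lambda}(1-z/\lambda)$, $\Lambda_i=\xi_i\mathfrak a_i$, $e_i=\exp_{\Lambda_i}$, $\breve\Lambda_{N,l}=\xi_{N,l}\Lambda_{\varepsilon_{N,l}}(f)$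 and $e_{N,l}=\exp_{\breve\Lambda_{N,l}}$. Let $\rho_0$ be the Hayes module with lattice $\Lambda_0$, so that $e_0(\alpha z)=\rho_{0,\alpha}(e_0(z))$. For $1\le i\le d-1$ the Hayes isogeny $\Phi_i$ is the unique monic generator of the left ideal of the ring $\mathbf C_\infty\{\tau\}$ of $\mathbb F_q$-additive polynomials (with composition) generated by the $\rho_{0,\alpha}$, $\alpha\in\mathfrak a_i$. For $0\le l\le d-2$ the approximate isogeny is $$\Phi_{N,l}(x)=x\prod_{0\ne\alpha\in\mathbb F_q\langle {\tt Q}_NT,\dots,{\tt Q}_NT^{d-1-l}\rangle}\bigl(x-e_{N,d-1}(\xi_{N,d-1}\alpha)\bigr).$$ **Quantum points.** For $z\in\mathbf C_\infty$ put $\breve z_1=(\xi_{1,d-1}f/\sqrt D)\,z$ and $\breve z_{N+1}=\psi_N(\breve z_N)$, where the shift $\psi_N$ is the homothety by $(\xi_{N+1,d-1}/\xi_{N,d-1})f$ (its conjugate by the exponentials $e_{N,d-1}$, $e_{N+1,d-1}$ is the shift $\Psi_N$). The $\breve z_N$ matter only as classes modulo $\breve\Lambda_{N,d-1}$ and modulo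 $\{s:|s|<\delta_N\}$, where $\delta_N\to0$. For any representatives $y_N$ of these classes put $w_{N,d-1}=e_{N,d-1}(y_N)$ and $w_{N,l}=\Phi_{N,l}(w_{N,d-1})$ for $0\le l\le d-2$. The quantum point is the set $w^{\rm qt}=\{w_0,\dots,w_{d-1}\}$ of the limits $w_{d-1-l}=\lim_{N\to\infty}w_{N,l}$. **Proposition.** Periods can be chosen as above. For each such choice the Hayes isogenies $\Phi_1,\dots,\Phi_{d-1}$ exist and are unique, and for every $z\in\mathbf C_\infty$ all the limits $w_{d-1-l}$, $0\le l\le d-1$, exist and do not depend on the representatives $y_N$. Moreover $w_0=e_0(\xi_0z)$, $w_i=\Phi_{d-i}(w_0)$ for $1\le i\le d-1$, and hence $$w^{\rm qt}=\{w_0,\Phi_{d-1}(w_0),\dots,\Phi_1(w_0)\}.$$ -/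

import Mathlib

open Polynomial Filter Topology
open scoped NNReal WithZero

noncomputable section

namespace QuantumDrinfeld

variable (Fq : Type*) [Field Fq] [Fintype Fq]

/-! ### The fields `k_∞` and `C_∞` -/

/-- `k_∞ = 𝔽_q((1/T))`, the completion of `k = 𝔽_q(T)` at `∞`, modelled as the field of Laurent
series over `𝔽_q` in the variable `1/T`. -/
abbrev KInf := LaurentSeries Fq

/-- The cardinality `q` of the field of constants as a nonnegative real number. -/
def qReal : ℝ≥0 := (Fintype.card Fq : ℝ≥0)

theorem one_lt_qReal : 1 < qReal Fq := by
  unfold qReal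
  exact_mod_cast Fintype.one_lt_card

/-- The rank one structure which normalizes the `(1/T)`-adic valuation by `|T| = q`. -/
@[reducible]
def rankOneKInf : Valuation.RankOne (Valued.v : Valuation (KInf Fq) ℤᵐ⁰) where
  hom' := (WithZeroMulInt.toNNReal (one_lt_qReal Fq).ne_bot).comp
    MonoidWithZeroHom.ValueGroup₀.embedding
  strictMono' := (WithZeroMulInt.toNNReal_strictMono (one_lt_qReal Fq)).comp
    MonoidWithZeroHom.ValueGroup₀.embedding_strictMono
  exists_val_nontrivial := by
    obtain ⟨x, hx⟩ := LaurentSeries.valuation_surjective Fq (WithZero.exp (1 : ℤ))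
    refine ⟨x, ?_, ?_⟩
    · rw [hx]; exact WithZero.exp_ne_zero
    · rw [hx, ← WithZero.exp_zero]
      simp

/-- `k_∞` with the absolute value normalized by `|T| = q`. -/
instance instNormKInf : NontriviallyNormedField (KInf Fq) :=
  letI := rankOneKInf Fq
  Valued.toNontriviallyNormedField (KInf Fq) ℤᵐ⁰

instance instUltraKInf : IsUltrametricDist (KInf Fq) :=
  letI := rankOneKInf Fq
  Valued.instIsUltrametricDist (KInf Fq) ℤᵐ⁰

instance instCompleteKInf : CompleteSpace (KInf Fq) :=
  LaurentSeries.instLaurentSeriesComplete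

theorem norm_eq_valuation (x : KInf Fq) :
    ‖x‖ = (WithZeroMulInt.toNNReal (one_lt_qReal Fq).ne_bot (Valued.v x) : ℝ) := by
  change ((WithZeroMulInt.toNNReal (one_lt_qReal Fq).ne_bot
    (MonoidWithZeroHom.ValueGroup₀.embedding (Valued.v.restrict x)) : ℝ≥0) : ℝ) = _
  rw [Valuation.embedding_restrict]

/-- The algebraic closure of `k_∞`. -/
abbrev AlgClInf := AlgebraicClosure (KInf Fq)

/-- The algebraic closure of `k_∞` with the unique extension of the absolute value. -/
instance instNormAlgClInf : NormedField (AlgClInf Fq) :=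
  spectralNorm.normedField (KInf Fq) (AlgClInf Fq)

/-- `C_∞`, the completion of the algebraic closure of `k_∞`. -/
abbrev CInf := UniformSpace.Completion (AlgClInf Fq)

variable {Fq}

/-- The inclusion `k_∞ → C_∞`. -/
def toC : KInf Fq →+* CInf Fq :=
  (UniformSpace.Completion.coeRingHom (α := AlgClInf Fq)).comp
    (algebraMap (KInf Fq) (AlgClInf Fq))

variable (Fq) in
/-- The element `T` of `k_∞`. -/
def T : KInf Fq := HahnSeries.single (-1 : ℤ) 1

theorem norm_T : ‖T Fq‖ = (Fintype.card Fq : ℝ) := by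
  have h := LaurentSeries.valuation_single_zpow Fq (-1)
  rw [norm_eq_valuation, T, h, WithZeroMulInt.toNNReal_neg_apply _ WithZero.exp_ne_zero]
  simp [qReal, WithZero.exp]

theorem norm_toC (x : KInf Fq) : ‖toC x‖ = ‖x‖ := by
  change ‖((algebraMap (KInf Fq) (AlgClInf Fq) x : AlgClInf Fq) : CInf Fq)‖ = ‖x‖
  rw [UniformSpace.Completion.norm_coe]
  exact spectralNorm_extends x

/-- The inclusion `A = 𝔽_q[T] → k_∞`. -/
def polyToK : Fq[X] →ₐ[Fq] KInf Fq := Polynomial.aeval (T Fq)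

/-- The degree in `T` of a nonzero element of `k_∞`. -/
def deg (x : KInf Fq) : ℤ := - HahnSeries.order x

/-- The sign: the leading coefficient of the expansion in `1/T`. -/
def sgn (x : KInf Fq) : Fq := HahnSeries.leadingCoeff x

/-! ### The quadratic unit -/

variable (Fq) in
/-- A quadratic unit `f ∈ k_∞`, with minimal polynomial `X² - a X - b` where `a ∈ A` is monic and
`b ∈ 𝔽_q^×`, chosen so that `|f| > |f^*|` for the conjugate `f^* = a - f`.
(The degree of `a` is then positive and the polynomial is irreducible over `k`.) -/
structure QuadraticUnit where
  a : Fq[X]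
  b : Fq
  f : KInf Fq
  monic_a : a.Monic
  b_ne_zero : b ≠ 0
  eq_f : f ^ 2 = polyToK a * f + algebraMap Fq (KInf Fq) b
  dominant : ‖polyToK a - f‖ < ‖f‖

namespace QuadraticUnit

variable (U : QuadraticUnit Fq)

/-- The degree `d` of `a`. -/
def d : ℕ := U.a.natDegree

/-- The conjugate `f^*` of `f`. -/
def fstar : KInf Fq := polyToK U.a - U.f

/-- The square root `√D = f - f^*` of the discriminant `D = a² + 4b`. -/
def sqrtD : KInf Fq := U.f - U.fstar

/-- The sequence `Q_0 = 1, Q_1 = a, Q_{n+1} = a Q_n + b Q_{n-1}` in `A`. -/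
def Q : ℕ → Fq[X]
  | 0 => 1
  | 1 => U.a
  | n + 2 => U.a * Q (n + 1) + C U.b * Q n

/-- `ε_{N,l} = q^{-dN-l}`. -/
def eps (N l : ℕ) : ℝ := ((Fintype.card Fq : ℝ) ^ (U.d * N + l))⁻¹

/-- `Λ_ε(f) = {x ∈ A : |x f - x^⊥| < ε for some x^⊥ ∈ A}`, as a subset of `k_∞`. -/
def approx (ε : ℝ) : Set (KInf Fq) :=
  {y | ∃ x : Fq[X], polyToK x = y ∧ ∃ x' : Fq[X], ‖polyToK x * U.f - polyToK x'‖ < ε}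

/-- The ring `A_{∞₁} = 𝔽_q[f, fT, …, fT^{d-1}]`. -/
def ringA : Subalgebra Fq (KInf Fq) :=
  Algebra.adjoin Fq ((fun j : ℕ => U.f * T Fq ^ j) '' {j | j < U.d})

/-- The ideal `𝔞_i = (f, fT, …, fT^i)` of `A_{∞₁}`, `0 ≤ i ≤ d-1`, as an `A_{∞₁}`-submodule
of `k_∞`. -/
def idealA (i : ℕ) : Submodule U.ringA (KInf Fq) :=
  Submodule.span U.ringA ((fun j : ℕ => U.f * T Fq ^ j) '' {j | j ≤ i})

end QuadraticUnit

/-! ### Periods -/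

/-- The uniformizer `π`: it is `f^{-1/d}` if `d` is prime to `p`, and `(fT)^{-1/(d+1)}` otherwise;
the root in `k_∞` is the one of sign `1`, so that `x π^{deg x} / sgn x` is a `1`-unit. -/
def IsUniformizer (U : QuadraticUnit Fq) (ϖ : KInf Fq) : Prop :=
  sgn ϖ = 1 ∧
    (Nat.Coprime U.d (ringChar Fq) → ϖ ^ U.d * U.f = 1) ∧
    (¬ Nat.Coprime U.d (ringChar Fq) → ϖ ^ (U.d + 1) * (U.f * T Fq) = 1)

/-- The `1`-unit part `⟨x⟩ = x π^{deg x} / sgn x` of `x`. -/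
def oneUnit (ϖ x : KInf Fq) : KInf Fq :=
  x * ϖ ^ deg x * algebraMap Fq (KInf Fq) (sgn x)⁻¹

/-- The norm zeta function `Z_S(u) = ∑_{0 ≠ x ∈ S} u^{deg x}`, as a power series. -/
def zetaSeries (S : Set (KInf Fq)) : PowerSeries ℚ :=
  PowerSeries.mk fun n => (Set.ncard {x | x ∈ S ∧ x ≠ 0 ∧ deg x = (n : ℤ)} : ℚ)

/-- `Z_S` is (the expansion at `u = 0` of) a rational function `P / Q` which is regular at `u = 1`,
and `Z_S'(1) = t`. -/
def ZetaDerivAtOne (S : Set (KInf Fq)) (t : ℚ) : Prop :=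
  ∃ P Q : ℚ[X], Q.eval 1 ≠ 0 ∧ (Q : PowerSeries ℚ) * zetaSeries S = (P : PowerSeries ℚ) ∧
    t = (P.derivative.eval 1 * Q.eval 1 - P.eval 1 * Q.derivative.eval 1) / (Q.eval 1) ^ 2

/-- `ξ ∈ C_∞` is a period of `S ⊂ k_∞` : `ξ^{q-1} = η⁻¹ π^{-t} u^{q-1}`, where
`η` is the (eventually constant) limit of `∏_{deg x = M} sgn x`, `t = (q-1) Z_S'(1)`, and `u` is the
limit of `∏_{deg x ≤ M} ⟨x⟩`, the products being over the nonzero `x ∈ S`. -/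
def IsPeriod (ϖ : KInf Fq) (S : Set (KInf Fq)) (ξ : CInf Fq) : Prop :=
  ∃ (η : Fq) (t : ℤ) (u : KInf Fq),
    (∀ᶠ M : ℕ in atTop, ∏ᶠ x ∈ {x | x ∈ S ∧ x ≠ 0 ∧ deg x = (M : ℤ)}, sgn x = η) ∧
    (∃ z : ℚ, ZetaDerivAtOne S z ∧ (t : ℚ) = ((Fintype.card Fq : ℚ) - 1) * z) ∧
    Tendsto (fun M : ℕ => ∏ᶠ x ∈ {x | x ∈ S ∧ x ≠ 0 ∧ deg x ≤ (M : ℤ)}, oneUnit ϖ x)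
      atTop (𝓝 u) ∧
    ξ ^ (Fintype.card Fq - 1) =
      toC (algebraMap Fq (KInf Fq) η⁻¹ * ϖ ^ (-t) * u ^ (Fintype.card Fq - 1))

/-- A choice of periods `ξ_{ε_{N,l}}` (`N ≥ 1`, `0 ≤ l ≤ d-1`) of the `Λ_{ε_{N,l}}(f)` and
`ξ_i` (`0 ≤ i ≤ d-1`) of the `𝔞_i`.  Each of them is determined up to a `(q-1)`-th root of unity;
the roots are taken coherently, i.e. the quotient `ξ_{ε_{N,l}} / ξ_{d-1-l}`, which lies in `k_∞`,
has sign `1`. -/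
structure IsPeriodSystem (U : QuadraticUnit Fq) (ϖ : KInf Fq)
    (ξe : ℕ → ℕ → CInf Fq) (ξ : ℕ → CInf Fq) : Prop where
  period_ideal : ∀ i < U.d, IsPeriod ϖ (U.idealA i : Set (KInf Fq)) (ξ i)
  period_approx : ∀ N, 1 ≤ N → ∀ l < U.d, IsPeriod ϖ (U.approx (U.eps N l)) (ξe N l)
  coherent : ∀ N, 1 ≤ N → ∀ l < U.d,
    ∃ c : KInf Fq, sgn c = 1 ∧ ξe N l = toC c * ξ (U.d - 1 - l)

/-! ### Exponentials, lattices, Hayes modules -/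

/-- The exponential `exp_Λ(z) = z ∏_{0 ≠ x ∈ Λ} (1 - z/x)`. -/
def expLat (Λ : Set (CInf Fq)) (z : CInf Fq) : CInf Fq :=
  z * ∏' x : {x : CInf Fq // x ∈ Λ ∧ x ≠ 0}, (1 - z / (x : CInf Fq))

/-- `ξ S ⊂ C_∞` for `ξ ∈ C_∞` and `S ⊂ k_∞`. -/
def scale (ξ : CInf Fq) (S : Set (KInf Fq)) : Set (CInf Fq) :=
  (fun x => ξ * toC x) '' S

/-- The polynomial `ρ_α(x) = α x ∏ (1 - x / exp_Λ(y))`, the product being over the nonzero classes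
`y ∈ α⁻¹Λ / Λ`, of the Drinfeld module `ρ` with lattice `Λ`, so that
`exp_Λ(α z) = ρ_α(exp_Λ(z))`. -/
def drinfeldPoly (Λ : Set (CInf Fq)) (α : CInf Fq) : (CInf Fq)[X] :=
  C α * X * ∏ᶠ μ ∈ {μ | μ ≠ 0 ∧ ∃ y, α * y ∈ Λ ∧ μ = expLat Λ y}, (1 - C μ⁻¹ * X)

variable (Fq) in
/-- The ring `C_∞{τ}` of `𝔽_q`-additive polynomials (spanned by the `x^{q^k}`); its
multiplication is the composition. -/
def additivePolys : Submodule (CInf Fq) (CInf Fq)[X] :=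
  Submodule.span (CInf Fq) (Set.range fun k : ℕ => X ^ (Fintype.card Fq ^ k))

/-- The left ideal of `C_∞{τ}` generated by `S`. -/
def leftIdeal (S : Set (CInf Fq)[X]) : AddSubgroup (CInf Fq)[X] :=
  AddSubgroup.closure {R | ∃ P ∈ additivePolys Fq, ∃ s ∈ S, R = P.comp s}

/-- `G` is a monic generator of the (principal) left ideal of `C_∞{τ}` generated by `S`. -/
def IsMonicGenerator (S : Set (CInf Fq)[X]) (G : (CInf Fq)[X]) : Prop :=
  G.Monic ∧ G ∈ additivePolys Fq ∧
    (leftIdeal S : Set (CInf Fq)[X]) = {R | ∃ P ∈ additivePolys Fq, R = P.comp G}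

namespace QuadraticUnit

variable (U : QuadraticUnit Fq)

/-- The exponential `e_i` of the lattice `Λ_i = ξ_i 𝔞_i`. -/
def expIdeal (ξ : ℕ → CInf Fq) (i : ℕ) : CInf Fq → CInf Fq :=
  expLat (scale (ξ i) (U.idealA i))

/-- `Φ` is the Hayes isogeny `Φ_i` : the monic generator of the left ideal generated by the
polynomials `ρ_{0,α}`, `α ∈ 𝔞_i`, where `ρ_0` is the Hayes module with lattice `Λ_0 = ξ_0 𝔞_0`. -/
def IsHayesIsogeny (ξ : ℕ → CInf Fq) (i : ℕ) (Φ : (CInf Fq)[X]) : Prop :=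
  IsMonicGenerator
    {P | ∃ α ∈ U.idealA i, P = drinfeldPoly (scale (ξ 0) (U.idealA 0)) (toC α)} Φ

/-! ### Quantum points -/

/-- The normalized vector space `ξ_ε Λ_ε(f)`, `ε = ε_{N,l}`. -/
def breve (ξe : ℕ → ℕ → CInf Fq) (N l : ℕ) : Set (CInf Fq) :=
  scale (ξe N l) (U.approx (U.eps N l))

/-- The exponential `e_{ε_{N,l}}` of `ξ_ε Λ_ε(f)`, `ε = ε_{N,l}`. -/
def expApprox (ξe : ℕ → ℕ → CInf Fq) (N l : ℕ) : CInf Fq → CInf Fq :=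
  expLat (U.breve ξe N l)

/-- The shift `ψ_{N,l}`: the homothety by `(ξ_{ε_{N+1,l}} / ξ_{ε_{N,l}}) f`. -/
def shift (ξe : ℕ → ℕ → CInf Fq) (N l : ℕ) (z : CInf Fq) : CInf Fq :=
  ξe (N + 1) l / ξe N l * toC U.f * z

/-- The sequence of the shifts of `z`: the term with index `1` is `(ξ_{ε_{1,l}} f / √D) z`, and the
term with index `N+1` is the image under `ψ_{N,l}` of the term with index `N`, for `N ≥ 1`.
(The term with index `0` is not used.) -/
def shiftSeq (ξe : ℕ → ℕ → CInf Fq) (l : ℕ) (z : CInf Fq) : ℕ → CInf Fq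
  | 0 => 0
  | 1 => ξe 1 l * toC U.f / toC U.sqrtD * z
  | N + 2 => U.shift ξe (N + 1) l (shiftSeq ξe l z (N + 1))

/-- `y N`, `N ≥ 1`, represents the class of the `N`-th shift of `z` (for `l = d-1`) modulo the
vector space `ξ_ε Λ_ε(f)`, `ε = ε_{N,d-1}`, and modulo the elements of absolute value `< δ N`,
where `δ N → 0`. -/
def IsRepresentative (ξe : ℕ → ℕ → CInf Fq) (z : CInf Fq) (y : ℕ → CInf Fq) : Prop :=
  ∃ δ : ℕ → ℝ, Tendsto δ atTop (𝓝 0) ∧ ∀ N, 1 ≤ N →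
    ∃ x ∈ U.breve ξe N (U.d - 1), ‖y N - (U.shiftSeq ξe (U.d - 1) z N + x)‖ < δ N

/-- The approximate isogeny `Φ_{N,l}(x) = x ∏ (x - e_ε(ξ_ε α))`, `ε = ε_{N,d-1}`, the product
being over the nonzero `α` in the `𝔽_q`-span of `Q_N T, …, Q_N T^{d-1-l}`.
For `l = d-1` it is the identity. -/
def approxIsogeny (ξe : ℕ → ℕ → CInf Fq) (N l : ℕ) : (CInf Fq)[X] :=
  X * ∏ᶠ α ∈ {α : Fq[X] | α ≠ 0 ∧ α ∈ Submodule.span Fq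
      ((fun j : ℕ => U.Q N * X ^ j) '' {j | 1 ≤ j ∧ j ≤ U.d - 1 - l})},
    (X - C (U.expApprox ξe N (U.d - 1) (ξe N (U.d - 1) * toC (polyToK α))))

/-- The points `w_{N,d-1} = e_{ε_{N,d-1}}(y N)` and `w_{N,l} = Φ_{N,l}(w_{N,d-1})`. -/
def pointSeq (ξe : ℕ → ℕ → CInf Fq) (y : ℕ → CInf Fq) (N l : ℕ) : CInf Fq :=
  (U.approxIsogeny ξe N l).eval (U.expApprox ξe N (U.d - 1) (y N))

/-- The quantum point: the set of the limits, for `N → ∞`, of the sequences `w_{N,l}`,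
`0 ≤ l ≤ d-1`. -/
def quantumPoint (ξe : ℕ → ℕ → CInf Fq) (y : ℕ → CInf Fq) : Set (CInf Fq) :=
  {w | ∃ l < U.d, Tendsto (fun N => U.pointSeq ξe y N l) atTop (𝓝 w)}

end QuadraticUnit

end QuantumDrinfeld

end

open Polynomial Filter Topology
open scoped NNReal WithZero

noncomputable section

namespace QuantumDrinfeld

set_option linter.unusedSectionVars false

variable {Fq : Type*} [Field Fq] [Fintype Fq]

/-! Put `i = d-1-l`. Both `𝔞_i` and `Λ_{ε_{N,l}}(f)` have explicit `𝔽_q`-bases of sign `1` and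
strictly increasing degree. For `𝔞_i` the basis consists of the `f^k T^j`, `j < d`, with `k = 1`, `j
≤ i`, or with `k ≥ 2` (`mem_idealA_iff`); for `Λ_{ε_{N,l}}(f)` it consists of the `Q_{N-1+k} T^j`
with the same pairs `(k, j)` (`approx_eq`). By Binet's formula `√D Q_n = f^{n+1} - (f^*)^{n+1}`,
multiplication by `√D f^{-N}` carries the second basis to the first up to a relative error `q^{-N}`,
uniformly in the basis element (`norm_scaleFactor_mul_approxSeq_sub_le`). Since the degrees are
distinct, the whole span inherits this error. It is the source of every limit.

Periods. For the span of such a sequence `η = -1`, the function `Z_S` is rational with `Z_S(1) =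
-1`, and `u` exists and varies with the sequence no more than the relative error. Scaling the
sequence changes `u` and `π^{-t}` in an explicit way. Hence `ξ_{N,l} = √D f^{-N} κ_N ξ_{d-1-l}` with
`|κ_N - 1| ≤ q^{-N}` (`exists_eq_mul`), coherence having removed the root of unity. For `l = d-1` it
follows that the normalized spaces converge to `Λ_0`, that their exponentials converge to `e_0`
(`tendsto_expApprox`), and that the shifts of `z` telescope to `κ_N ξ_0 z` (`shiftSeq_eq`).

So `w_{N,d-1}` tends to `e_0(ξ_0 z)`, and the zeros `e_{N,d-1}(ξ_{N,d-1} Q_N T^j)` tend to `e_0(ξ_0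
f T^j)`. As `𝔞_i = 𝔞_0 ⊕ ⟨fT, …, fT^i⟩`, the isogeny `Φ_{N,l}` tends to the monic polynomial whose
zeros are the finite space `e_0(ξ_0 𝔞_{d-1-l})` (`tendsto_pointSeq`).

Hayes isogenies. The zeros of `ρ_{0,α}` are the `e_0(y)` with `αy ∈ Λ_0`, so the common zeros for `α
∈ 𝔞_i` form `e_0(ξ_0 (𝔞_0 : 𝔞_i))`. The relation `f T^d = f^2 - b - …` gives `(𝔞_0 : 𝔞_i) =
𝔞_{d-i}`. Right division makes left ideals of `C_∞{τ}` principal, and the generator is the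
polynomial of the intersection of the kernels (`isMonicGenerator_subspacePoly`). Hence `Φ_i` has the
zeros `e_0(ξ_0 𝔞_{d-i})` (`isHayesIsogeny`): the limit of `Φ_{N,l}` is `Φ_{l+1}` for `l < d-1` and
the identity for `l = d-1`. -/

/-! ### Norm, degree and sign on `k_∞`. -/

theorem one_lt_card_real : (1 : ℝ) < Fintype.card Fq := by
  exact_mod_cast Fintype.one_lt_card (α := Fq)

theorem norm_eq_zpow_deg {x : KInf Fq} (hx : x ≠ 0) : ‖x‖ = (Fintype.card Fq : ℝ) ^ deg x := by
  have h1 : Valued.v x ≤ WithZero.exp (-HahnSeries.order x) :=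
    (LaurentSeries.valuation_le_iff_coeff_lt_eq_zero Fq).2
      fun n hn => HahnSeries.coeff_eq_zero_of_lt_order hn
  have h2 : ¬ Valued.v x ≤ WithZero.exp (-(HahnSeries.order x + 1)) := by
    rw [LaurentSeries.valuation_le_iff_coeff_lt_eq_zero Fq]
    intro h
    exact hx (HahnSeries.coeff_order_eq_zero.1 (h _ (by simp)))
  have h0 : Valued.v x ≠ 0 := by simpa using hx
  have h3 : Valued.v x = WithZero.exp (deg x) := by
    rw [← WithZero.exp_log h0] at h1 h2 ⊢
    rw [WithZero.exp_le_exp] at h1 h2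
    congr 1
    unfold deg
    omega
  rw [norm_eq_valuation, h3, WithZeroMulInt.toNNReal_neg_apply _ WithZero.exp_ne_zero]
  simp [qReal, WithZero.exp]

theorem deg_lt_deg_iff {x y : KInf Fq} (hx : x ≠ 0) (hy : y ≠ 0) : deg x < deg y ↔ ‖x‖ < ‖y‖ := by
  rw [norm_eq_zpow_deg hx, norm_eq_zpow_deg hy, zpow_lt_zpow_iff_right₀ one_lt_card_real]

theorem deg_eq_of_norm {x : KInf Fq} {n : ℤ} (h : ‖x‖ = (Fintype.card Fq : ℝ) ^ n) :
    deg x = n := by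
  have hx : x ≠ 0 := by
    rintro rfl
    rw [norm_zero] at h
    exact (zpow_pos (zero_lt_one.trans one_lt_card_real) n).ne h
  rw [norm_eq_zpow_deg hx] at h
  exact zpow_right_injective₀ (zero_lt_one.trans one_lt_card_real) one_lt_card_real.ne' h

theorem sgn_mul (x y : KInf Fq) : sgn (x * y) = sgn x * sgn y := HahnSeries.leadingCoeff_mul x y

theorem sgn_one : sgn (1 : KInf Fq) = 1 := HahnSeries.leadingCoeff_one

theorem sgn_eq_zero {x : KInf Fq} : sgn x = 0 ↔ x = 0 := HahnSeries.leadingCoeff_eq_zero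

theorem ne_zero_of_sgn_eq_one {x : KInf Fq} (h : sgn x = 1) : x ≠ 0 := by
  rintro rfl
  rw [sgn_eq_zero.2 rfl] at h
  exact zero_ne_one h

variable (Fq) in
/-- The sign as a multiplicative homomorphism. -/
def sgnHom : KInf Fq →*₀ Fq where
  toFun := sgn
  map_zero' := sgn_eq_zero.2 rfl
  map_one' := sgn_one
  map_mul' := sgn_mul

theorem sgn_pow (x : KInf Fq) (n : ℕ) : sgn (x ^ n) = sgn x ^ n := map_pow (sgnHom Fq) x n

theorem sgn_zpow (x : KInf Fq) (n : ℤ) : sgn (x ^ n) = sgn x ^ n := map_zpow₀ (sgnHom Fq) x n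

theorem sgn_div (x y : KInf Fq) : sgn (x / y) = sgn x / sgn y := map_div₀ (sgnHom Fq) x y

theorem deg_mul {x y : KInf Fq} (hx : x ≠ 0) (hy : y ≠ 0) : deg (x * y) = deg x + deg y := by
  unfold deg
  rw [HahnSeries.order_mul hx hy]
  ring

theorem algebraMap_eq_C (c : Fq) : algebraMap Fq (KInf Fq) c = HahnSeries.C c :=
  LaurentSeries.algebraMap_apply Fq c

theorem sgn_algebraMap (c : Fq) : sgn (algebraMap Fq (KInf Fq) c) = c := by
  rw [algebraMap_eq_C]
  exact HahnSeries.leadingCoeff_of_single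

theorem deg_algebraMap (c : Fq) : deg (algebraMap Fq (KInf Fq) c) = 0 := by
  rw [algebraMap_eq_C, deg, HahnSeries.order_C, neg_zero]

theorem algebraMap_ne_zero {c : Fq} (hc : c ≠ 0) : algebraMap Fq (KInf Fq) c ≠ 0 := by
  simpa using hc

theorem norm_algebraMap_KInf {c : Fq} (hc : c ≠ 0) : ‖algebraMap Fq (KInf Fq) c‖ = 1 := by
  rw [norm_eq_zpow_deg (algebraMap_ne_zero hc), deg_algebraMap, zpow_zero]

theorem norm_algebraMap_le_one (c : Fq) : ‖algebraMap Fq (KInf Fq) c‖ ≤ 1 := by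
  rcases eq_or_ne c 0 with rfl | hc
  · simp
  · exact (norm_algebraMap_KInf hc).le

theorem sgn_T : sgn (T Fq) = 1 := HahnSeries.leadingCoeff_of_single

theorem T_ne_zero : T Fq ≠ 0 := ne_zero_of_sgn_eq_one sgn_T

theorem sgn_add_of_norm_lt {x y : KInf Fq} (h : ‖y‖ < ‖x‖) : sgn (x + y) = sgn x := by
  rcases eq_or_ne y 0 with rfl | hy
  · rw [add_zero]
  have hx : x ≠ 0 := by
    rintro rfl
    rw [norm_zero] at h
    exact absurd h (norm_nonneg y).not_gt
  refine HahnSeries.leadingCoeff_add_eq_left ?_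
  rw [← HahnSeries.order_eq_orderTop_of_ne_zero hx, ← HahnSeries.order_eq_orderTop_of_ne_zero hy]
  have := (deg_lt_deg_iff hy hx).2 h
  unfold deg at this
  exact_mod_cast neg_lt_neg_iff.1 this

theorem norm_add_of_norm_lt {L : Type*} [NormedField L] [IsUltrametricDist L] {x y : L}
    (h : ‖y‖ < ‖x‖) : ‖x + y‖ = ‖x‖ := by
  rw [IsUltrametricDist.norm_add_eq_max_of_norm_ne_norm h.ne', max_eq_left h.le]

/-- The value group is `q^ℤ`, so a strict bound gains a whole factor `q`. -/
theorem norm_le_of_norm_lt {x : KInf Fq} {n : ℤ} (h : ‖x‖ < (Fintype.card Fq : ℝ) ^ n) :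
    ‖x‖ ≤ (Fintype.card Fq : ℝ) ^ (n - 1) := by
  rcases eq_or_ne x 0 with rfl | hx
  · rw [norm_zero]; positivity
  rw [norm_eq_zpow_deg hx] at h ⊢
  rw [zpow_lt_zpow_iff_right₀ one_lt_card_real] at h
  rw [zpow_le_zpow_iff_right₀ one_lt_card_real]
  omega

/-- Two elements of the same absolute value and sign differ by an element of smaller absolute
value. -/
theorem norm_sub_lt_of_sgn_eq {x y : KInf Fq} (hx : x ≠ 0) (h : ‖x‖ = ‖y‖) (hs : sgn x = sgn y) :
    ‖x - y‖ < ‖x‖ := by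
  have hle : ‖x - y‖ ≤ ‖x‖ := by
    rw [sub_eq_add_neg]
    refine (IsUltrametricDist.norm_add_le_max x (-y)).trans ?_
    rw [norm_neg, h, max_self]
  refine lt_of_le_of_ne hle fun he => ?_
  have hxy : x - y ≠ 0 := by
    intro h0
    rw [h0, norm_zero] at he
    exact hx (norm_eq_zero.1 he.symm)
  have hy : y ≠ 0 := by
    rintro rfl
    rw [norm_zero] at h
    exact hx (norm_eq_zero.1 h)
  have hd : deg (x - y) = deg x := deg_eq_of_norm (he.trans (norm_eq_zpow_deg hx))
  have hd' : deg y = deg x := deg_eq_of_norm (h.symm.trans (norm_eq_zpow_deg hx))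
  unfold deg at hd hd'
  unfold sgn at hs
  rw [neg_inj] at hd hd'
  apply HahnSeries.coeff_order_eq_zero.not.2 hxy
  rw [hd, HahnSeries.coeff_sub, sub_eq_zero, ← HahnSeries.leadingCoeff_eq, hs,
    HahnSeries.leadingCoeff_eq, hd']

theorem norm_sub_one_le {x : KInf Fq} (hx : ‖x‖ = 1) (hs : sgn x = 1) :
    ‖x - 1‖ ≤ (Fintype.card Fq : ℝ)⁻¹ := by
  have h := norm_sub_lt_of_sgn_eq (x := x) (y := 1) (ne_zero_of_sgn_eq_one hs)
    (by rw [hx, norm_one]) (hs.trans sgn_one.symm)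
  rw [hx, ← zpow_zero (Fintype.card Fq : ℝ)] at h
  simpa using norm_le_of_norm_lt h

theorem tendsto_iff_forall_norm_sub_lt {L : Type*} [SeminormedAddCommGroup L] {f : ℕ → L} {u : L} :
    Tendsto f atTop (𝓝 u) ↔ ∀ ε > 0, ∃ n₀, ∀ n ≥ n₀, ‖f n - u‖ < ε := by
  simp only [Metric.tendsto_atTop, dist_eq_norm]

theorem tendsto_KInf_iff {f : ℕ → KInf Fq} {u : KInf Fq} :
    Tendsto f atTop (𝓝 u) ↔ ∀ ε > 0, ∃ n₀, ∀ n ≥ n₀, ‖f n - u‖ < ε :=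
  tendsto_iff_forall_norm_sub_lt

/-! ### The ultrametric and `𝔽_q`-linear structure of `C_∞`. -/

instance instUltraAlgClInf : IsUltrametricDist (AlgClInf Fq) :=
  IsUltrametricDist.isUltrametricDist_of_isNonarchimedean_norm isNonarchimedean_spectralNorm

instance instUltraCInf : IsUltrametricDist (CInf Fq) := by
  refine IsUltrametricDist.isUltrametricDist_of_isNonarchimedean_norm fun x y => ?_
  induction x, y using UniformSpace.Completion.induction_on₂ with
  | hp => exact isClosed_le (by fun_prop) (by fun_prop)
  | ih x y =>
    rw [← UniformSpace.Completion.coe_add]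
    simp only [UniformSpace.Completion.norm_coe]
    exact IsUltrametricDist.norm_add_le_max x y

/-- Defined through `k_∞`, so that compatibility with `toC` holds by definition. -/
instance instAlgebraCInf : Algebra Fq (CInf Fq) :=
  ((toC (Fq := Fq)).comp (algebraMap Fq (KInf Fq))).toAlgebra

instance instSMulCInf : SMul Fq (CInf Fq) := Algebra.toSMul

theorem algebraMap_CInf (c : Fq) : algebraMap Fq (CInf Fq) c = toC (algebraMap Fq (KInf Fq) c) :=
  rfl

/-! ### Spans of sequences, indexed by polynomials, and the additive polynomials of flags. -/

section Seq

variable {Fq : Type*} [Field Fq] [Fintype Fq] {L : Type*} [Field L] [Algebra Fq L]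

/-- The additive map `∑ cₙ Xⁿ ↦ ∑ cₙ gₙ`. -/
def seqEval (g : ℕ → L) : Fq[X] →+ L where
  toFun p := p.sum fun n c => algebraMap Fq L c * g n
  map_zero' := by simp
  map_add' p p' := by
    refine Polynomial.sum_add_index p p' _ (fun n => ?_) fun n c c' => ?_
    · rw [map_zero, zero_mul]
    · rw [map_add, add_mul]

theorem seqEval_monomial (g : ℕ → L) (n : ℕ) (c : Fq) :
    seqEval g (C c * X ^ n) = algebraMap Fq L c * g n := by
  rw [C_mul_X_pow_eq_monomial]
  exact Polynomial.sum_monomial_index c (fun n c => algebraMap Fq L c * g n) (by rw [map_zero, zero_mul])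

theorem seqEval_X_pow (g : ℕ → L) (n : ℕ) : seqEval (Fq := Fq) g (X ^ n) = g n := by
  simpa using seqEval_monomial (Fq := Fq) g n 1

theorem seqEval_C_mul (g : ℕ → L) (c : Fq) (p : Fq[X]) :
    seqEval g (C c * p) = algebraMap Fq L c * seqEval g p := by
  induction p using Polynomial.induction_on' with
  | add p p' h h' => rw [mul_add, map_add, map_add, mul_add, h, h']
  | monomial n a =>
    rw [← C_mul_X_pow_eq_monomial, ← mul_assoc, ← C_mul, seqEval_monomial, seqEval_monomial,
      map_mul, mul_assoc]

theorem seqEval_eq_sum (g : ℕ → L) (p : Fq[X]) :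
    seqEval g p = ∑ n ∈ p.support, algebraMap Fq L (p.coeff n) * g n := rfl

theorem map_seqEval {L' : Type*} [Field L'] [Algebra Fq L'] (φ : L →+ L')
    (hφ : ∀ (c : Fq) x, φ (algebraMap Fq L c * x) = algebraMap Fq L' c * φ x) (g : ℕ → L)
    (p : Fq[X]) : φ (seqEval g p) = seqEval (fun n => φ (g n)) p := by
  simp only [seqEval_eq_sum, map_sum, hφ]

variable (Fq) in
open Classical in
/-- The finite set of the polynomials of degree less than `r`. -/
def polysLT : ℕ → Finset Fq[X]
  | 0 => {0}
  | r + 1 => (Finset.univ ×ˢ polysLT r).image fun cp => cp.2 + C cp.1 * X ^ r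

theorem mem_polysLT {r : ℕ} {p : Fq[X]} : p ∈ polysLT Fq r ↔ p.degree < r := by
  classical
  induction r generalizing p with
  | zero => simp [polysLT, Nat.WithBot.lt_zero_iff]
  | succ r ih =>
    simp only [polysLT, Finset.mem_image, Finset.mem_product, Finset.mem_univ, true_and, Prod.exists,
      ih]
    constructor
    · rintro ⟨c, p', hp', rfl⟩
      refine (degree_add_le _ _).trans_lt (max_lt (hp'.trans ?_) ?_)
      · exact_mod_cast Nat.lt_succ_self r
      · exact (degree_C_mul_X_pow_le r c).trans_lt (by exact_mod_cast Nat.lt_succ_self r)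
    · intro hp
      refine ⟨p.coeff r, p - C (p.coeff r) * X ^ r, ?_, by ring⟩
      rw [degree_lt_iff_coeff_zero] at hp ⊢
      intro m hm
      rcases hm.eq_or_lt with rfl | hm
      · simp
      · rw [coeff_sub, hp m hm, coeff_C_mul_X_pow, if_neg hm.ne', sub_zero]

theorem zero_mem_polysLT (r : ℕ) : (0 : Fq[X]) ∈ polysLT Fq r := by
  rw [mem_polysLT, degree_zero]
  exact WithBot.bot_lt_coe r

/-- The coefficient of `X ^ r` is split off; every induction along a flag rests on this formula. -/
theorem prod_polysLT_succ {M : Type*} [CommMonoid M] (r : ℕ) (h : Fq[X] → M) :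
    ∏ p ∈ polysLT Fq (r + 1), h p = ∏ c : Fq, ∏ p ∈ polysLT Fq r, h (p + C c * X ^ r) := by
  classical
  rw [polysLT, Finset.prod_image, Finset.prod_product]
  rintro ⟨c, p⟩ hp ⟨c', p'⟩ hp' heq
  simp only [Finset.coe_product, Set.mem_prod, Finset.mem_coe, mem_polysLT] at hp hp' heq
  have h1 := congr_arg (fun P => coeff P r) heq
  simp only [coeff_add, coeff_C_mul, coeff_X_pow_self, mul_one,
    coeff_eq_zero_of_degree_lt hp.2, coeff_eq_zero_of_degree_lt hp'.2, zero_add] at h1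
  subst h1
  simpa using heq

theorem card_polysLT (r : ℕ) : (polysLT Fq r).card = Fintype.card Fq ^ r := by
  induction r with
  | zero => simp [polysLT]
  | succ r ih =>
    -- Counting is a product in `Multiplicative ℕ`, so the product formula applies to it.
    have := prod_polysLT_succ (Fq := Fq) (M := Multiplicative ℕ) r fun _ => Multiplicative.ofAdd 1
    simp only [Finset.prod_const, Finset.card_univ, ih, ← ofAdd_nsmul] at this
    have h := congr_arg Multiplicative.toAdd this
    simp only [toAdd_ofAdd, smul_eq_mul, mul_one] at h
    rw [h, pow_succ']

theorem prod_X_sub_C_univ : ∏ c : Fq, (X - C c) = X ^ Fintype.card Fq - X := by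
  have h := Fintype.one_lt_card (α := Fq)
  have hm : (X ^ Fintype.card Fq - X : Fq[X]).Monic :=
    monic_X_pow_sub (by rw [degree_X]; exact_mod_cast h)
  rw [← prod_multiset_X_sub_C_of_monic_of_roots_card_eq hm, FiniteField.roots_X_pow_card_sub_X]
  · rfl
  · rw [FiniteField.roots_X_pow_card_sub_X, FiniteField.X_pow_card_sub_X_natDegree_eq Fq h]
    rfl

variable {R : Type*} [CommRing R] [Algebra L R] [Algebra Fq R] [IsScalarTower Fq L R]

/-- The identity `∏ (X - c) = X^q - X`, homogenized by `y`; dividing by `y` forces the separate case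
`y = 0`. The ring `R` is arbitrary because both values in `L` and polynomials over `L` are needed.
-/
theorem prod_sub_algebraMap_mul (y : L) (A : R) :
    ∏ c : Fq, (A - algebraMap L R (algebraMap Fq L c * y)) =
      A ^ Fintype.card Fq - algebraMap L R (y ^ (Fintype.card Fq - 1)) * A := by
  have hq : Fintype.card Fq ≠ 0 := Fintype.card_ne_zero
  have hq1 : Fintype.card Fq - 1 ≠ 0 := by
    have := Fintype.one_lt_card (α := Fq)
    omega
  rcases eq_or_ne y 0 with rfl | hy
  · simp [hq1]
  set B := algebraMap L R y⁻¹ * A with hB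
  have hA : A = algebraMap L R y * B := by
    rw [hB, ← mul_assoc, ← map_mul, mul_inv_cancel₀ hy, map_one, one_mul]
  have key : ∏ c : Fq, (B - algebraMap Fq R c) = B ^ Fintype.card Fq - B := by
    have := congr_arg (aeval B) (prod_X_sub_C_univ (Fq := Fq))
    simpa [map_prod] using this
  have : ∀ c : Fq, A - algebraMap L R (algebraMap Fq L c * y) =
      algebraMap L R y * (B - algebraMap Fq R c) := by
    intro c
    rw [hA, IsScalarTower.algebraMap_apply Fq L R, map_mul]
    ring
  simp only [this]
  have hpow : algebraMap L R (y ^ (Fintype.card Fq - 1)) * algebraMap L R y =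
      algebraMap L R y ^ Fintype.card Fq := by
    rw [← map_mul, ← pow_succ, Nat.sub_add_cancel (by omega), map_pow]
  clear_value B
  subst hA
  rw [Finset.prod_mul_distrib, key, Finset.prod_const, Finset.card_univ, mul_sub, mul_pow,
    ← mul_assoc (algebraMap L R _), hpow]

/-- The additive polynomial `∏ (x - v)`, the product being over the span of the first `r` terms
of `g`. -/
def flagProd (g : ℕ → L) (r : ℕ) (x : R) : R :=
  ∏ p ∈ polysLT Fq r, (x - algebraMap L R (seqEval g p))

theorem flagProd_zero (g : ℕ → L) (x : R) : flagProd (Fq := Fq) g 0 x = x := by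
  simp [flagProd, polysLT]

theorem flagProd_succ_eq_prod (g : ℕ → L) (r : ℕ) (x : R) :
    flagProd (Fq := Fq) g (r + 1) x =
      ∏ c : Fq, flagProd (Fq := Fq) g r (x - algebraMap L R (algebraMap Fq L c * g r)) := by
  rw [flagProd, prod_polysLT_succ]
  refine Finset.prod_congr rfl fun c _ => Finset.prod_congr rfl fun p _ => ?_
  rw [map_add, seqEval_monomial, map_add]
  ring

theorem algebraMap_flagProd (g : ℕ → L) (r : ℕ) (x : L) :
    algebraMap L R (flagProd (Fq := Fq) g r x) = flagProd (Fq := Fq) g r (algebraMap L R x) := by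
  simp [flagProd, map_prod]

/-- A family of maps given by the recursion of the polynomials attached to a flag is additive and
`Fq`-linear. -/
theorem additive_of_recursion {a : L} {φ ψ : R → R}
    (hψ : ∀ x, ψ x = φ x ^ Fintype.card Fq - algebraMap L R a * φ x)
    (hadd : ∀ x y, φ (x + y) = φ x + φ y)
    (hsmul : ∀ (c : Fq) x, φ (algebraMap Fq R c * x) = algebraMap Fq R c * φ x) :
    (∀ x y, ψ (x + y) = ψ x + ψ y) ∧
      ∀ (c : Fq) x, ψ (algebraMap Fq R c * x) = algebraMap Fq R c * ψ x := by
  have hF : ∀ x y : R, (x + y) ^ Fintype.card Fq = x ^ Fintype.card Fq + y ^ Fintype.card Fq :=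
    fun x y => map_add (FiniteField.frobeniusAlgHom Fq R) x y
  constructor
  · intro x y
    rw [hψ, hψ, hψ, hadd, hF]
    ring
  · intro c x
    rw [hψ, hψ, hsmul, mul_pow, ← map_pow, FiniteField.pow_card]
    ring

/-- The three claims need one induction: additivity at stage `r` turns the product over `c` into the
recursion, and the recursion passes additivity on to stage `r + 1`, because the `q`-Frobenius is
additive. -/
theorem flagProd_additive_aux (g : ℕ → L) (r : ℕ) :
    (∀ x y : R, flagProd (Fq := Fq) g r (x + y) =
      flagProd (Fq := Fq) g r x + flagProd (Fq := Fq) g r y) ∧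
    (∀ (c : Fq) (x : R), flagProd (Fq := Fq) g r (algebraMap Fq R c * x) =
      algebraMap Fq R c * flagProd (Fq := Fq) g r x) ∧
    ∀ x : R, flagProd (Fq := Fq) g (r + 1) x = flagProd (Fq := Fq) g r x ^ Fintype.card Fq -
      algebraMap L R (flagProd (Fq := Fq) g r (g r) ^ (Fintype.card Fq - 1)) *
        flagProd (Fq := Fq) g r x := by
  have step : ∀ r, (∀ x y : R, flagProd (Fq := Fq) g r (x + y) =
        flagProd (Fq := Fq) g r x + flagProd (Fq := Fq) g r y) →
      (∀ (c : Fq) (x : R), flagProd (Fq := Fq) g r (algebraMap Fq R c * x) =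
        algebraMap Fq R c * flagProd (Fq := Fq) g r x) →
      ∀ x : R, flagProd (Fq := Fq) g (r + 1) x = flagProd (Fq := Fq) g r x ^ Fintype.card Fq -
        algebraMap L R (flagProd (Fq := Fq) g r (g r) ^ (Fintype.card Fq - 1)) *
          flagProd (Fq := Fq) g r x := by
    intro r hadd hsmul x
    rw [flagProd_succ_eq_prod, ← prod_sub_algebraMap_mul (Fq := Fq)]
    refine Finset.prod_congr rfl fun c _ => ?_
    have hneg : ∀ y : R, flagProd (Fq := Fq) g r (-y) = -flagProd (Fq := Fq) g r y := by
      intro y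
      have := hsmul (-1) y
      simpa using this
    rw [sub_eq_add_neg, hadd, hneg, map_mul, ← IsScalarTower.algebraMap_apply, hsmul, map_mul,
      ← IsScalarTower.algebraMap_apply, algebraMap_flagProd, sub_eq_add_neg]
  induction r with
  | zero =>
    refine ⟨fun x y => by simp only [flagProd_zero], fun c x => by simp only [flagProd_zero],
      step 0 (fun x y => by simp only [flagProd_zero]) fun c x => by simp only [flagProd_zero]⟩
  | succ r ih =>
    obtain ⟨h1, h2, h3⟩ := ih
    obtain ⟨h1', h2'⟩ := additive_of_recursion (Fq := Fq) h3 h1 h2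
    exact ⟨h1', h2', step _ h1' h2'⟩

theorem flagProd_succ (g : ℕ → L) (r : ℕ) (x : R) :
    flagProd (Fq := Fq) g (r + 1) x = flagProd (Fq := Fq) g r x ^ Fintype.card Fq -
      algebraMap L R (flagProd (Fq := Fq) g r (g r) ^ (Fintype.card Fq - 1)) *
        flagProd (Fq := Fq) g r x :=
  (flagProd_additive_aux g r).2.2 x

theorem flagProd_algebraMap_mul (g : ℕ → L) (r : ℕ) (c : Fq) (x : R) :
    flagProd (Fq := Fq) g r (algebraMap Fq R c * x) =
      algebraMap Fq R c * flagProd (Fq := Fq) g r x :=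
  (flagProd_additive_aux g r).2.1 c x

end Seq

/-! ### Products in ultrametric fields -/

section Ultra

variable {L : Type*} [NormedField L] [IsUltrametricDist L] {ι : Type*}

theorem norm_sub_le_max_of_ultra (x y : L) : ‖x - y‖ ≤ max ‖x‖ ‖y‖ := by
  rw [sub_eq_add_neg, ← norm_neg y]
  exact IsUltrametricDist.norm_add_le_max x (-y)

theorem norm_eq_of_norm_sub_lt {x y : L} (h : ‖x - y‖ < ‖y‖) : ‖x‖ = ‖y‖ := by
  have := norm_add_of_norm_lt h
  rwa [add_sub_cancel] at this

/-- Telescoping, one factor at a time. The condition `1 ≤ B i` allows the bound of the factor being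
replaced to be put back into the product. -/
theorem norm_prod_sub_prod_le {s : Finset ι} {a b : ι → L} {B : ι → ℝ} {δ : ℝ} (hδ : 0 ≤ δ)
    (hB : ∀ i ∈ s, 1 ≤ B i) (ha : ∀ i ∈ s, ‖a i‖ ≤ B i) (hb : ∀ i ∈ s, ‖b i‖ ≤ B i)
    (hab : ∀ i ∈ s, ‖a i - b i‖ ≤ δ) :
    ‖∏ i ∈ s, a i - ∏ i ∈ s, b i‖ ≤ δ * ∏ i ∈ s, B i := by
  classical
  induction s using Finset.induction_on with
  | empty => simpa using hδ
  | insert i s hi ih =>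
    simp only [Finset.forall_mem_insert] at hB ha hb hab
    rw [Finset.prod_insert hi, Finset.prod_insert hi, Finset.prod_insert hi]
    have h1 : 1 ≤ ∏ i ∈ s, B i := by
      simpa using Finset.prod_le_prod (f := fun _ => (1 : ℝ)) (fun _ _ => zero_le_one) hB.2
    have hbs : ‖∏ i ∈ s, b i‖ ≤ ∏ i ∈ s, B i := by
      rw [norm_prod]
      exact Finset.prod_le_prod (fun _ _ => norm_nonneg _) hb.2
    have : a i * ∏ i ∈ s, a i - b i * ∏ i ∈ s, b i =
        a i * (∏ i ∈ s, a i - ∏ i ∈ s, b i) + (a i - b i) * ∏ i ∈ s, b i := by ring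
    rw [this]
    refine (IsUltrametricDist.norm_add_le_max _ _).trans (max_le ?_ ?_)
    · rw [norm_mul]
      calc ‖a i‖ * ‖∏ i ∈ s, a i - ∏ i ∈ s, b i‖ ≤ B i * (δ * ∏ i ∈ s, B i) :=
            mul_le_mul ha.1 (ih hB.2 ha.2 hb.2 hab.2) (norm_nonneg _) (by linarith [hB.1])
        _ = δ * (B i * ∏ i ∈ s, B i) := by ring
    · rw [norm_mul]
      refine mul_le_mul hab.1 (hbs.trans ?_) (norm_nonneg _) hδ
      exact le_mul_of_one_le_left (by linarith) hB.1

theorem norm_prod_sub_one_le {s : Finset ι} {a : ι → L} {δ : ℝ} (hδ : 0 ≤ δ) (hδ1 : δ ≤ 1)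
    (ha : ∀ i ∈ s, ‖a i - 1‖ ≤ δ) : ‖∏ i ∈ s, a i - 1‖ ≤ δ := by
  have h : ∀ i ∈ s, ‖a i‖ ≤ 1 := by
    intro i hi
    rw [← sub_add_cancel (a i) 1]
    refine (IsUltrametricDist.norm_add_le_max _ _).trans (max_le ((ha i hi).trans hδ1) ?_)
    rw [norm_one]
  simpa using norm_prod_sub_prod_le (B := fun _ => 1) (b := fun _ => 1) hδ (by simp) h (by simp) ha

theorem norm_mul_sub_one_le {x y : L} {δ : ℝ} (hδ1 : δ ≤ 1) (hx : ‖x - 1‖ ≤ δ)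
    (hy : ‖y - 1‖ ≤ δ) : ‖x * y - 1‖ ≤ δ := by
  have := norm_prod_sub_one_le (s := Finset.univ) (a := ![x, y]) ((norm_nonneg _).trans hx) hδ1
    (by simp [Fin.forall_fin_two, hx, hy])
  simpa using this

theorem norm_pow_sub_one_le {x : L} {δ : ℝ} (hδ1 : δ ≤ 1) (hx : ‖x - 1‖ ≤ δ) (n : ℕ) :
    ‖x ^ n - 1‖ ≤ δ := by
  simpa using norm_prod_sub_one_le (s := Finset.range n) (a := fun _ => x)
    ((norm_nonneg _).trans hx) hδ1 (fun _ _ => hx)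

theorem norm_sum_lt_of_forall_lt {s : Finset ι} {a : ι → L} {δ : ℝ} (hδ : 0 < δ)
    (ha : ∀ i ∈ s, ‖a i‖ < δ) : ‖∑ i ∈ s, a i‖ < δ := by
  rcases s.eq_empty_or_nonempty with rfl | hs
  · simpa using hδ
  · obtain ⟨i, hi, h⟩ := IsUltrametricDist.exists_norm_finsetSum_le_of_nonempty hs a
    exact h.trans_lt (ha i hi)

end Ultra

/-! ### Graded sequences in `k_∞` -/

/-- The terms of `g` have sign `1` and the strictly increasing degrees `m n`. -/
structure IsGraded (g : ℕ → KInf Fq) (m : ℕ → ℕ) : Prop where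
  strictMono : StrictMono m
  norm_eq : ∀ n, ‖g n‖ = (Fintype.card Fq : ℝ) ^ m n
  sgn_eq : ∀ n, sgn (g n) = 1

namespace IsGraded

variable {g g' : ℕ → KInf Fq} {m : ℕ → ℕ} (hg : IsGraded g m) (hg' : IsGraded g' m)
include hg

theorem norm_lt {n r : ℕ} (h : n < r) : ‖g n‖ < ‖g r‖ := by
  rw [hg.norm_eq, hg.norm_eq]
  exact pow_lt_pow_right₀ one_lt_card_real (hg.strictMono h)

theorem ne_zero (n : ℕ) : g n ≠ 0 := ne_zero_of_sgn_eq_one (hg.sgn_eq n)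

theorem norm_seqEval_lt {p : Fq[X]} {r : ℕ} (hp : p.degree < r) : ‖seqEval g p‖ < ‖g r‖ := by
  rw [seqEval_eq_sum]
  refine norm_sum_lt_of_forall_lt (norm_pos_iff.2 (hg.ne_zero r)) fun n hn => ?_
  rw [norm_mul]
  refine (mul_le_of_le_one_left (norm_nonneg _) (norm_algebraMap_le_one _)).trans_lt
    (hg.norm_lt ?_)
  exact_mod_cast (le_degree_of_mem_supp n hn).trans_lt hp

/-- The degrees being strictly increasing, the top term strictly dominates the others and decides
norm and sign. -/
theorem norm_and_sgn_seqEval_add {p : Fq[X]} {r : ℕ} (hp : p.degree < r) {c : Fq} (hc : c ≠ 0) :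
    ‖seqEval g (p + C c * X ^ r)‖ = ‖g r‖ ∧ sgn (seqEval g (p + C c * X ^ r)) = c := by
  have h1 : ‖algebraMap Fq (KInf Fq) c * g r‖ = ‖g r‖ := by
    rw [norm_mul, norm_algebraMap_KInf hc, one_mul]
  have h2 := hg.norm_seqEval_lt hp
  rw [← h1] at h2
  rw [map_add, seqEval_monomial, add_comm]
  refine ⟨(norm_add_of_norm_lt h2).trans h1, ?_⟩
  rw [sgn_add_of_norm_lt h2, sgn_mul, sgn_algebraMap, hg.sgn_eq, mul_one]

theorem norm_and_sgn_seqEval {p : Fq[X]} (hp : p ≠ 0) :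
    ‖seqEval g p‖ = ‖g p.natDegree‖ ∧ sgn (seqEval g p) = p.leadingCoeff := by
  have h := hg.norm_and_sgn_seqEval_add (p := p.eraseLead) (r := p.natDegree)
    (by rw [← degree_eq_natDegree hp]; exact degree_eraseLead_lt hp) (leadingCoeff_ne_zero.2 hp)
  rwa [eraseLead_add_C_mul_X_pow] at h

theorem norm_seqEval {p : Fq[X]} (hp : p ≠ 0) :
    ‖seqEval g p‖ = (Fintype.card Fq : ℝ) ^ m p.natDegree := by
  rw [(hg.norm_and_sgn_seqEval hp).1, hg.norm_eq]

theorem sgn_seqEval {p : Fq[X]} (hp : p ≠ 0) : sgn (seqEval g p) = p.leadingCoeff :=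
  (hg.norm_and_sgn_seqEval hp).2

theorem deg_seqEval {p : Fq[X]} (hp : p ≠ 0) : deg (seqEval g p) = m p.natDegree :=
  deg_eq_of_norm (by rw [hg.norm_seqEval hp, zpow_natCast])

theorem seqEval_ne_zero {p : Fq[X]} (hp : p ≠ 0) : seqEval g p ≠ 0 := by
  rw [← norm_pos_iff, hg.norm_seqEval hp]
  exact pow_pos (zero_lt_one.trans one_lt_card_real) _

theorem seqEval_injective : Function.Injective (seqEval (Fq := Fq) g) := by
  rw [injective_iff_map_eq_zero]
  intro p hp
  by_contra h
  exact hg.seqEval_ne_zero h hp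

/-- A relative error on the basis passes to the span: no term exceeds the top one, whose norm is
that of the whole sum. -/
theorem norm_seqEval_sub_le {δ : ℝ} (hδ : 0 ≤ δ) (h : ∀ n, ‖g' n - g n‖ ≤ δ * ‖g n‖) (p : Fq[X]) :
    ‖seqEval g' p - seqEval g p‖ ≤ δ * ‖seqEval g p‖ := by
  rcases eq_or_ne p 0 with rfl | hp
  · simp
  have : seqEval g' p - seqEval g p =
      ∑ n ∈ p.support, algebraMap Fq (KInf Fq) (p.coeff n) * (g' n - g n) := by
    simp only [seqEval_eq_sum, mul_sub, Finset.sum_sub_distrib]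
  rw [this, (hg.norm_and_sgn_seqEval hp).1]
  obtain ⟨n, hn, hle⟩ := IsUltrametricDist.exists_norm_finsetSum_le_of_nonempty
    (nonempty_support_iff.2 hp) fun n => algebraMap Fq (KInf Fq) (p.coeff n) * (g' n - g n)
  refine hle.trans ?_
  rw [norm_mul]
  refine (mul_le_of_le_one_left (norm_nonneg _) (norm_algebraMap_le_one _)).trans ((h n).trans ?_)
  refine mul_le_mul_of_nonneg_left ?_ hδ
  rw [hg.norm_eq, hg.norm_eq]
  exact pow_le_pow_right₀ one_lt_card_real.le
    (hg.strictMono.monotone (le_natDegree_of_mem_supp n hn))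

theorem norm_flagProd {r : ℕ} {x : KInf Fq} (hx : ∀ n < r, ‖g n‖ < ‖x‖) :
    ‖flagProd (Fq := Fq) g r x‖ = ‖x‖ ^ Fintype.card Fq ^ r := by
  rw [flagProd, norm_prod, ← card_polysLT, ← Finset.prod_const]
  refine Finset.prod_congr rfl fun p hp => ?_
  rw [mem_polysLT] at hp
  rw [Algebra.algebraMap_self_apply]
  rcases eq_or_ne p 0 with rfl | hp0
  · simp
  rw [sub_eq_add_neg, norm_add_of_norm_lt]
  rw [norm_neg, (hg.norm_and_sgn_seqEval hp0).1]
  exact hx _ ((natDegree_lt_iff_degree_lt hp0).2 hp)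

/-- Let `R_r` be the quotient and `a` the value of the flag polynomial at `g r`. The recursion reads
`R_{r+1} - 1 = (R_r - 1)^q - (a / x^{q^r})^{q-1} R_r`. The first term is small by induction, and the
second is at most `q^{-(q-1) q^r}`. -/
theorem norm_flagProd_div_sub_one_le (r : ℕ) {x : KInf Fq}
    (hx : ∀ n < r, ‖g n‖ ≤ (Fintype.card Fq : ℝ)⁻¹ * ‖x‖) (hx0 : x ≠ 0) :
    ‖flagProd (Fq := Fq) g r x / x ^ Fintype.card Fq ^ r - 1‖ ≤ (Fintype.card Fq : ℝ)⁻¹ ^ r := by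
  have hq : (0 : ℝ) < (Fintype.card Fq : ℝ)⁻¹ := inv_pos.2 (zero_lt_one.trans one_lt_card_real)
  have hq1 : (Fintype.card Fq : ℝ)⁻¹ < 1 := inv_lt_one_of_one_lt₀ one_lt_card_real
  have hcard := Fintype.one_lt_card (α := Fq)
  induction r with
  | zero => simp [flagProd_zero, hx0]
  | succ r ih =>
    have ih := ih fun n hn => hx n (hn.trans (Nat.lt_succ_self r))
    have hF : ∀ y : KInf Fq, (y - 1) ^ Fintype.card Fq = y ^ Fintype.card Fq - 1 := fun y => by
      simpa using map_sub (FiniteField.frobeniusAlgHom Fq (KInf Fq)) y 1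
    have hxpow : x ^ Fintype.card Fq ^ r ≠ 0 := pow_ne_zero _ hx0
    set a := flagProd (Fq := Fq) g r (g r) with ha
    set R := flagProd (Fq := Fq) g r x / x ^ Fintype.card Fq ^ r with hR
    have hlt : ∀ n < r + 1, ‖g n‖ < ‖x‖ := fun n hn =>
      (hx n hn).trans_lt (mul_lt_of_lt_one_left (norm_pos_iff.2 hx0) hq1)
    have hstep : flagProd (Fq := Fq) g (r + 1) x / x ^ Fintype.card Fq ^ (r + 1) - 1 =
        (R - 1) ^ Fintype.card Fq +
          -((a / x ^ Fintype.card Fq ^ r) ^ (Fintype.card Fq - 1) * R) := by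
      rw [flagProd_succ, hF, pow_succ, pow_mul, hR, Algebra.algebraMap_self_apply]
      have : (x ^ Fintype.card Fq ^ r) ^ Fintype.card Fq =
          (x ^ Fintype.card Fq ^ r) ^ (Fintype.card Fq - 1) * x ^ Fintype.card Fq ^ r := by
        rw [← pow_succ, Nat.sub_add_cancel hcard.le]
      rw [div_pow, div_pow, div_mul_div_comm, sub_div, ← this]
      ring
    rw [hstep]
    have hRn : ‖R‖ = 1 := by
      rw [hR, norm_div, norm_pow, hg.norm_flagProd fun n hn => hlt n (by omega),
        div_self (pow_ne_zero _ (norm_ne_zero_iff.2 hx0))]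
    refine (IsUltrametricDist.norm_add_le_max _ _).trans (max_le ?_ ?_)
    · rw [norm_pow]
      -- For `r = 0` the quotient is exactly `1` and the term vanishes; for `r ≥ 1` one has `r q ≥ r
      -- + 1`.
      rcases Nat.eq_zero_or_pos r with rfl | hr
      · simp [hR, flagProd_zero, hx0, Fintype.card_ne_zero, hq.le]
      · refine (pow_le_pow_left₀ (norm_nonneg _) ih _).trans ?_
        rw [← pow_mul]
        refine pow_le_pow_of_le_one hq.le hq1.le ?_
        nlinarith
    · rw [norm_neg, norm_mul, hRn, mul_one, norm_pow, norm_div, norm_pow, ha,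
        hg.norm_flagProd fun n hn => hg.norm_lt hn, ← div_pow, ← pow_mul]
      have h1 : ‖g r‖ / ‖x‖ ≤ (Fintype.card Fq : ℝ)⁻¹ :=
        (div_le_iff₀ (norm_pos_iff.2 hx0)).2 (hx r (Nat.lt_succ_self r))
      refine (pow_le_pow_left₀ (by positivity) h1 _).trans (pow_le_pow_of_le_one hq.le hq1.le ?_)
      have h2 : r + 1 ≤ Fintype.card Fq ^ r := Nat.lt_pow_self hcard
      exact h2.trans (Nat.le_mul_of_pos_right _ (by omega))

end IsGraded

/-! ### The limit of the products of `1`-unit parts -/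

theorem oneUnit_mul (ϖ : KInf Fq) (hϖ : ϖ ≠ 0) {x y : KInf Fq} (hx : x ≠ 0) (hy : y ≠ 0) :
    oneUnit ϖ (x * y) = oneUnit ϖ x * oneUnit ϖ y := by
  unfold oneUnit
  rw [deg_mul hx hy, zpow_add₀ hϖ, sgn_mul, mul_inv, map_mul]
  ring

theorem norm_oneUnit {ϖ : KInf Fq} (hϖ : ‖ϖ‖ = (Fintype.card Fq : ℝ)⁻¹) {x : KInf Fq} (hx : x ≠ 0) :
    ‖oneUnit ϖ x‖ = 1 := by
  have h0 : (Fintype.card Fq : ℝ) ≠ 0 := (zero_lt_one.trans one_lt_card_real).ne'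
  rw [oneUnit, norm_mul, norm_mul, norm_zpow, hϖ, norm_eq_zpow_deg hx,
    norm_algebraMap_KInf (inv_ne_zero (sgn_eq_zero.not.2 hx)), mul_one, inv_zpow,
    mul_inv_cancel₀ (zpow_ne_zero _ h0)]

theorem sgn_oneUnit {ϖ : KInf Fq} (hs : sgn ϖ = 1) {x : KInf Fq} (hx : x ≠ 0) :
    sgn (oneUnit ϖ x) = 1 := by
  rw [oneUnit, sgn_mul, sgn_mul, sgn_zpow, hs, one_zpow, mul_one, sgn_algebraMap,
    mul_inv_cancel₀ (sgn_eq_zero.not.2 hx)]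

theorem norm_oneUnit_sub_one_le {ϖ : KInf Fq} (hϖ : ‖ϖ‖ = (Fintype.card Fq : ℝ)⁻¹)
    (hs : sgn ϖ = 1) {x : KInf Fq} (hx : x ≠ 0) :
    ‖oneUnit ϖ x - 1‖ ≤ (Fintype.card Fq : ℝ)⁻¹ :=
  norm_sub_one_le (norm_oneUnit hϖ hx) (sgn_oneUnit hs hx)

theorem norm_pow_card_pow_sub_one_le {x : KInf Fq} (hx : ‖x - 1‖ ≤ (Fintype.card Fq : ℝ)⁻¹) (r : ℕ) :
    ‖x ^ Fintype.card Fq ^ r - 1‖ ≤ (Fintype.card Fq : ℝ)⁻¹ ^ r := by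
  have hF : ∀ r, x ^ Fintype.card Fq ^ r - 1 = (x - 1) ^ Fintype.card Fq ^ r := by
    intro r
    induction r with
    | zero => simp
    | succ r ih =>
      have := map_sub (FiniteField.frobeniusAlgHom Fq (KInf Fq)) (x ^ Fintype.card Fq ^ r) 1
      simp only [FiniteField.frobeniusAlgHom_apply, one_pow] at this
      rw [pow_succ, pow_mul, pow_mul, ← this, ih]
  have hq : (0 : ℝ) < (Fintype.card Fq : ℝ)⁻¹ := inv_pos.2 (zero_lt_one.trans one_lt_card_real)
  rw [hF, norm_pow]
  refine (pow_le_pow_left₀ (norm_nonneg _) hx _).trans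
    (pow_le_pow_of_le_one hq.le (inv_lt_one_of_one_lt₀ one_lt_card_real).le ?_)
  exact (Nat.lt_pow_self (Fintype.one_lt_card (α := Fq))).le

/-- The product of the `1`-unit parts of the nonzero elements of the span of the first `r` terms
of `g`. -/
def unitProd (ϖ : KInf Fq) (g : ℕ → KInf Fq) (r : ℕ) : KInf Fq :=
  open Classical in ∏ p ∈ (polysLT Fq r).erase 0, oneUnit ϖ (seqEval g p)

theorem prod_erase_polysLT_succ {M : Type*} [CommMonoid M] (r : ℕ) (h : Fq[X] → M) :
    open Classical in
    ∏ p ∈ (polysLT Fq (r + 1)).erase 0, h p = (∏ p ∈ (polysLT Fq r).erase 0, h p) *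
      ∏ c ∈ Finset.univ.erase (0 : Fq), ∏ p ∈ polysLT Fq r, h (p + C c * X ^ r) := by
  classical
  -- Removing `0` is replaced by the value `1` at `0`, so that the formula for the full product
  -- applies.
  have key : ∀ r : ℕ, ∏ p ∈ polysLT Fq r, (if p = 0 then 1 else h p) =
      ∏ p ∈ (polysLT Fq r).erase 0, h p := by
    intro r
    rw [← Finset.mul_prod_erase _ _ (zero_mem_polysLT r), if_pos rfl, one_mul]
    exact Finset.prod_congr rfl fun p hp => if_neg (Finset.ne_of_mem_erase hp)
  rw [← key, prod_polysLT_succ, ← Finset.mul_prod_erase _ _ (Finset.mem_univ (0 : Fq)), ← key]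
  congr 1
  · simp
  · refine Finset.prod_congr rfl fun c hc => Finset.prod_congr rfl fun p hp => if_neg fun h0 => ?_
    have := congr_arg (fun P => coeff P r) h0
    simp only [coeff_add, coeff_C_mul, coeff_X_pow_self, mul_one,
      coeff_eq_zero_of_degree_lt (mem_polysLT.1 hp), zero_add, coeff_zero] at this
    exact Finset.ne_of_mem_erase hc this

namespace IsGraded

variable {g g' : ℕ → KInf Fq} {m : ℕ → ℕ} {ϖ : KInf Fq} (hg : IsGraded g m)
include hg

/-- On the coset of `c g_r` the sign is `c` and the degree is `m r`, so only the product of the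
elements matters; it is the flag polynomial at `-c g_r`, up to signs. By `𝔽_q`-linearity and
`c^{q^r} = c` all constants cancel, and the result does not depend on `c`. -/
theorem prod_oneUnit_seqEval_add (r : ℕ) {c : Fq} (hc : c ≠ 0) :
    ∏ p ∈ polysLT Fq r, oneUnit ϖ (seqEval g (p + C c * X ^ r)) =
      flagProd (Fq := Fq) g r (g r) * (ϖ ^ m r) ^ Fintype.card Fq ^ r := by
  have h1 : ∀ p ∈ polysLT Fq r, oneUnit ϖ (seqEval g (p + C c * X ^ r)) =
      (algebraMap Fq (KInf Fq) (-c) * g r - seqEval g p) *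
        (algebraMap Fq (KInf Fq) (-c⁻¹) * ϖ ^ m r) := by
    intro p hp
    obtain ⟨hn, hs⟩ := hg.norm_and_sgn_seqEval_add (mem_polysLT.1 hp) hc
    rw [oneUnit, hs, deg_eq_of_norm (n := m r) (by rw [hn, hg.norm_eq, zpow_natCast]), map_add,
      seqEval_monomial, zpow_natCast, map_neg, map_neg]
    ring
  rw [Finset.prod_congr rfl h1, Finset.prod_mul_distrib, Finset.prod_const, card_polysLT]
  have h2 : ∏ p ∈ polysLT Fq r, (algebraMap Fq (KInf Fq) (-c) * g r - seqEval g p) =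
      algebraMap Fq (KInf Fq) (-c) * flagProd (Fq := Fq) g r (g r) := by
    rw [← flagProd_algebraMap_mul]
    rfl
  have h3 : (-c) * (-c⁻¹) = 1 := by rw [neg_mul_neg, mul_inv_cancel₀ hc]
  rw [h2, mul_pow, ← map_pow, FiniteField.pow_card_pow, mul_mul_mul_comm, ← map_mul, h3, map_one,
    one_mul]

theorem unitProd_succ (r : ℕ) : unitProd ϖ g (r + 1) = unitProd ϖ g r *
    (flagProd (Fq := Fq) g r (g r) * (ϖ ^ m r) ^ Fintype.card Fq ^ r) ^ (Fintype.card Fq - 1) := by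
  classical
  rw [unitProd, unitProd, prod_erase_polysLT_succ]
  congr 1
  rw [Finset.prod_congr rfl fun c hc => hg.prod_oneUnit_seqEval_add r (Finset.ne_of_mem_erase hc),
    Finset.prod_const, Finset.card_erase_of_mem (Finset.mem_univ _), Finset.card_univ]

variable (hϖ : ‖ϖ‖ = (Fintype.card Fq : ℝ)⁻¹) (hs : sgn ϖ = 1)
include hϖ hs

theorem norm_unitProd_sub_one_le (r : ℕ) : ‖unitProd ϖ g r - 1‖ ≤ (Fintype.card Fq : ℝ)⁻¹ :=
  norm_prod_sub_one_le (inv_nonneg.2 (zero_lt_one.trans one_lt_card_real).le)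
    (inv_le_one_of_one_le₀ one_lt_card_real.le) fun p hp =>
      norm_oneUnit_sub_one_le hϖ hs (hg.seqEval_ne_zero (by simp at hp; exact hp.1))

theorem norm_unitProd (r : ℕ) : ‖unitProd ϖ g r‖ = 1 := by
  rw [← norm_one (α := KInf Fq)]
  refine norm_eq_of_norm_sub_lt ((hg.norm_unitProd_sub_one_le hϖ hs r).trans_lt ?_)
  rw [norm_one]
  exact inv_lt_one_of_one_lt₀ one_lt_card_real

/-- The quotient of successive products is the `(q-1)`-th power of `(F_r(g_r) / g_r^{q^r})
⟨g_r⟩^{q^r}`, where `F_r` is the flag polynomial; both factors are within `q^{-r}` of `1`. -/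
theorem norm_unitProd_succ_sub_le (r : ℕ) :
    ‖unitProd ϖ g (r + 1) - unitProd ϖ g r‖ ≤ (Fintype.card Fq : ℝ)⁻¹ ^ r := by
  have hq : (0 : ℝ) < (Fintype.card Fq : ℝ)⁻¹ := inv_pos.2 (zero_lt_one.trans one_lt_card_real)
  have hq1 : (Fintype.card Fq : ℝ)⁻¹ < 1 := inv_lt_one_of_one_lt₀ one_lt_card_real
  have h1 : (Fintype.card Fq : ℝ)⁻¹ ^ r ≤ 1 := pow_le_one₀ hq.le hq1.le
  rw [hg.unitProd_succ, ← mul_sub_one, norm_mul, hg.norm_unitProd hϖ hs, one_mul]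
  refine norm_pow_sub_one_le h1 ?_ _
  have hR := hg.norm_flagProd_div_sub_one_le r (x := g r) (fun n hn => by
    rw [hg.norm_eq, hg.norm_eq, inv_mul_eq_div, le_div_iff₀ (zero_lt_one.trans one_lt_card_real),
      ← pow_succ]
    exact pow_le_pow_right₀ one_lt_card_real.le (hg.strictMono hn)) (hg.ne_zero r)
  have hU := norm_pow_card_pow_sub_one_le (norm_oneUnit_sub_one_le hϖ hs (hg.ne_zero r)) r
  have hd : deg (g r) = m r := deg_eq_of_norm (by rw [hg.norm_eq, zpow_natCast])
  have : flagProd (Fq := Fq) g r (g r) * (ϖ ^ m r) ^ Fintype.card Fq ^ r =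
      flagProd (Fq := Fq) g r (g r) / g r ^ Fintype.card Fq ^ r *
        oneUnit ϖ (g r) ^ Fintype.card Fq ^ r := by
    rw [oneUnit, hd, hg.sgn_eq, inv_one, map_one, mul_one, mul_pow, ← mul_assoc,
      div_mul_cancel₀ _ (pow_ne_zero _ (hg.ne_zero r)), zpow_natCast]
  rw [this]
  exact norm_mul_sub_one_le h1 hR hU

theorem exists_tendsto_unitProd : ∃ u : KInf Fq, Tendsto (unitProd ϖ g) atTop (𝓝 u) := by
  refine cauchySeq_tendsto_of_complete (cauchySeq_of_le_geometric (α := KInf Fq) (Fintype.card Fq : ℝ)⁻¹ 1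
    (inv_lt_one_of_one_lt₀ one_lt_card_real) fun r => ?_)
  rw [dist_comm, dist_eq_norm, one_mul]
  exact hg.norm_unitProd_succ_sub_le hϖ hs r

end IsGraded

theorem norm_limit_le {L : Type*} [SeminormedAddCommGroup L] {f : ℕ → L} {u v : L} {δ : ℝ}
    (hf : Tendsto f atTop (𝓝 u)) (h : ∀ n, ‖f n - v‖ ≤ δ) : ‖u - v‖ ≤ δ :=
  le_of_tendsto (hf.sub_const v).norm (Eventually.of_forall h)

namespace IsGraded

variable {g g' : ℕ → KInf Fq} {m m' : ℕ → ℕ} {ϖ : KInf Fq} (hg : IsGraded g m)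
  (hϖ : ‖ϖ‖ = (Fintype.card Fq : ℝ)⁻¹) (hs : sgn ϖ = 1)
include hg hϖ hs

theorem norm_limit_sub_one_le {u : KInf Fq} (hu : Tendsto (unitProd ϖ g) atTop (𝓝 u)) :
    ‖u - 1‖ ≤ (Fintype.card Fq : ℝ)⁻¹ :=
  norm_limit_le (L := KInf Fq) hu (hg.norm_unitProd_sub_one_le hϖ hs)

theorem norm_limit_eq_one {u : KInf Fq} (hu : Tendsto (unitProd ϖ g) atTop (𝓝 u)) : ‖u‖ = 1 := by
  rw [← norm_one (α := KInf Fq)]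
  refine norm_eq_of_norm_sub_lt ((hg.norm_limit_sub_one_le hϖ hs hu).trans_lt ?_)
  rw [norm_one]
  exact inv_lt_one_of_one_lt₀ one_lt_card_real

theorem sgn_limit_eq_one {u : KInf Fq} (hu : Tendsto (unitProd ϖ g) atTop (𝓝 u)) : sgn u = 1 := by
  rw [← add_sub_cancel 1 u, sgn_add_of_norm_lt, sgn_one]
  refine (hg.norm_limit_sub_one_le hϖ hs hu).trans_lt ?_
  rw [norm_one]
  exact inv_lt_one_of_one_lt₀ one_lt_card_real

/-- Corresponding elements of the two spans have the same degree and sign, so their `1`-unit parts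
arise by the same scaling and differ exactly by the relative error. -/
theorem norm_unitProd_sub_unitProd_le (hg' : IsGraded g' m) {δ : ℝ} (hδ : 0 ≤ δ)
    (h : ∀ n, ‖g' n - g n‖ ≤ δ * ‖g n‖) (r : ℕ) : ‖unitProd ϖ g' r - unitProd ϖ g r‖ ≤ δ := by
  classical
  have hne : ∀ p ∈ (polysLT Fq r).erase 0, p ≠ 0 := fun p hp => Finset.ne_of_mem_erase hp
  have := norm_prod_sub_prod_le (s := (polysLT Fq r).erase 0) (B := fun _ => 1)
    (a := fun p => oneUnit ϖ (seqEval g' p)) (b := fun p => oneUnit ϖ (seqEval g p)) hδ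
    (fun _ _ => le_rfl) (fun p hp => (norm_oneUnit hϖ (hg'.seqEval_ne_zero (hne p hp))).le)
    (fun p hp => (norm_oneUnit hϖ (hg.seqEval_ne_zero (hne p hp))).le) (fun p hp => ?_)
  · simpa [unitProd] using this
  · have h1 := hg.norm_seqEval_sub_le hδ h p
    have h2 := norm_oneUnit hϖ (hg.seqEval_ne_zero (hne p hp))
    have h3 : oneUnit ϖ (seqEval g' p) - oneUnit ϖ (seqEval g p) =
        (seqEval g' p - seqEval g p) * (ϖ ^ deg (seqEval g p) *
          algebraMap Fq (KInf Fq) (sgn (seqEval g p))⁻¹) := by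
      rw [oneUnit, oneUnit, hg.deg_seqEval (hne p hp), hg'.deg_seqEval (hne p hp),
        hg.sgn_seqEval (hne p hp), hg'.sgn_seqEval (hne p hp)]
      ring
    rw [oneUnit, mul_assoc, norm_mul] at h2
    rw [h3, norm_mul]
    calc _ ≤ δ * ‖seqEval g p‖ * _ := mul_le_mul_of_nonneg_right h1 (norm_nonneg _)
      _ = δ := by rw [mul_assoc, h2, mul_one]

theorem norm_limit_sub_limit_le (hg' : IsGraded g' m) {δ : ℝ} (hδ : 0 ≤ δ)
    (h : ∀ n, ‖g' n - g n‖ ≤ δ * ‖g n‖) {u u' : KInf Fq} (hu : Tendsto (unitProd ϖ g) atTop (𝓝 u))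
    (hu' : Tendsto (unitProd ϖ g') atTop (𝓝 u')) : ‖u' - u‖ ≤ δ := by
  have h1 : Tendsto (fun r => unitProd ϖ g' r - unitProd ϖ g r) atTop (𝓝 (u' - u)) :=
    Tendsto.sub (G := KInf Fq) hu' hu
  simpa using norm_limit_le (L := KInf Fq) (v := 0) h1 fun r => by
    simpa using hg.norm_unitProd_sub_unitProd_le hϖ hs hg' hδ h r

/-- The span of `r` terms has `q^r - 1` nonzero elements, so scaling by `a` multiplies the product
by `⟨a⟩^{q^r - 1}`, which tends to `⟨a⟩⁻¹`. -/
theorem limit_mul_eq {a : KInf Fq} (ha : a ≠ 0)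
    {u u' : KInf Fq} (hu : Tendsto (unitProd ϖ g) atTop (𝓝 u))
    (hu' : Tendsto (unitProd ϖ fun n => a * g n) atTop (𝓝 u')) : u' * oneUnit ϖ a = u := by
  classical
  have hϖ0 : ϖ ≠ 0 := ne_zero_of_sgn_eq_one hs
  have h1 : ∀ r, unitProd ϖ (fun n => a * g n) r * oneUnit ϖ a =
      oneUnit ϖ a ^ Fintype.card Fq ^ r * unitProd ϖ g r := by
    intro r
    have : ∀ p ∈ (polysLT Fq r).erase 0, oneUnit ϖ (seqEval (fun n => a * g n) p) =
        oneUnit ϖ a * oneUnit ϖ (seqEval g p) := by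
      intro p hp
      rw [← oneUnit_mul ϖ hϖ0 ha (hg.seqEval_ne_zero (Finset.ne_of_mem_erase hp))]
      congr 1
      simp only [seqEval_eq_sum, Finset.mul_sum]
      exact Finset.sum_congr rfl fun n _ => by ring
    rw [unitProd, Finset.prod_congr rfl this, Finset.prod_mul_distrib, Finset.prod_const,
      Finset.card_erase_of_mem (zero_mem_polysLT r), card_polysLT, mul_right_comm, ← pow_succ,
      Nat.sub_add_cancel (Nat.one_le_pow _ _ Fintype.card_pos), unitProd]
  have h2 : Tendsto (fun r => oneUnit ϖ a ^ Fintype.card Fq ^ r) atTop (𝓝 1) := by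
    rw [tendsto_KInf_iff]
    intro ε hε
    obtain ⟨n, hn⟩ := exists_pow_lt_of_lt_one hε
      (inv_lt_one_of_one_lt₀ (one_lt_card_real (Fq := Fq)))
    refine ⟨n, fun k hk => ?_⟩
    refine (norm_pow_card_pow_sub_one_le (norm_oneUnit_sub_one_le hϖ hs ha) k).trans_lt
      (lt_of_le_of_lt ?_ hn)
    exact pow_le_pow_of_le_one (inv_nonneg.2 (zero_lt_one.trans one_lt_card_real).le)
      (inv_le_one_of_one_le₀ one_lt_card_real.le) hk
  have h3 : Tendsto (fun r => unitProd ϖ (fun n => a * g n) r * oneUnit ϖ a) atTop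
      (𝓝 (u' * oneUnit ϖ a)) := Tendsto.mul_const (M := KInf Fq) _ hu'
  have h4 : Tendsto (fun r => oneUnit ϖ a ^ Fintype.card Fq ^ r * unitProd ϖ g r) atTop
      (𝓝 (1 * u)) := Tendsto.mul (M := KInf Fq) h2 hu
  rw [one_mul] at h4
  simp only [h1] at h3
  exact tendsto_nhds_unique (X := KInf Fq) h3 h4

end IsGraded

/-! ### Sums and products over the span of a graded sequence -/

theorem polysLT_subset_succ (r : ℕ) : polysLT Fq r ⊆ polysLT Fq (r + 1) := fun p hp => by
  rw [mem_polysLT] at hp ⊢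
  exact hp.trans (by exact_mod_cast Nat.lt_succ_self r)

theorem prod_polysLT_sdiff {M : Type*} [CommMonoid M] (r : ℕ) (h : Fq[X] → M) :
    open Classical in
    ∏ p ∈ polysLT Fq (r + 1) \ polysLT Fq r, h p =
      ∏ c ∈ Finset.univ.erase (0 : Fq), ∏ p ∈ polysLT Fq r, h (p + C c * X ^ r) := by
  classical
  have h1 := prod_polysLT_succ r fun p => if p ∈ polysLT Fq r then 1 else h p
  rw [← Finset.prod_sdiff (polysLT_subset_succ r),
    Finset.prod_congr rfl fun p hp => if_neg (Finset.mem_sdiff.1 hp).2,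
    Finset.prod_congr (s₁ := polysLT Fq r) rfl fun p hp => if_pos hp, Finset.prod_const_one,
    mul_one, ← Finset.mul_prod_erase _ _ (Finset.mem_univ (0 : Fq))] at h1
  rw [h1, Finset.prod_congr rfl fun p hp => if_pos (by simpa using hp), Finset.prod_const_one,
    one_mul]
  refine Finset.prod_congr rfl fun c hc => Finset.prod_congr rfl fun p hp => if_neg fun h0 => ?_
  have h2 := coeff_eq_zero_of_degree_lt (mem_polysLT.1 h0)
  simp only [coeff_add, coeff_C_mul, coeff_X_pow_self, mul_one,
    coeff_eq_zero_of_degree_lt (mem_polysLT.1 hp), zero_add] at h2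
  exact Finset.ne_of_mem_erase hc h2

theorem prod_univ_erase_zero : open Classical in ∏ c ∈ Finset.univ.erase (0 : Fq), c = -1 := by
  classical
  have hq := Fintype.one_lt_card (α := Fq)
  have h : ∏ c ∈ Finset.univ.erase (0 : Fq), (X - C c) = X ^ (Fintype.card Fq - 1) - 1 := by
    apply mul_left_cancel₀ (X_ne_zero (R := Fq))
    have := prod_X_sub_C_univ (Fq := Fq)
    rw [← Finset.mul_prod_erase _ _ (Finset.mem_univ (0 : Fq)), map_zero, sub_zero] at this
    rw [this, mul_sub, ← pow_succ', Nat.sub_add_cancel hq.le, mul_one]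
  have h0 := congr_arg (eval 0) h
  rw [eval_prod] at h0
  simp only [eval_sub, eval_X, eval_C, eval_pow, eval_one, zero_sub,
    zero_pow (show Fintype.card Fq - 1 ≠ 0 by omega)] at h0
  rw [← h0]
  refine Finset.prod_equiv (Equiv.neg Fq) (by simp) fun c _ => by simp

namespace IsGraded

variable {g : ℕ → KInf Fq} {m : ℕ → ℕ} (hg : IsGraded g m)
include hg

theorem setOf_deg_le_eq {M r : ℕ} (hr : ∀ n, m n ≤ M ↔ n < r) :
    {x | x ∈ Set.range (seqEval (Fq := Fq) g) ∧ x ≠ 0 ∧ deg x ≤ (M : ℤ)} =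
      open Classical in seqEval (Fq := Fq) g '' ((polysLT Fq r).erase 0 : Finset Fq[X]) := by
  ext x
  simp only [Set.mem_ofPred_eq, Set.mem_range, Set.mem_image, Finset.coe_erase, Set.mem_sdiff,
    Finset.mem_coe, Set.mem_singleton_iff]
  constructor
  · rintro ⟨⟨p, rfl⟩, hx, hd⟩
    have hp : p ≠ 0 := by
      rintro rfl
      exact hx (map_zero _)
    refine ⟨p, ⟨mem_polysLT.2 ?_, hp⟩, rfl⟩
    rw [hg.deg_seqEval hp] at hd
    exact (natDegree_lt_iff_degree_lt hp).1 ((hr _).1 (by exact_mod_cast hd))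
  · rintro ⟨p, ⟨hp, hp0⟩, rfl⟩
    refine ⟨⟨p, rfl⟩, hg.seqEval_ne_zero hp0, ?_⟩
    rw [hg.deg_seqEval hp0]
    exact_mod_cast (hr _).2 ((natDegree_lt_iff_degree_lt hp0).2 (mem_polysLT.1 hp))

theorem setOf_deg_eq_eq (r : ℕ) :
    {x | x ∈ Set.range (seqEval (Fq := Fq) g) ∧ x ≠ 0 ∧ deg x = (m r : ℤ)} =
      open Classical in
      seqEval (Fq := Fq) g '' (polysLT Fq (r + 1) \ polysLT Fq r : Finset Fq[X]) := by
  ext x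
  simp only [Set.mem_ofPred_eq, Set.mem_range, Set.mem_image, Finset.coe_sdiff, Set.mem_sdiff,
    Finset.mem_coe, mem_polysLT]
  constructor
  · rintro ⟨⟨p, rfl⟩, hx, hd⟩
    have hp : p ≠ 0 := by
      rintro rfl
      exact hx (map_zero _)
    refine ⟨p, ?_, rfl⟩
    rw [hg.deg_seqEval hp, Nat.cast_inj] at hd
    have := hg.strictMono.injective hd
    rw [← natDegree_lt_iff_degree_lt hp, ← natDegree_lt_iff_degree_lt hp]
    omega
  · rintro ⟨p, hp, rfl⟩
    have hp0 : p ≠ 0 := by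
      rintro rfl
      exact hp.2 (by rw [degree_zero]; exact WithBot.bot_lt_coe r)
    refine ⟨⟨p, rfl⟩, hg.seqEval_ne_zero hp0, ?_⟩
    rw [hg.deg_seqEval hp0]
    rw [← natDegree_lt_iff_degree_lt hp0, ← natDegree_lt_iff_degree_lt hp0] at hp
    congr 2
    omega

theorem finprod_deg_le {M' : Type*} [CommMonoid M'] (h : KInf Fq → M') {M r : ℕ}
    (hr : ∀ n, m n ≤ M ↔ n < r) :
    ∏ᶠ x ∈ {x | x ∈ Set.range (seqEval (Fq := Fq) g) ∧ x ≠ 0 ∧ deg x ≤ (M : ℤ)}, h x =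
      open Classical in ∏ p ∈ (polysLT Fq r).erase 0, h (seqEval g p) := by
  rw [hg.setOf_deg_le_eq hr, finprod_mem_image hg.seqEval_injective.injOn, finprod_mem_coe_finset]

/-- Each sign `c` is taken by `q^r` elements, and `c^{q^r} = c`, so that Wilson's theorem for `𝔽_q`
gives `-1`. -/
theorem finprod_sgn_deg_eq (r : ℕ) :
    ∏ᶠ x ∈ {x | x ∈ Set.range (seqEval (Fq := Fq) g) ∧ x ≠ 0 ∧ deg x = (m r : ℤ)}, sgn x = -1 := by
  classical
  rw [hg.setOf_deg_eq_eq, finprod_mem_image hg.seqEval_injective.injOn, finprod_mem_coe_finset,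
    prod_polysLT_sdiff, ← prod_univ_erase_zero]
  refine Finset.prod_congr rfl fun c hc => ?_
  rw [Finset.prod_congr rfl fun p hp => (hg.norm_and_sgn_seqEval_add (mem_polysLT.1 hp)
    (Finset.ne_of_mem_erase hc)).2, Finset.prod_const, card_polysLT, FiniteField.pow_card_pow]

theorem ncard_deg_eq (r : ℕ) :
    Set.ncard {x | x ∈ Set.range (seqEval (Fq := Fq) g) ∧ x ≠ 0 ∧ deg x = (m r : ℤ)} =
      (Fintype.card Fq - 1) * Fintype.card Fq ^ r := by
  classical
  rw [hg.setOf_deg_eq_eq, Set.ncard_image_of_injective _ hg.seqEval_injective,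
    Set.ncard_coe_finset, Finset.card_sdiff_of_subset (polysLT_subset_succ r), card_polysLT,
    card_polysLT, pow_succ', Nat.sub_one_mul]

theorem ncard_deg_eq_zero {M : ℕ} (hM : ∀ n, m n ≠ M) :
    Set.ncard {x | x ∈ Set.range (seqEval (Fq := Fq) g) ∧ x ≠ 0 ∧ deg x = (M : ℤ)} = 0 := by
  convert Set.ncard_empty (KInf Fq)
  rw [Set.eq_empty_iff_forall_notMem]
  rintro x ⟨⟨p, rfl⟩, hx, hd⟩
  have hp : p ≠ 0 := by
    rintro rfl
    exact hx (map_zero _)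
  rw [hg.deg_seqEval hp, Nat.cast_inj] at hd
  exact hM _ hd

end IsGraded

/-! ### The norm zeta function -/

/-- `IsPeriod` only asserts that some value `t` exists, so the derivative must not depend on the
fraction `P / Q`. This follows by evaluating at `1` the cross-multiplied identity and its
derivative. -/
theorem zetaDerivAtOne_unique {S : Set (KInf Fq)} {z z' : ℚ} (h : ZetaDerivAtOne S z)
    (h' : ZetaDerivAtOne S z') : z = z' := by
  obtain ⟨P, Q, hQ, hZ, rfl⟩ := h
  obtain ⟨R, B, hB, hZ', rfl⟩ := h'
  have key : P * B = R * Q := by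
    apply Polynomial.coe_injective ℚ
    rw [Polynomial.coe_mul, Polynomial.coe_mul, ← hZ, ← hZ']
    ring
  have h1 := congr_arg (eval 1) key
  have h2 := congr_arg (fun P => eval 1 (derivative P)) key
  simp only [derivative_mul, eval_mul, eval_add] at h1 h2
  rw [div_eq_div_iff (pow_ne_zero _ hQ) (pow_ne_zero _ hB)]
  linear_combination (eval 1 Q * eval 1 B) * h2 -
    (eval 1 Q * eval 1 (derivative B) + eval 1 B * eval 1 (derivative Q)) * h1

section Zeta

variable (Fq) in
/-- The value of `Z_S'(1)` for the span `S` of a graded sequence with degrees `m n`, where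
`m n = n + k` for `n ≥ n₀`. -/
def zetaDeriv (m : ℕ → ℕ) (n₀ k : ℕ) : ℚ :=
  ∑ n ∈ Finset.range n₀, ((Fintype.card Fq : ℚ) - 1) * (Fintype.card Fq : ℚ) ^ n * m n -
    (Fintype.card Fq : ℚ) ^ n₀ * (n₀ + k) +
    (Fintype.card Fq : ℚ) ^ (n₀ + 1) / ((Fintype.card Fq : ℚ) - 1)

variable (Fq) in
/-- The integer `(q - 1) Z_S'(1)`. -/
def zetaExponent (m : ℕ → ℕ) (n₀ k : ℕ) : ℤ :=
  ((Fintype.card Fq : ℤ) - 1) *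
    (∑ n ∈ Finset.range n₀, ((Fintype.card Fq : ℤ) - 1) * (Fintype.card Fq : ℤ) ^ n * m n -
      (Fintype.card Fq : ℤ) ^ n₀ * (n₀ + k)) + (Fintype.card Fq : ℤ) ^ (n₀ + 1)

theorem card_sub_one_ne_zero : (Fintype.card Fq : ℚ) - 1 ≠ 0 := by
  have : (1 : ℚ) < Fintype.card Fq := by exact_mod_cast Fintype.one_lt_card (α := Fq)
  exact (sub_pos.2 this).ne'

theorem zetaExponent_eq (m : ℕ → ℕ) (n₀ k : ℕ) :
    (zetaExponent Fq m n₀ k : ℚ) = ((Fintype.card Fq : ℚ) - 1) * zetaDeriv Fq m n₀ k := by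
  have := card_sub_one_ne_zero (Fq := Fq)
  rw [zetaDeriv, zetaExponent]
  push_cast
  field_simp

/-- Shifting all degrees by `s` multiplies `Z_S(u)` by `u^s`, which changes `Z_S'(1)` by `s Z_S(1)`;
and `Z_S(1) = -1`. -/
theorem zetaExponent_shift (m : ℕ → ℕ) (n₀ k s : ℕ) :
    zetaExponent Fq (fun n => m n + s) n₀ (k + s) =
      zetaExponent Fq m n₀ k - ((Fintype.card Fq : ℤ) - 1) * s := by
  have h : ∑ n ∈ Finset.range n₀, ((Fintype.card Fq : ℤ) - 1) * (Fintype.card Fq : ℤ) ^ n =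
      (Fintype.card Fq : ℤ) ^ n₀ - 1 := by
    rw [← Finset.mul_sum, mul_comm, geom_sum_mul]
  unfold zetaExponent
  push_cast
  simp only [mul_add _ (_ : ℤ) (s : ℤ), Finset.sum_add_distrib, ← Finset.sum_mul, h]
  ring

-- From index `n₀` on the degrees are consecutive, so that `Z_S` is a polynomial plus the geometric
-- tail `(q-1) q^{n₀} u^{n₀+k} / (1 - q u)`.
open PowerSeries in
theorem IsGraded.zetaDerivAtOne {g : ℕ → KInf Fq} {m : ℕ → ℕ} (hg : IsGraded g m) {n₀ k : ℕ}
    (hk : ∀ n, n₀ ≤ n → m n = n + k) :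
    ZetaDerivAtOne (Set.range (seqEval (Fq := Fq) g)) (zetaDeriv Fq m n₀ k) := by
  set q : ℚ := (Fintype.card Fq : ℚ) with hq
  have hq1 := card_sub_one_ne_zero (Fq := Fq)
  have hq1' : 1 - q ≠ 0 := by
    rw [← neg_sub]
    exact neg_ne_zero.2 hq1
  set A : ℚ[X] := ∑ n ∈ Finset.range n₀,
    Polynomial.C ((q - 1) * q ^ n) * Polynomial.X ^ m n with hA
  set Q : ℚ[X] := 1 - Polynomial.C q * Polynomial.X with hQ
  set P : ℚ[X] := Q * A + Polynomial.C ((q - 1) * q ^ n₀) * Polynomial.X ^ (n₀ + k) with hP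
  have hZ : zetaSeries (Set.range (seqEval (Fq := Fq) g)) =
      (A : ℚ⟦X⟧) + PowerSeries.C ((q - 1) * q ^ n₀) * (PowerSeries.X ^ (n₀ + k) *
        PowerSeries.mk fun n => q ^ n) := by
    ext j
    rw [zetaSeries, coeff_mk, map_add, Polynomial.coeff_coe, PowerSeries.coeff_C_mul,
      PowerSeries.coeff_X_pow_mul', hA, finsetSum_coeff]
    simp only [Polynomial.coeff_C_mul, Polynomial.coeff_X_pow, mul_ite, mul_one, mul_zero, coeff_mk]
    split_ifs with hj
    · have h1 : m (j - k) = j := by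
        rw [hk _ (by omega)]
        omega
      have h2 := hg.ncard_deg_eq (j - k)
      rw [h1] at h2
      rw [h2, Finset.sum_eq_zero, zero_add]
      · push_cast [Nat.cast_sub (Fintype.card_pos (α := Fq))]
        rw [mul_assoc (_ - 1), ← pow_add, show n₀ + (j - (n₀ + k)) = j - k by omega]
      · intro n hn
        rw [if_neg]
        have := hg.strictMono (Finset.mem_range.1 hn)
        rw [hk n₀ le_rfl] at this
        omega
    · rw [add_zero]
      by_cases hr : ∃ r, m r = j
      · obtain ⟨r, rfl⟩ := hr
        have hrn : r < n₀ := by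
          by_contra hcon
          have := hk r (by omega)
          omega
        rw [hg.ncard_deg_eq, Finset.sum_eq_single_of_mem r (Finset.mem_range.2 hrn), if_pos rfl]
        · push_cast [Nat.cast_sub (Fintype.card_pos (α := Fq))]
          simp [hq]
        · intro n _ hn
          exact if_neg fun h => hn (hg.strictMono.injective h).symm
      · push Not at hr
        rw [hg.ncard_deg_eq_zero hr, Finset.sum_eq_zero, Nat.cast_zero]
        intro n _
        exact if_neg fun h => hr n h.symm
  have hgeom : (Q : ℚ⟦X⟧) * PowerSeries.mk (fun n => q ^ n) = 1 := by
    rw [hQ]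
    ext n
    rw [Polynomial.coe_sub, Polynomial.coe_one, Polynomial.coe_mul, Polynomial.coe_C,
      Polynomial.coe_X, sub_mul, one_mul, map_sub, mul_assoc, PowerSeries.coeff_C_mul, coeff_mk,
      PowerSeries.coeff_one]
    cases n with
    | zero => simp
    | succ n => rw [coeff_succ_X_mul, coeff_mk, pow_succ', sub_self, if_neg (Nat.succ_ne_zero n)]
  refine ⟨P, Q, by simpa [hQ] using hq1', ?_, ?_⟩
  · rw [hZ, hP]
    simp only [Polynomial.coe_add, Polynomial.coe_mul, Polynomial.coe_C, Polynomial.coe_pow,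
      Polynomial.coe_X]
    linear_combination (PowerSeries.C ((q - 1) * q ^ n₀) * PowerSeries.X ^ (n₀ + k)) * hgeom
  · have hQ1 : eval 1 Q = 1 - q := by simp [hQ]
    have hQ2 : eval 1 (derivative Q) = -q := by simp [hQ]
    have hder : ∀ (a : ℚ) (n : ℕ),
        eval 1 (derivative (Polynomial.C a * Polynomial.X ^ n)) = a * n := by
      intro a n
      rw [derivative_C_mul_X_pow]
      simp
    have hA1 : eval 1 A = q ^ n₀ - 1 := by
      rw [hA, eval_finsetSum]
      simp only [eval_mul, eval_C, eval_pow, eval_X, one_pow, mul_one]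
      rw [← Finset.mul_sum, mul_comm, geom_sum_mul]
    have hA2 : eval 1 (derivative A) = ∑ n ∈ Finset.range n₀, (q - 1) * q ^ n * m n := by
      rw [hA, derivative_sum, eval_finsetSum]
      exact Finset.sum_congr rfl fun n _ => hder _ _
    have hP1 : eval 1 P = (1 - q) * (q ^ n₀ - 1) + (q - 1) * q ^ n₀ := by
      simp [hP, hQ1, hA1]
    have hP2 : eval 1 (derivative P) = -q * (q ^ n₀ - 1) +
        (1 - q) * ∑ n ∈ Finset.range n₀, (q - 1) * q ^ n * m n + (q - 1) * q ^ n₀ * (n₀ + k) := by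
      rw [hP, derivative_add, eval_add, hder, derivative_mul, eval_add, eval_mul, eval_mul, hQ1,
        hQ2, hA1, hA2]
      push_cast
      ring
    rw [hP1, hP2, hQ1, hQ2, zetaDeriv, ← hq]
    generalize ∑ n ∈ Finset.range n₀, (q - 1) * q ^ n * m n = A'
    have hB : q ^ (n₀ + 1) / (q - 1) * (1 - q) ^ 2 = q ^ (n₀ + 1) * (q - 1) := by
      rw [div_mul_eq_mul_div, div_eq_iff hq1]
      ring
    rw [eq_div_iff (pow_ne_zero 2 hq1'), add_mul, hB]
    ring

end Zeta

/-! ### Periods of the span of a graded sequence -/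

namespace IsGraded

variable {g : ℕ → KInf Fq} {m : ℕ → ℕ} (hg : IsGraded g m)
include hg

theorem tendsto_finprod_oneUnit {ϖ u : KInf Fq} {n₀ k : ℕ} (hk : ∀ n, n₀ ≤ n → m n = n + k)
    (hu : Tendsto (unitProd ϖ g) atTop (𝓝 u)) :
    Tendsto (fun M : ℕ => ∏ᶠ x ∈ {x | x ∈ Set.range (seqEval (Fq := Fq) g) ∧ x ≠ 0 ∧
      deg x ≤ (M : ℤ)}, oneUnit ϖ x) atTop (𝓝 u) := by
  -- For `M ≥ n₀ + k` the elements of degree at most `M` are spanned by the first `M - k + 1` terms.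
  have h1 : Tendsto (fun M : ℕ => M - k + 1) atTop atTop :=
    tendsto_atTop_mono (fun M => Nat.le_succ _) (tendsto_sub_atTop_nat k)
  refine (hu.comp h1).congr' ?_
  filter_upwards [eventually_ge_atTop (n₀ + k)] with M hM
  refine (hg.finprod_deg_le (r := M - k + 1) _ fun n => ?_).symm
  rcases le_or_gt n₀ n with hn | hn
  · rw [hk n hn]
    omega
  · have := hg.strictMono hn
    rw [hk n₀ le_rfl] at this
    omega

theorem eventually_finprod_sgn {n₀ k : ℕ} (hk : ∀ n, n₀ ≤ n → m n = n + k) :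
    ∀ᶠ M : ℕ in atTop, ∏ᶠ x ∈ {x | x ∈ Set.range (seqEval (Fq := Fq) g) ∧ x ≠ 0 ∧
      deg x = (M : ℤ)}, sgn x = -1 := by
  filter_upwards [eventually_ge_atTop (n₀ + k)] with M hM
  have := hg.finprod_sgn_deg_eq (M - k)
  rwa [hk _ (by omega), Nat.sub_add_cancel (by omega)] at this

/-- The data `η`, `t`, `u` of `IsPeriod` are unique, being limits or determined by `Z_S`; so being a
period means being a root of one explicit constant. -/
theorem isPeriod_iff {ϖ u : KInf Fq} {n₀ k : ℕ} (hk : ∀ n, n₀ ≤ n → m n = n + k)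
    (hu : Tendsto (unitProd ϖ g) atTop (𝓝 u)) {ξ : CInf Fq} :
    IsPeriod ϖ (Set.range (seqEval (Fq := Fq) g)) ξ ↔ ξ ^ (Fintype.card Fq - 1) =
      toC (algebraMap Fq (KInf Fq) (-1)⁻¹ * ϖ ^ (-zetaExponent Fq m n₀ k) *
        u ^ (Fintype.card Fq - 1)) := by
  constructor
  · rintro ⟨η, t, u', hη, ⟨z, hz, ht⟩, hu', h⟩
    obtain ⟨M, hM, hM'⟩ := (hη.and (hg.eventually_finprod_sgn hk)).exists
    obtain rfl : η = -1 := hM.symm.trans hM'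
    obtain rfl : u' = u := tendsto_nhds_unique (X := KInf Fq) hu' (hg.tendsto_finprod_oneUnit hk hu)
    obtain rfl := zetaDerivAtOne_unique hz (hg.zetaDerivAtOne hk)
    rw [← zetaExponent_eq, Int.cast_inj] at ht
    rw [h, ht]
  · intro h
    exact ⟨-1, _, u, hg.eventually_finprod_sgn hk, ⟨_, hg.zetaDerivAtOne hk, zetaExponent_eq m n₀ k⟩,
      hg.tendsto_finprod_oneUnit hk hu, h⟩

end IsGraded

/-! ### The quadratic unit, the sequence `Q_n`, and the two bases. -/

theorem isGraded_T_pow : IsGraded (fun n => T Fq ^ n) id where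
  strictMono := strictMono_id
  norm_eq n := by rw [norm_pow, norm_T]; rfl
  sgn_eq n := by rw [sgn_pow, sgn_T, one_pow]

theorem polyToK_eq_seqEval (p : Fq[X]) : polyToK p = seqEval (fun n => T Fq ^ n) p := by
  rw [polyToK, aeval_def, eval₂_eq_sum]
  rfl

theorem polyToK_X : polyToK (X : Fq[X]) = T Fq := by rw [polyToK, aeval_X]

theorem polyToK_C (c : Fq) : polyToK (C c) = algebraMap Fq (KInf Fq) c := by rw [polyToK, aeval_C]

theorem norm_polyToK {p : Fq[X]} (hp : p ≠ 0) :
    ‖polyToK p‖ = (Fintype.card Fq : ℝ) ^ p.natDegree := by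
  rw [polyToK_eq_seqEval, isGraded_T_pow.norm_seqEval hp]
  rfl

theorem sgn_polyToK {p : Fq[X]} (hp : p ≠ 0) : sgn (polyToK p) = p.leadingCoeff := by
  rw [polyToK_eq_seqEval, isGraded_T_pow.sgn_seqEval hp]

theorem eq_zero_of_norm_polyToK_lt_one {p : Fq[X]} (h : ‖polyToK p‖ < 1) : p = 0 := by
  by_contra hp
  rw [norm_polyToK hp] at h
  exact absurd h (one_le_pow₀ one_lt_card_real.le).not_gt

namespace QuadraticUnit

variable (U : QuadraticUnit Fq)

theorem f_mul_fstar : U.f * U.fstar = -algebraMap Fq (KInf Fq) U.b := by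
  rw [fstar]
  linear_combination -U.eq_f

theorem norm_f_mul_norm_fstar : ‖U.f‖ * ‖U.fstar‖ = 1 := by
  rw [← norm_mul, f_mul_fstar, norm_neg, norm_algebraMap_KInf U.b_ne_zero]

theorem one_lt_norm_f : 1 < ‖U.f‖ := by
  by_contra! h
  have h1 : ‖U.fstar‖ < 1 := U.dominant.trans_le h
  have h2 := U.norm_f_mul_norm_fstar
  nlinarith [norm_nonneg U.f, norm_nonneg U.fstar]

theorem f_ne_zero : U.f ≠ 0 := norm_pos_iff.1 (zero_lt_one.trans U.one_lt_norm_f)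

theorem norm_fstar_lt_one : ‖U.fstar‖ < 1 := by
  have h1 := U.one_lt_norm_f
  have h2 := U.norm_f_mul_norm_fstar
  by_contra! h
  nlinarith

theorem norm_f : ‖U.f‖ = (Fintype.card Fq : ℝ) ^ U.d := by
  have h : ‖U.f + U.fstar‖ = ‖U.f‖ := norm_add_of_norm_lt U.dominant
  rw [← h, fstar, add_sub_cancel, norm_polyToK U.monic_a.ne_zero, d]

theorem sgn_f : sgn U.f = 1 := by
  have h : sgn (U.f + U.fstar) = sgn U.f := sgn_add_of_norm_lt U.dominant
  rw [← h, fstar, add_sub_cancel, sgn_polyToK U.monic_a.ne_zero, U.monic_a]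

theorem d_pos : 0 < U.d := by
  by_contra! h
  have h1 := U.one_lt_norm_f
  rw [norm_f, Nat.le_zero.1 h, pow_zero] at h1
  exact lt_irrefl _ h1

theorem norm_fstar : ‖U.fstar‖ = ((Fintype.card Fq : ℝ) ^ U.d)⁻¹ := by
  rw [← norm_f]
  exact eq_inv_of_mul_eq_one_right U.norm_f_mul_norm_fstar

theorem norm_sqrtD : ‖U.sqrtD‖ = (Fintype.card Fq : ℝ) ^ U.d := by
  rw [sqrtD, sub_eq_add_neg, norm_add_of_norm_lt, norm_f]
  rw [norm_neg]
  exact U.dominant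

theorem sgn_sqrtD : sgn U.sqrtD = 1 := by
  rw [sqrtD, sub_eq_add_neg, sgn_add_of_norm_lt, sgn_f]
  rw [norm_neg]
  exact U.dominant

theorem fstar_sq : U.fstar ^ 2 = polyToK U.a * U.fstar + algebraMap Fq (KInf Fq) U.b := by
  rw [fstar]
  linear_combination U.eq_f

/-- Binet's formula: both sides satisfy the recursion of `Q`, because `f` and `f^*` are the roots of
`X² - aX - b`. -/
theorem sqrtD_mul_Q (n : ℕ) : U.sqrtD * polyToK (U.Q n) = U.f ^ (n + 1) - U.fstar ^ (n + 1) := by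
  induction n using Nat.twoStepInduction with
  | zero => simp [Q, sqrtD]
  | one =>
    rw [Q, sqrtD, fstar]
    ring
  | more n h0 h1 =>
    rw [Q, map_add, map_mul, map_mul, polyToK_C]
    linear_combination polyToK U.a * h1 + algebraMap Fq (KInf Fq) U.b * h0 -
      U.f ^ (n + 1) * U.eq_f + U.fstar ^ (n + 1) * U.fstar_sq

theorem sqrtD_ne_zero : U.sqrtD ≠ 0 := ne_zero_of_sgn_eq_one U.sgn_sqrtD

/-- By Binet the powers of `f` cancel. As `|f^*| < 1`, the polynomial `Q_{n+1}` is the one nearest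
to `Q_n f`. -/
theorem Q_mul_f_sub (n : ℕ) :
    polyToK (U.Q n) * U.f - polyToK (U.Q (n + 1)) = -U.fstar ^ (n + 1) := by
  apply mul_left_cancel₀ U.sqrtD_ne_zero
  rw [mul_sub, ← mul_assoc, sqrtD_mul_Q, sqrtD_mul_Q, sqrtD]
  ring

theorem monic_Q_and_natDegree (n : ℕ) : (U.Q n).Monic ∧ (U.Q n).natDegree = n * U.d := by
  induction n using Nat.twoStepInduction with
  | zero => simp [Q, monic_one]
  | one => simp [Q, U.monic_a, d]
  | more n h0 h1 =>
    have hm := U.monic_a.mul h1.1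
    have hd : (U.a * U.Q (n + 1)).natDegree = (n + 2) * U.d := by
      rw [U.monic_a.natDegree_mul h1.1, h1.2, d]
      ring
    have hlt : (C U.b * U.Q n).natDegree < (U.a * U.Q (n + 1)).natDegree := by
      refine (natDegree_C_mul_le _ _).trans_lt ?_
      rw [h0.2, hd]
      exact Nat.mul_lt_mul_of_pos_right (by omega) U.d_pos
    rw [Q]
    exact ⟨hm.add_of_left (degree_lt_degree hlt),
      (natDegree_add_eq_left_of_natDegree_lt hlt).trans hd⟩

/-- The element `f ^ n T ^ j` of degree `m = d n + j`, `0 ≤ j < d`. -/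
def ringElem (m : ℕ) : KInf Fq := U.f ^ (m / U.d) * T Fq ^ (m % U.d)

/-- The polynomial `Q_n T ^ j` of degree `m = d n + j`, `0 ≤ j < d`. -/
def polyElem (m : ℕ) : Fq[X] := U.Q (m / U.d) * X ^ (m % U.d)

theorem monic_polyElem (m : ℕ) : (U.polyElem m).Monic :=
  (U.monic_Q_and_natDegree _).1.mul (monic_X_pow _)

theorem natDegree_polyElem (m : ℕ) : (U.polyElem m).natDegree = m := by
  rw [polyElem, (U.monic_Q_and_natDegree _).1.natDegree_mul (monic_X_pow _),
    (U.monic_Q_and_natDegree _).2, natDegree_X_pow, Nat.div_add_mod']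

theorem isGraded_ringElem : IsGraded U.ringElem id where
  strictMono := strictMono_id
  norm_eq m := by
    rw [ringElem, norm_mul, norm_pow, norm_pow, norm_f, norm_T, ← pow_mul, ← pow_add,
      Nat.div_add_mod, id]
  sgn_eq m := by
    rw [ringElem, sgn_mul, sgn_pow, sgn_pow, sgn_f, sgn_T, one_pow, one_pow, one_mul]

theorem isGraded_polyElem : IsGraded (fun m => polyToK (U.polyElem m)) id where
  strictMono := strictMono_id
  norm_eq m := by
    rw [norm_polyToK (U.monic_polyElem m).ne_zero, natDegree_polyElem, id]
  sgn_eq m := by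
    rw [sgn_polyToK (U.monic_polyElem m).ne_zero, U.monic_polyElem m]

theorem _root_.QuantumDrinfeld.IsGraded.comp {g : ℕ → KInf Fq} {m : ℕ → ℕ} (hg : IsGraded g m)
    {ν : ℕ → ℕ} (hν : StrictMono ν) : IsGraded (fun n => g (ν n)) fun n => m (ν n) where
  strictMono := hg.strictMono.comp hν
  norm_eq n := hg.norm_eq (ν n)
  sgn_eq n := hg.sgn_eq (ν n)

/-- The degrees `d, …, d + i, 2d, 2d + 1, …` of the elements of `𝔞_i`. -/
def idealDeg (i n : ℕ) : ℕ := if n ≤ i then U.d + n else 2 * U.d + (n - i - 1)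

theorem strictMono_idealDeg {i : ℕ} (hi : i < U.d) : StrictMono (U.idealDeg i) := by
  intro n n' h
  unfold idealDeg
  split_ifs <;> omega

theorem idealDeg_eq_add {i : ℕ} (hi : i < U.d) (n : ℕ) (hn : i + 1 ≤ n) :
    U.idealDeg i n = n + (2 * U.d - i - 1) := by
  rw [idealDeg, if_neg (by omega)]
  omega

/-- In `𝔞_i` the first power of `f` comes only with `T^j`, `j ≤ i`, the higher powers with every
`T^j`, `j < d`. -/
theorem idealDeg_div_mod {i n : ℕ} (hi : i < U.d) :
    (n ≤ i ∧ U.idealDeg i n / U.d = 1 ∧ U.idealDeg i n % U.d = n) ∨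
      (2 ≤ U.idealDeg i n / U.d ∧ U.idealDeg i n % U.d < U.d) := by
  have hd := U.d_pos
  unfold idealDeg
  split_ifs with h
  · left
    refine ⟨h, ?_, ?_⟩
    · rw [Nat.add_div_left _ hd, Nat.div_eq_of_lt (by omega)]
    · rw [Nat.add_mod_left, Nat.mod_eq_of_lt (by omega)]
  · right
    refine ⟨(Nat.le_div_iff_mul_le hd).2 (by omega), Nat.mod_lt _ hd⟩

/-- The graded sequence spanning `𝔞_i`. -/
def idealSeq (i n : ℕ) : KInf Fq := U.ringElem (U.idealDeg i n)

/-- The graded sequence spanning `Λ_{ε_{N,l}}(f)`, `i = d - 1 - l`. -/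
def approxSeq (N i n : ℕ) : KInf Fq :=
  polyToK (U.polyElem (U.idealDeg i n + U.d * (N - 1)))

theorem isGraded_idealSeq {i : ℕ} (hi : i < U.d) : IsGraded (U.idealSeq i) (U.idealDeg i) :=
  U.isGraded_ringElem.comp (U.strictMono_idealDeg hi)

theorem isGraded_approxSeq (N : ℕ) {i : ℕ} (hi : i < U.d) :
    IsGraded (U.approxSeq N i) fun n => U.idealDeg i n + U.d * (N - 1) :=
  U.isGraded_polyElem.comp ((U.strictMono_idealDeg hi).add_const _)

/-- The factor `√D f ^ (-N)`, by which `Λ_{ε_{N,l}}(f)` is close to `𝔞_{d-1-l}`. -/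
def scaleFactor (N : ℕ) : KInf Fq := U.sqrtD / U.f ^ N

theorem sgn_scaleFactor (N : ℕ) : sgn (U.scaleFactor N) = 1 := by
  rw [scaleFactor, sgn_div, sgn_sqrtD, sgn_pow, sgn_f, one_pow, div_one]

theorem norm_scaleFactor (N : ℕ) :
    ‖U.scaleFactor N‖ = (Fintype.card Fq : ℝ) ^ U.d / (Fintype.card Fq : ℝ) ^ (U.d * N) := by
  rw [scaleFactor, norm_div, norm_sqrtD, norm_pow, norm_f, pow_mul]

theorem isGraded_scaleFactor_mul {N : ℕ} (hN : 1 ≤ N) {i : ℕ} (hi : i < U.d) :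
    IsGraded (fun n => U.scaleFactor N * U.approxSeq N i n) (U.idealDeg i) where
  strictMono := U.strictMono_idealDeg hi
  norm_eq n := by
    obtain ⟨N, rfl⟩ : ∃ M, N = M + 1 := ⟨N - 1, by omega⟩
    have h0 : (Fintype.card Fq : ℝ) ≠ 0 := (zero_lt_one.trans one_lt_card_real).ne'
    rw [norm_mul, norm_scaleFactor, (U.isGraded_approxSeq (N + 1) hi).norm_eq, Nat.add_sub_cancel,
      pow_add, mul_add, pow_add, mul_one]
    field_simp
  sgn_eq n := by
    rw [sgn_mul, sgn_scaleFactor, (U.isGraded_approxSeq N hi).sgn_eq, mul_one]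

theorem scaleFactor_mul_approxSeq_sub {N : ℕ} (hN : 1 ≤ N) (i n : ℕ) :
    U.scaleFactor N * U.approxSeq N i n - U.idealSeq i n =
      -(U.fstar ^ (N + U.idealDeg i n / U.d) / U.f ^ N * T Fq ^ (U.idealDeg i n % U.d)) := by
  obtain ⟨N, rfl⟩ : ∃ M, N = M + 1 := ⟨N - 1, by omega⟩
  have hf : U.f ^ (N + 1) ≠ 0 := pow_ne_zero _ U.f_ne_zero
  have h := U.sqrtD_mul_Q (N + U.idealDeg i n / U.d)
  rw [scaleFactor, approxSeq, idealSeq, ringElem, polyElem, Nat.add_sub_cancel,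
    Nat.add_mul_div_left _ _ U.d_pos, Nat.add_mul_mod_self_left, map_mul, map_pow, polyToK_X,
    add_comm _ N]
  have h' : U.f ^ (N + U.idealDeg i n / U.d + 1) = U.f ^ (N + 1) * U.f ^ (U.idealDeg i n / U.d) := by
    ring
  rw [h', add_right_comm] at h
  field_simp
  linear_combination (T Fq ^ (U.idealDeg i n % U.d)) * h

/-- By Binet the error is `(f^*)^{N+k} f^{-N} T^j`, compared with `f^k T^j`; as `|f^*| < 1` and `|f|
≥ q`, the ratio is at most `q^{-N}`. What matters later is the uniformity in `n`. -/
theorem norm_scaleFactor_mul_approxSeq_sub_le {N : ℕ} (hN : 1 ≤ N) (i n : ℕ) :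
    ‖U.scaleFactor N * U.approxSeq N i n - U.idealSeq i n‖ ≤
      (Fintype.card Fq : ℝ)⁻¹ ^ N * ‖U.idealSeq i n‖ := by
  have hq : (1 : ℝ) < Fintype.card Fq := one_lt_card_real
  rw [scaleFactor_mul_approxSeq_sub U hN, norm_neg, norm_mul, norm_div, norm_pow, norm_pow,
    idealSeq, ringElem, norm_mul, norm_pow U.f, ← mul_assoc]
  refine mul_le_mul_of_nonneg_right ?_ (norm_nonneg _)
  have h1 : ‖U.fstar‖ ^ (N + U.idealDeg i n / U.d) ≤ 1 :=
    pow_le_one₀ (norm_nonneg _) U.norm_fstar_lt_one.le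
  have h2 : (Fintype.card Fq : ℝ) ≤ ‖U.f‖ := by
    rw [norm_f]
    exact le_self_pow₀ hq.le U.d_pos.ne'
  have h3 : 1 ≤ ‖U.f‖ ^ (U.idealDeg i n / U.d) := one_le_pow₀ U.one_lt_norm_f.le
  calc _ ≤ 1 / (Fintype.card Fq : ℝ) ^ N :=
        div_le_div₀ zero_le_one h1 (by positivity) (pow_le_pow_left₀ (by positivity) h2 N)
    _ = (Fintype.card Fq : ℝ)⁻¹ ^ N := by rw [inv_pow, one_div]
    _ ≤ _ := le_mul_of_one_le_right (by positivity) h3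

end QuadraticUnit

theorem algebraMap_mul_mem_range {g : ℕ → KInf Fq} (c : Fq) {x : KInf Fq}
    (hx : x ∈ (seqEval (Fq := Fq) g).range) :
    algebraMap Fq (KInf Fq) c * x ∈ (seqEval (Fq := Fq) g).range := by
  obtain ⟨p, rfl⟩ := hx
  exact ⟨C c * p, seqEval_C_mul g c p⟩

theorem seqEval_mem {H : AddSubgroup (KInf Fq)}
    (hH : ∀ (c : Fq) x, x ∈ H → algebraMap Fq (KInf Fq) c * x ∈ H) {g : ℕ → KInf Fq}
    (hg : ∀ n, g n ∈ H) (p : Fq[X]) : seqEval g p ∈ H := by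
  rw [seqEval_eq_sum]
  exact sum_mem fun n _ => hH _ _ (hg n)

theorem norm_lt_of_norm_sum_lt {L : Type*} [SeminormedAddCommGroup L] [IsUltrametricDist L]
    {ι : Type*} {s : Finset ι} {f : ι → L} (hf : Set.Pairwise (s : Set ι) fun i j => ‖f i‖ ≠ ‖f j‖)
    {ε : ℝ} (h : ‖∑ i ∈ s, f i‖ < ε) {i : ι} (hi : i ∈ s) : ‖f i‖ < ε := by
  rw [IsUltrametricDist.norm_sum_eq_sup'_of_pairwise_ne ⟨i, hi⟩ hf] at h
  exact (Finset.le_sup' (fun i => ‖f i‖) hi).trans_lt h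

/-! ### The `𝔽_q`-basis of the ideals `𝔞_i`. -/

namespace QuadraticUnit

variable (U : QuadraticUnit Fq)

theorem idealSeq_mem_range (i n : ℕ) : U.idealSeq i n ∈ (seqEval (Fq := Fq) (U.idealSeq i)).range :=
  ⟨X ^ n, seqEval_X_pow _ n⟩

/-- The equation `f² = a f + b` solved for the top term of `a f`. It serves to lower exponents of
`T`, and later to determine `(𝔞_0 : 𝔞_i)`. -/
theorem f_mul_T_pow_d : U.f * T Fq ^ U.d = U.f ^ 2 - algebraMap Fq (KInf Fq) U.b -
    ∑ j ∈ Finset.range U.d, algebraMap Fq (KInf Fq) (U.a.coeff j) * (U.f * T Fq ^ j) := by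
  have h1 := congr_arg polyToK U.monic_a.as_sum
  simp only [map_add, map_sum, map_mul, map_pow, polyToK_X, polyToK_C] at h1
  have h2 := U.eq_f
  rw [h1] at h2
  have h3 : ∑ j ∈ Finset.range U.d, algebraMap Fq (KInf Fq) (U.a.coeff j) * (U.f * T Fq ^ j) =
      (∑ j ∈ Finset.range U.d, algebraMap Fq (KInf Fq) (U.a.coeff j) * T Fq ^ j) * U.f := by
    rw [Finset.sum_mul]
    exact Finset.sum_congr rfl fun j _ => by ring
  rw [h3]
  unfold d
  linear_combination -h2

/-- Monomials with `e < d` are basis elements; otherwise the relation for `f T^d` lowers `e`. The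
bound on `e` is chosen to survive this: it holds again for the three kinds of monomials `f^{n+1}
T^{e-d}`, `f^{n-1} T^{e-d}` and `f^n T^{e-d+j}`, `j < d`, that appear. -/
theorem f_pow_mul_T_pow_mem_range {i : ℕ} (hi : i < U.d) (e n : ℕ) (hn : 1 ≤ n)
    (he : e ≤ (n - 1) * U.d + i) :
    U.f ^ n * T Fq ^ e ∈ (seqEval (Fq := Fq) (U.idealSeq i)).range := by
  induction e using Nat.strong_induction_on generalizing n with
  | _ e ih =>
    have hd := U.d_pos
    rcases lt_or_ge e U.d with hlt | hge
    · have hex : ∃ k, U.idealDeg i k = n * U.d + e := by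
        rcases hn.eq_or_lt with rfl | hn
        · refine ⟨e, ?_⟩
          rw [idealDeg, if_pos (by omega)]
          ring
        · obtain ⟨n, rfl⟩ : ∃ n', n = n' + 2 := ⟨n - 2, by omega⟩
          refine ⟨n * U.d + e + i + 1, ?_⟩
          rw [idealDeg, if_neg (by omega), add_mul]
          omega
      obtain ⟨k, hk⟩ := hex
      have := U.idealSeq_mem_range i k
      rwa [idealSeq, ringElem, hk, mul_comm n, Nat.mul_add_div hd, Nat.mul_add_mod,
        Nat.div_eq_of_lt hlt, Nat.mod_eq_of_lt hlt, add_zero] at this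
    · obtain ⟨e, rfl⟩ : ∃ e', e = e' + U.d := ⟨e - U.d, by omega⟩
      -- For `n = 1` the bound gives `e ≤ i < d`, so the reduction only occurs when `n ≥ 2`.
      obtain ⟨n, rfl⟩ : ∃ n', n = n' + 2 := ⟨n - 2, by
        rcases hn.eq_or_lt with rfl | hn
        · simp at he
          omega
        · omega⟩
      have hb : (n + 2 - 1) * U.d = n * U.d + U.d := by
        rw [show n + 2 - 1 = n + 1 by omega]
        ring
      rw [hb] at he
      have h : U.f ^ (n + 2) * T Fq ^ (e + U.d) = U.f ^ (n + 3) * T Fq ^ e -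
          algebraMap Fq (KInf Fq) U.b * (U.f ^ (n + 1) * T Fq ^ e) -
          ∑ j ∈ Finset.range U.d, algebraMap Fq (KInf Fq) (U.a.coeff j) *
            (U.f ^ (n + 2) * T Fq ^ (e + j)) := by
        have h3 : ∑ j ∈ Finset.range U.d, algebraMap Fq (KInf Fq) (U.a.coeff j) *
            (U.f ^ (n + 2) * T Fq ^ (e + j)) = U.f ^ (n + 1) * T Fq ^ e *
            ∑ j ∈ Finset.range U.d, algebraMap Fq (KInf Fq) (U.a.coeff j) * (U.f * T Fq ^ j) := by
          rw [Finset.mul_sum]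
          exact Finset.sum_congr rfl fun j _ => by ring
        rw [h3]
        linear_combination (U.f ^ (n + 1) * T Fq ^ e) * U.f_mul_T_pow_d
      rw [h]
      refine sub_mem (sub_mem (ih e (by omega) _ (by omega) ?_)
        (algebraMap_mul_mem_range _ (ih e (by omega) _ (by omega) ?_))) (sum_mem fun j hj =>
          algebraMap_mul_mem_range _ (ih _ ?_ _ (by omega) ?_))
      · rw [show n + 3 - 1 = n + 2 by omega, add_mul]
        omega
      · rw [show n + 1 - 1 = n by omega]
        omega
      · rw [Finset.mem_range] at hj
        omega
      · rw [Finset.mem_range] at hj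
        rw [hb]
        omega

/-- A generator `f T^j` raises the exponent of `f` by one and that of `T` by `j < d`, which stays
within the bound of `f_pow_mul_T_pow_mem_range`. -/
theorem mul_mem_range_idealSeq {i : ℕ} (hi : i < U.d) {r : KInf Fq} (hr : r ∈ U.ringA)
    {x : KInf Fq} (hx : x ∈ (seqEval (Fq := Fq) (U.idealSeq i)).range) :
    r * x ∈ (seqEval (Fq := Fq) (U.idealSeq i)).range := by
  induction hr using Algebra.adjoin_induction generalizing x with
  | algebraMap c => exact algebraMap_mul_mem_range c hx
  | add r s _ _ hr hs =>
    rw [add_mul]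
    exact add_mem (hr hx) (hs hx)
  | mul r s _ _ hr hs =>
    rw [mul_assoc]
    exact hr (hs hx)
  | mem r hr =>
    obtain ⟨j, hj, rfl⟩ := hr
    obtain ⟨p, rfl⟩ := hx
    rw [seqEval_eq_sum, Finset.mul_sum]
    refine sum_mem fun n _ => ?_
    rw [mul_left_comm]
    refine algebraMap_mul_mem_range _ ?_
    have h : U.f * T Fq ^ j * U.idealSeq i n =
        U.f ^ (U.idealDeg i n / U.d + 1) * T Fq ^ (j + U.idealDeg i n % U.d) := by
      rw [idealSeq, ringElem]
      ring
    simp only [h]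
    refine U.f_pow_mul_T_pow_mem_range hi _ _ (Nat.le_add_left 1 _) ?_
    have hj : j < U.d := hj
    rw [Nat.add_sub_cancel]
    rcases U.idealDeg_div_mod (n := n) hi with ⟨h1, h2, h3⟩ | ⟨h1, h2⟩
    · rw [h2, h3]
      omega
    · have := Nat.mul_le_mul_right U.d h1
      omega

theorem f_mul_T_pow_mem_ringA {j : ℕ} (hj : j < U.d) : U.f * T Fq ^ j ∈ U.ringA :=
  Algebra.subset_adjoin ⟨j, hj, rfl⟩

theorem f_mem_ringA : U.f ∈ U.ringA := by
  simpa using U.f_mul_T_pow_mem_ringA U.d_pos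

theorem mul_mem_idealA {i : ℕ} {r x : KInf Fq} (hr : r ∈ U.ringA) (hx : x ∈ U.idealA i) :
    r * x ∈ U.idealA i :=
  (U.idealA i).smul_mem ⟨r, hr⟩ hx

theorem f_mul_T_pow_mem_idealA {i j : ℕ} (hj : j ≤ i) : U.f * T Fq ^ j ∈ U.idealA i :=
  Submodule.subset_span ⟨j, hj, rfl⟩

theorem algebraMap_mul_mem_idealA {i : ℕ} (c : Fq) {x : KInf Fq} (hx : x ∈ U.idealA i) :
    algebraMap Fq (KInf Fq) c * x ∈ U.idealA i :=
  U.mul_mem_idealA (U.ringA.algebraMap_mem c) hx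

theorem idealSeq_mem_idealA {i : ℕ} (hi : i < U.d) (n : ℕ) : U.idealSeq i n ∈ U.idealA i := by
  rw [idealSeq, ringElem]
  rcases U.idealDeg_div_mod (n := n) hi with ⟨h1, h2, h3⟩ | ⟨h1, h2⟩
  · rw [h2, h3, pow_one]
    exact U.f_mul_T_pow_mem_idealA h1
  · obtain ⟨k, hk⟩ : ∃ k, U.idealDeg i n / U.d = k + 2 := ⟨_, (Nat.sub_add_cancel h1).symm⟩
    rw [hk]
    have : U.f ^ (k + 2) * T Fq ^ (U.idealDeg i n % U.d) =
        (U.f ^ k * (U.f * T Fq ^ (U.idealDeg i n % U.d))) * (U.f * T Fq ^ 0) := by ring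
    rw [this]
    exact U.mul_mem_idealA (mul_mem (pow_mem U.f_mem_ringA k) (U.f_mul_T_pow_mem_ringA h2))
      (U.f_mul_T_pow_mem_idealA (Nat.zero_le i))

theorem mem_idealA_iff {i : ℕ} (hi : i < U.d) {x : KInf Fq} :
    x ∈ U.idealA i ↔ x ∈ (seqEval (Fq := Fq) (U.idealSeq i)).range := by
  constructor
  · intro hx
    induction hx using Submodule.span_induction with
    | mem x hx =>
      obtain ⟨j, hj, rfl⟩ := hx
      have hj : j ≤ i := hj
      simpa using U.f_pow_mul_T_pow_mem_range hi j 1 le_rfl (by omega)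
    | zero => exact zero_mem _
    | add x y _ _ hx hy => exact add_mem hx hy
    | smul r x _ hx => exact U.mul_mem_range_idealSeq hi r.2 hx
  · rintro ⟨p, rfl⟩
    exact seqEval_mem (H := (U.idealA i).toAddSubgroup)
      (fun c x hx => U.algebraMap_mul_mem_idealA c hx) (U.idealSeq_mem_idealA hi) p

theorem coe_idealA {i : ℕ} (hi : i < U.d) :
    (U.idealA i : Set (KInf Fq)) = Set.range (seqEval (Fq := Fq) (U.idealSeq i)) := by
  ext x
  exact U.mem_idealA_iff hi

/-! ### The vector spaces `Λ_ε(f)` -/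

/-- The `Q_n T^j` with `j < d` contain exactly one monic polynomial of each degree, hence form a
basis of `A`. -/
theorem exists_polyToK_eq_seqEval (x : Fq[X]) :
    ∃ p : Fq[X], polyToK x = seqEval (fun m => polyToK (U.polyElem m)) p := by
  let S : Polynomial.Sequence Fq :=
    ⟨U.polyElem, fun m => by
      rw [degree_eq_natDegree (U.monic_polyElem m).ne_zero, natDegree_polyElem]⟩
  have hx : x ∈ Submodule.span Fq (Set.range S) := by
    rw [S.span fun m => by
      change IsUnit (U.polyElem m).leadingCoeff
      rw [U.monic_polyElem m]
      exact isUnit_one]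
    trivial
  induction hx using Submodule.span_induction with
  | mem x hx =>
    obtain ⟨m, rfl⟩ := hx
    refine ⟨X ^ m, ?_⟩
    rw [seqEval_X_pow]
  | zero => exact ⟨0, by simp⟩
  | add x y _ _ hx hy =>
    obtain ⟨p, hp⟩ := hx
    obtain ⟨p', hp'⟩ := hy
    exact ⟨p + p', by rw [map_add, map_add, hp, hp']⟩
  | smul c x _ hx =>
    obtain ⟨p, hp⟩ := hx
    exact ⟨C c * p, by rw [seqEval_C_mul, smul_eq_C_mul, map_mul, polyToK_C, hp]⟩

/-- The polynomial nearest to `f Q_n T ^ j`, where `m = d n + j`. -/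
def nearPoly (m : ℕ) : Fq[X] := U.Q (m / U.d + 1) * X ^ (m % U.d)

theorem polyElem_mul_f_sub (m : ℕ) : polyToK (U.polyElem m) * U.f - polyToK (U.nearPoly m) =
    -(U.fstar ^ (m / U.d + 1) * T Fq ^ (m % U.d)) := by
  rw [polyElem, nearPoly, map_mul, map_mul, map_pow, polyToK_X]
  linear_combination (T Fq ^ (m % U.d)) * U.Q_mul_f_sub (m / U.d)

theorem norm_polyElem_mul_f_sub (m : ℕ) :
    ‖polyToK (U.polyElem m) * U.f - polyToK (U.nearPoly m)‖ =
      (Fintype.card Fq : ℝ) ^ ((m % U.d : ℕ) - (U.d * (m / U.d + 1) : ℕ) : ℤ) := by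
  have h0 : (Fintype.card Fq : ℝ) ≠ 0 := (zero_lt_one.trans one_lt_card_real).ne'
  rw [polyElem_mul_f_sub, norm_neg, norm_mul, norm_pow, norm_pow, norm_fstar, norm_T, inv_pow,
    ← pow_mul, zpow_sub₀ h0, zpow_natCast, zpow_natCast, inv_mul_eq_div]

theorem eps_eq_zpow (N l : ℕ) :
    U.eps N l = (Fintype.card Fq : ℝ) ^ (-(U.d * N + l : ℕ) : ℤ) := by
  rw [eps, zpow_neg, zpow_natCast]

theorem eps_le_one (N l : ℕ) : U.eps N l ≤ 1 :=
  inv_le_one_of_one_le₀ (one_le_pow₀ one_lt_card_real.le)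

theorem norm_polyElem_mul_f_sub_lt_eps_iff (N l m : ℕ) :
    ‖polyToK (U.polyElem m) * U.f - polyToK (U.nearPoly m)‖ < U.eps N l ↔
      U.d * N + l + m % U.d < U.d * (m / U.d + 1) := by
  rw [norm_polyElem_mul_f_sub, eps_eq_zpow, zpow_lt_zpow_iff_right₀ one_lt_card_real]
  omega

theorem norm_polyElem_mul_f_sub_lt_one (m : ℕ) :
    ‖polyToK (U.polyElem m) * U.f - polyToK (U.nearPoly m)‖ < 1 := by
  have h := Nat.mod_lt m U.d_pos
  rw [norm_polyElem_mul_f_sub, ← zpow_zero (Fintype.card Fq : ℝ),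
    zpow_lt_zpow_iff_right₀ one_lt_card_real, mul_add]
  omega

/-- The distances are `q^{j - d(n+1)}` with `0 ≤ j < d`, so they determine `n` and `j`. Being
distinct, they cannot cancel in a sum, and smallness can be tested term by term. -/
theorem norm_polyElem_mul_f_sub_injective : Function.Injective fun m =>
    ‖polyToK (U.polyElem m) * U.f - polyToK (U.nearPoly m)‖ := by
  intro m m' h
  simp only [norm_polyElem_mul_f_sub] at h
  have h1 := zpow_right_injective₀ (zero_lt_one.trans one_lt_card_real) one_lt_card_real.ne' h
  have hm := Nat.mod_lt m U.d_pos
  have hm' := Nat.mod_lt m' U.d_pos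
  have hq : m / U.d = m' / U.d := by
    rcases lt_trichotomy (m / U.d) (m' / U.d) with hlt | heq | hlt
    · have := Nat.mul_le_mul_left U.d (Nat.succ_le_succ hlt)
      simp only [mul_add, Nat.succ_eq_add_one] at this h1
      omega
    · exact heq
    · have := Nat.mul_le_mul_left U.d (Nat.succ_le_succ hlt)
      simp only [mul_add, Nat.succ_eq_add_one] at this h1
      omega
  rw [hq] at h1
  rw [← Nat.div_add_mod m U.d, ← Nat.div_add_mod m' U.d, hq]
  omega

/-- For `m = d n + j` the inequality fails if `n < N`, means `j ≤ d - 1 - l` if `n = N`, and always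
holds if `n > N`: these are the degrees of `𝔞_{d-1-l}` shifted by `d (N - 1)`. -/
theorem lt_iff_exists_idealDeg {N l m : ℕ} (hN : 1 ≤ N) (hl : l < U.d) :
    U.d * N + l + m % U.d < U.d * (m / U.d + 1) ↔
      ∃ n, m = U.idealDeg (U.d - 1 - l) n + U.d * (N - 1) := by
  obtain ⟨N, rfl⟩ : ∃ M, N = M + 1 := ⟨N - 1, by omega⟩
  rw [Nat.add_sub_cancel]
  have hd := U.d_pos
  constructor
  · intro h
    have hm := Nat.div_add_mod m U.d
    have hmd := Nat.mod_lt m hd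
    have h1 : N + 1 ≤ m / U.d := by
      by_contra! hcon
      have : U.d * (m / U.d + 1) ≤ U.d * (N + 1) := Nat.mul_le_mul_left U.d hcon
      omega
    rcases h1.eq_or_lt with h2 | h2
    · rw [← h2] at h hm
      refine ⟨m % U.d, ?_⟩
      simp only [mul_add] at h hm
      rw [idealDeg, if_pos (by omega)]
      omega
    · have := Nat.mul_le_mul_left U.d (Nat.succ_le_of_lt h2)
      simp only [mul_add, Nat.succ_eq_add_one] at this
      refine ⟨m - U.d * N - 2 * U.d + (U.d - 1 - l) + 1, ?_⟩
      rw [idealDeg, if_neg (by omega)]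
      omega
  · rintro ⟨n, rfl⟩
    rw [Nat.add_mul_div_left _ _ hd, Nat.add_mul_mod_self_left]
    rcases U.idealDeg_div_mod (i := U.d - 1 - l) (n := n) (by omega) with ⟨h1, h2, h3⟩ | ⟨h1, h2⟩
    · rw [h2, h3]
      simp only [mul_add]
      omega
    · have := Nat.mul_le_mul_left U.d h1
      simp only [mul_add]
      omega

theorem seqEval_mul_f_sub (p : Fq[X]) :
    seqEval (fun m => polyToK (U.polyElem m)) p * U.f - seqEval (fun m => polyToK (U.nearPoly m)) p =
      seqEval (fun m => polyToK (U.polyElem m) * U.f - polyToK (U.nearPoly m)) p := by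
  simp only [seqEval_eq_sum, mul_sub, Finset.sum_sub_distrib, Finset.sum_mul, mul_assoc]

theorem seqEval_polyToK (G : ℕ → Fq[X]) (p : Fq[X]) :
    seqEval (fun m => polyToK (G m)) p = polyToK (∑ m ∈ p.support, C (p.coeff m) * G m) := by
  simp only [seqEval_eq_sum, map_sum, map_mul, polyToK_C]

/-- Expand `x` in the basis `Q_n T^j`. The distance of `x f` to its nearest polynomial is a sum of
terms of distinct norms, so it is less than `ε` exactly when each term is. -/
theorem approx_eq {N l : ℕ} (hN : 1 ≤ N) (hl : l < U.d) :
    U.approx (U.eps N l) = Set.range (seqEval (Fq := Fq) (U.approxSeq N (U.d - 1 - l))) := by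
  ext y
  constructor
  · rintro ⟨x, rfl, x', hx'⟩
    obtain ⟨p, hp⟩ := U.exists_polyToK_eq_seqEval x
    set x'' := ∑ m ∈ p.support, C (p.coeff m) * U.nearPoly m with hx''
    have h1 : polyToK x * U.f - polyToK x'' =
        seqEval (fun m => polyToK (U.polyElem m) * U.f - polyToK (U.nearPoly m)) p := by
      rw [hp, ← seqEval_mul_f_sub, seqEval_polyToK U.nearPoly]
    have h2 : ‖polyToK x * U.f - polyToK x''‖ < 1 := by
      rw [h1, seqEval_eq_sum]
      refine norm_sum_lt_of_forall_lt zero_lt_one fun m _ => ?_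
      rw [norm_mul]
      exact (mul_le_of_le_one_left (norm_nonneg _) (norm_algebraMap_le_one _)).trans_lt
        (U.norm_polyElem_mul_f_sub_lt_one m)
    -- Both polynomials are at distance less than `1` from `x f`, and a polynomial of norm less than
    -- `1` is zero.
    have h3 : x'' = x' := by
      rw [← sub_eq_zero]
      apply eq_zero_of_norm_polyToK_lt_one
      have : polyToK (x'' - x') = (polyToK x * U.f - polyToK x') -
          (polyToK x * U.f - polyToK x'') := by
        rw [map_sub]
        ring
      rw [this]
      exact (norm_sub_le_max_of_ultra _ _).trans_lt (max_lt (hx'.trans_le (U.eps_le_one N l)) h2)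
    rw [← h3, h1, seqEval_eq_sum] at hx'
    have hne : ∀ m ∈ p.support, ‖algebraMap Fq (KInf Fq) (p.coeff m) *
        (polyToK (U.polyElem m) * U.f - polyToK (U.nearPoly m))‖ =
        ‖polyToK (U.polyElem m) * U.f - polyToK (U.nearPoly m)‖ := by
      intro m hm
      rw [norm_mul, norm_algebraMap_KInf (mem_support_iff.1 hm), one_mul]
    have h4 : ∀ m ∈ p.support, ∃ n, m = U.idealDeg (U.d - 1 - l) n + U.d * (N - 1) := by
      intro m hm
      rw [← U.lt_iff_exists_idealDeg hN hl, ← norm_polyElem_mul_f_sub_lt_eps_iff, ← hne m hm]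
      refine norm_lt_of_norm_sum_lt (fun m hm m' hm' h => ?_) hx' hm
      beta_reduce
      rw [hne m hm, hne m' hm']
      exact U.norm_polyElem_mul_f_sub_injective.ne h
    rw [hp, seqEval_eq_sum]
    change _ ∈ (seqEval (Fq := Fq) (U.approxSeq N (U.d - 1 - l))).range
    refine sum_mem fun m hm => algebraMap_mul_mem_range _ ?_
    obtain ⟨n, rfl⟩ := h4 m hm
    exact ⟨X ^ n, seqEval_X_pow _ n⟩
  · rintro ⟨p, rfl⟩
    set M := fun n => U.idealDeg (U.d - 1 - l) n + U.d * (N - 1) with hM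
    refine ⟨∑ n ∈ p.support, C (p.coeff n) * U.polyElem (M n), (seqEval_polyToK _ p).symm,
      ∑ n ∈ p.support, C (p.coeff n) * U.nearPoly (M n), ?_⟩
    have h : polyToK (∑ n ∈ p.support, C (p.coeff n) * U.polyElem (M n)) * U.f -
        polyToK (∑ n ∈ p.support, C (p.coeff n) * U.nearPoly (M n)) =
        ∑ n ∈ p.support, algebraMap Fq (KInf Fq) (p.coeff n) *
          (polyToK (U.polyElem (M n)) * U.f - polyToK (U.nearPoly (M n))) := by
      simp only [map_sum, map_mul, polyToK_C, mul_sub, Finset.sum_sub_distrib, Finset.sum_mul,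
        mul_assoc]
    rw [h]
    refine norm_sum_lt_of_forall_lt (inv_pos.2 (pow_pos (zero_lt_one.trans one_lt_card_real) _))
      fun n _ => ?_
    rw [norm_mul]
    refine (mul_le_of_le_one_left (norm_nonneg _) (norm_algebraMap_le_one _)).trans_lt ?_
    rw [norm_polyElem_mul_f_sub_lt_eps_iff, U.lt_iff_exists_idealDeg hN hl]
    exact ⟨n, rfl⟩

end QuadraticUnit

/-! ### Additive polynomials -/

theorem X_mem_additivePolys : (X : (CInf Fq)[X]) ∈ additivePolys Fq :=
  Submodule.subset_span ⟨0, by simp⟩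

theorem add_pow_card {R : Type*} [CommRing R] [Algebra Fq R] (x y : R) (k : ℕ) :
    (x + y) ^ Fintype.card Fq ^ k = x ^ Fintype.card Fq ^ k + y ^ Fintype.card Fq ^ k := by
  induction k generalizing x y with
  | zero => simp
  | succ k ih =>
    rw [pow_succ', pow_mul, pow_mul, pow_mul, ← ih]
    congr 1
    exact map_add (FiniteField.frobeniusAlgHom Fq R) x y

theorem pow_card_mem_additivePolys {P : (CInf Fq)[X]} (hP : P ∈ additivePolys Fq) (k : ℕ) :
    P ^ Fintype.card Fq ^ k ∈ additivePolys Fq := by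
  induction hP using Submodule.span_induction with
  | mem P hP =>
    obtain ⟨n, rfl⟩ := hP
    exact Submodule.subset_span ⟨n + k, by simp only [← pow_mul, pow_add]⟩
  | zero =>
    rw [zero_pow (pow_ne_zero _ Fintype.card_ne_zero)]
    exact zero_mem _
  | add P P' _ _ h h' =>
    rw [add_pow_card]
    exact add_mem h h'
  | smul c P _ h =>
    rw [_root_.smul_pow]
    exact Submodule.smul_mem _ _ h

theorem C_mul_mem_additivePolys (c : CInf Fq) {P : (CInf Fq)[X]} (hP : P ∈ additivePolys Fq) :
    C c * P ∈ additivePolys Fq := by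
  rw [← smul_eq_C_mul]
  exact Submodule.smul_mem _ _ hP

theorem comp_mem_additivePolys {P R : (CInf Fq)[X]} (hP : P ∈ additivePolys Fq)
    (hR : R ∈ additivePolys Fq) : P.comp R ∈ additivePolys Fq := by
  induction hP using Submodule.span_induction with
  | mem P hP =>
    obtain ⟨n, rfl⟩ := hP
    rw [X_pow_comp]
    exact pow_card_mem_additivePolys hR n
  | zero =>
    rw [zero_comp]
    exact zero_mem _
  | add P P' _ _ h h' =>
    rw [add_comp]
    exact add_mem h h'
  | smul c P _ h =>
    rw [smul_comp]
    exact Submodule.smul_mem _ _ h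

theorem comp_add_of_mem_additivePolys {P : (CInf Fq)[X]} (hP : P ∈ additivePolys Fq)
    (R S : (CInf Fq)[X]) : P.comp (R + S) = P.comp R + P.comp S := by
  induction hP using Submodule.span_induction with
  | mem P hP =>
    obtain ⟨n, rfl⟩ := hP
    simp only [X_pow_comp, add_pow_card]
  | zero => simp
  | add P P' _ _ h h' =>
    rw [add_comp, add_comp, add_comp, h, h']
    ring
  | smul c P _ h => rw [smul_comp, smul_comp, smul_comp, h, smul_add]

theorem eval_add_of_mem_additivePolys {P : (CInf Fq)[X]} (hP : P ∈ additivePolys Fq)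
    (x y : CInf Fq) : P.eval (x + y) = P.eval x + P.eval y := by
  have := congr_arg (eval 0) (comp_add_of_mem_additivePolys hP (C x) (C y))
  rwa [← C_add, eval_add, comp_C, comp_C, comp_C, eval_C, eval_C, eval_C] at this

theorem eval_algebraMap_mul_of_mem_additivePolys {P : (CInf Fq)[X]} (hP : P ∈ additivePolys Fq)
    (c : Fq) (x : CInf Fq) :
    P.eval (algebraMap Fq (CInf Fq) c * x) = algebraMap Fq (CInf Fq) c * P.eval x := by
  induction hP using Submodule.span_induction with
  | mem P hP =>
    obtain ⟨n, rfl⟩ := hP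
    simp only [eval_pow, eval_X, mul_pow, ← map_pow, FiniteField.pow_card_pow]
  | zero => simp
  | add P P' _ _ h h' =>
    rw [eval_add, eval_add, h, h']
    ring
  | smul a P _ h =>
    rw [eval_smul, eval_smul, h, smul_eq_mul, smul_eq_mul]
    ring

theorem X_dvd_of_mem_additivePolys {P : (CInf Fq)[X]} (hP : P ∈ additivePolys Fq) : X ∣ P := by
  induction hP using Submodule.span_induction with
  | mem P hP =>
    obtain ⟨n, rfl⟩ := hP
    exact dvd_pow_self X (pow_ne_zero _ Fintype.card_ne_zero)
  | zero => exact dvd_zero _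
  | add P P' _ _ h h' => exact dvd_add h h'
  | smul c P _ h =>
    rw [smul_eq_C_mul]
    exact dvd_mul_of_dvd_right h _

theorem dvd_comp_of_mem_additivePolys {P : (CInf Fq)[X]} (hP : P ∈ additivePolys Fq)
    (G : (CInf Fq)[X]) : G ∣ P.comp G := by
  obtain ⟨R, rfl⟩ := X_dvd_of_mem_additivePolys hP
  rw [mul_comp, X_comp]
  exact dvd_mul_right _ _

theorem coeff_eq_zero_of_mem_additivePolys {P : (CInf Fq)[X]} (hP : P ∈ additivePolys Fq) {n : ℕ}
    (hn : ∀ k, n ≠ Fintype.card Fq ^ k) : P.coeff n = 0 := by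
  induction hP using Submodule.span_induction with
  | mem P hP =>
    obtain ⟨k, rfl⟩ := hP
    rw [coeff_X_pow, if_neg (hn k)]
  | zero => exact coeff_zero n
  | add P P' _ _ h h' => rw [coeff_add, h, h', add_zero]
  | smul c P _ h => rw [coeff_smul, h, smul_zero]

theorem exists_natDegree_eq_of_mem_additivePolys {P : (CInf Fq)[X]} (hP : P ∈ additivePolys Fq)
    (h0 : P ≠ 0) : ∃ k, P.natDegree = Fintype.card Fq ^ k := by
  by_contra! h
  exact leadingCoeff_ne_zero.2 h0 (coeff_eq_zero_of_mem_additivePolys hP h)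

/-- Right division by a monic additive polynomial. -/
theorem exists_eq_comp_add_of_monic {G : (CInf Fq)[X]} (hG : G ∈ additivePolys Fq) (hGm : G.Monic)
    {F : (CInf Fq)[X]} (hF : F ∈ additivePolys Fq) :
    ∃ P ∈ additivePolys Fq, (F - P.comp G).degree < G.degree := by
  induction hN : F.natDegree using Nat.strong_induction_on generalizing F with
  | _ N ih =>
    rcases lt_or_ge F.degree G.degree with hlt | hge
    · exact ⟨0, zero_mem _, by simpa using hlt⟩
    have hF0 : F ≠ 0 := by
      rintro rfl
      rw [degree_zero, le_bot_iff, degree_eq_bot] at hge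
      exact hGm.ne_zero hge
    obtain ⟨k, hk⟩ := exists_natDegree_eq_of_mem_additivePolys hF hF0
    obtain ⟨j, hj⟩ := exists_natDegree_eq_of_mem_additivePolys hG hGm.ne_zero
    have hq := Fintype.one_lt_card (α := Fq)
    -- Degrees of additive polynomials are powers of `q`, so `G^{q^{k-j}}` has the degree of `F` and
    -- can cancel its leading term.
    have hjk : j ≤ k := by
      have := natDegree_le_natDegree hge
      rw [hj, hk] at this
      exact (Nat.pow_le_pow_iff_right hq).1 this
    set M : (CInf Fq)[X] := C F.leadingCoeff * X ^ Fintype.card Fq ^ (k - j) with hM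
    have hMa : M ∈ additivePolys Fq :=
      C_mul_mem_additivePolys _ (Submodule.subset_span ⟨k - j, rfl⟩)
    have hMG : M.comp G = C F.leadingCoeff * G ^ Fintype.card Fq ^ (k - j) := by
      rw [hM, mul_comp, C_comp, X_pow_comp]
    have hc0 : F.leadingCoeff ≠ 0 := leadingCoeff_ne_zero.2 hF0
    have hpm : (G ^ Fintype.card Fq ^ (k - j)).Monic := hGm.pow _
    have hdeg : (M.comp G).natDegree = F.natDegree := by
      rw [hMG, natDegree_C_mul hc0, hGm.natDegree_pow, hj, hk, ← pow_add, Nat.sub_add_cancel hjk]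
    have hlead : (M.comp G).leadingCoeff = F.leadingCoeff := by
      rw [hMG, leadingCoeff_mul, leadingCoeff_C, hpm, mul_one]
    have hMG0 : M.comp G ≠ 0 := by
      rw [← leadingCoeff_ne_zero, hlead]
      exact hc0
    have hlt : (F - M.comp G).degree < F.degree := by
      refine degree_sub_lt_left ?_ hF0 hlead.symm
      rw [degree_eq_natDegree hF0, degree_eq_natDegree hMG0, hdeg]
    have hmem : F - M.comp G ∈ additivePolys Fq := sub_mem hF (comp_mem_additivePolys hMa hG)
    rcases eq_or_ne (F - M.comp G) 0 with h0 | h0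
    · refine ⟨M, hMa, ?_⟩
      rw [h0, degree_zero, bot_lt_iff_ne_bot, Ne, degree_eq_bot]
      exact hGm.ne_zero
    · obtain ⟨P, hP, h⟩ := ih _ (by rw [← hN]; exact natDegree_lt_natDegree h0 hlt) hmem rfl
      refine ⟨M + P, add_mem hMa hP, ?_⟩
      rwa [add_comp, ← sub_sub]

/-! ### Polynomials with a given finite vector space of roots -/

section

variable {L : Type*} [Field L] [Algebra Fq L]

/-- A basis of `V` presents it as the span of a flag, so that `flagProd` shows its polynomial to be
additive. -/
theorem exists_flag (V : Submodule Fq L) (hV : (V : Set L).Finite) :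
    ∃ (g : ℕ → L) (n : ℕ), Set.BijOn (seqEval (Fq := Fq) g) (polysLT Fq n) V := by
  have : Finite V := hV
  set n := Module.finrank Fq V with hn
  let b : Module.Basis (Fin n) Fq V := Module.finBasis Fq V
  let g : ℕ → L := fun k => if h : k < n then (b ⟨k, h⟩ : L) else 0
  have hg : ∀ p ∈ polysLT Fq n, seqEval g p = ((∑ i : Fin n, p.coeff i • b i : V) : L) := by
    intro p hp
    have h1 : seqEval g p = ∑ k ∈ Finset.range n, algebraMap Fq L (p.coeff k) * g k := by
      rcases eq_or_ne p 0 with rfl | hp0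
      · simp
      · exact Polynomial.sum_over_range' (f := fun n c => algebraMap Fq L c * g n) p
          (fun k => by rw [map_zero, zero_mul]) n
          ((natDegree_lt_iff_degree_lt hp0).2 (mem_polysLT.1 hp))
    rw [h1, Finset.sum_range, Submodule.coe_sum]
    refine Finset.sum_congr rfl fun i _ => ?_
    rw [Submodule.coe_smul, Algebra.smul_def]
    simp [g]
  refine ⟨g, n, ?_, ?_, ?_⟩
  · intro p hp
    rw [hg p hp]
    exact Subtype.coe_prop _
  · intro p hp p' hp' h
    rw [hg p hp, hg p' hp'] at h
    have h2 := b.linearIndependent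
    have h3 : ∀ i : Fin n, p.coeff i = p'.coeff i := by
      have h4 := Subtype.coe_injective h
      rw [← b.equivFun_symm_apply (fun i : Fin n => p.coeff i),
        ← b.equivFun_symm_apply (fun i : Fin n => p'.coeff i)] at h4
      exact congr_fun (b.equivFun.symm.injective h4)
    ext k
    rcases lt_or_ge k n with hk | hk
    · exact h3 ⟨k, hk⟩
    · rw [coeff_eq_zero_of_degree_lt ((mem_polysLT.1 hp).trans_le (by exact_mod_cast hk)),
        coeff_eq_zero_of_degree_lt ((mem_polysLT.1 hp').trans_le (by exact_mod_cast hk))]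
  · intro v hv
    have hp : (∑ i : Fin n, C (b.repr ⟨v, hv⟩ i) * X ^ (i : ℕ)) ∈ polysLT Fq n := by
      rw [mem_polysLT]
      refine (degree_sum_le _ _).trans_lt ((Finset.sup_lt_iff (WithBot.bot_lt_coe n)).2 fun i _ => ?_)
      exact (degree_C_mul_X_pow_le _ _).trans_lt (WithBot.coe_lt_coe.2 i.2)
    refine ⟨_, hp, ?_⟩
    rw [hg _ hp]
    have : ∀ i : Fin n, (∑ i : Fin n, C (b.repr ⟨v, hv⟩ i) * X ^ (i : ℕ)).coeff i =
        b.repr ⟨v, hv⟩ i := by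
      intro i
      simp [finsetSum_coeff, coeff_X_pow, Fin.val_inj]
    simp only [this, b.sum_repr]

end

/-- The polynomial `∏ (X - v)`, `v ∈ V`. -/
def subspacePoly (V : Submodule Fq (CInf Fq)) : (CInf Fq)[X] := ∏ᶠ v ∈ (V : Set (CInf Fq)), (X - C v)

theorem flagProd_X_mem_additivePolys (g : ℕ → CInf Fq) (n : ℕ) :
    flagProd (Fq := Fq) g n (X : (CInf Fq)[X]) ∈ additivePolys Fq := by
  induction n with
  | zero =>
    rw [flagProd_zero]
    exact X_mem_additivePolys
  | succ n ih =>
    rw [flagProd_succ]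
    refine sub_mem ?_ (C_mul_mem_additivePolys _ ih)
    simpa using pow_card_mem_additivePolys ih 1

section

variable {V : Submodule Fq (CInf Fq)} (hV : (V : Set (CInf Fq)).Finite)
include hV

theorem subspacePoly_eq_prod : subspacePoly V = ∏ v ∈ hV.toFinset, (X - C v) :=
  finprod_mem_eq_finite_toFinset_prod _ hV

theorem subspacePoly_mem_additivePolys : subspacePoly V ∈ additivePolys Fq := by
  obtain ⟨g, n, h⟩ := exists_flag V hV
  have : subspacePoly V = flagProd (Fq := Fq) g n (X : (CInf Fq)[X]) := by
    rw [subspacePoly, ← h.image_eq, finprod_mem_image h.injOn, finprod_mem_coe_finset]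
    rfl
  rw [this]
  exact flagProd_X_mem_additivePolys g n

theorem monic_subspacePoly : (subspacePoly V).Monic := by
  rw [subspacePoly_eq_prod hV]
  exact monic_prod_X_sub_C _ _

theorem eval_subspacePoly (x : CInf Fq) :
    (subspacePoly V).eval x = ∏ v ∈ hV.toFinset, (x - v) := by
  rw [subspacePoly_eq_prod hV, eval_prod]
  simp

theorem eval_subspacePoly_eq_zero_iff {x : CInf Fq} : (subspacePoly V).eval x = 0 ↔ x ∈ V := by
  rw [eval_subspacePoly hV, Finset.prod_eq_zero_iff]
  constructor
  · rintro ⟨v, hv, h⟩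
    rw [sub_eq_zero.1 h]
    simpa using hv
  · intro hx
    exact ⟨x, by simpa using hx, sub_self x⟩

theorem subspacePoly_dvd_of_eval_eq_zero {P : (CInf Fq)[X]} (h : ∀ v ∈ V, P.eval v = 0) :
    subspacePoly V ∣ P := by
  rw [subspacePoly_eq_prod hV]
  refine Finset.prod_dvd_of_coprime (fun v _ w _ hvw => ?_) fun v hv => ?_
  · exact isCoprime_X_sub_C_of_isUnit_sub (sub_ne_zero.2 hvw).isUnit
  · exact dvd_iff_isRoot.2 (h v (by simpa using hv))

end

/-- The polynomial of a vector space `W` containing `V` is a left multiple of that of `V`. -/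
theorem exists_subspacePoly_eq_comp {V W : Submodule Fq (CInf Fq)} (hVW : V ≤ W)
    (hW : (W : Set (CInf Fq)).Finite) :
    ∃ P ∈ additivePolys Fq, subspacePoly W = P.comp (subspacePoly V) := by
  have hV : (V : Set (CInf Fq)).Finite := hW.subset hVW
  obtain ⟨P, hP, hlt⟩ := exists_eq_comp_add_of_monic (subspacePoly_mem_additivePolys hV)
    (monic_subspacePoly hV) (subspacePoly_mem_additivePolys hW)
  -- The remainder of the division vanishes on `V` but has smaller degree than the polynomial of
  -- `V`, hence is zero.
  refine ⟨P, hP, sub_eq_zero.1 (eq_zero_of_dvd_of_degree_lt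
    (subspacePoly_dvd_of_eval_eq_zero hV fun v hv => ?_) hlt)⟩
  obtain ⟨R, rfl⟩ := X_dvd_of_mem_additivePolys hP
  rw [eval_sub, eval_comp, (eval_subspacePoly_eq_zero_iff hW).2 (hVW hv),
    (eval_subspacePoly_eq_zero_iff hV).2 hv]
  simp

/-! ### Left ideals of the ring of additive polynomials -/

theorem comp_zero_of_mem_additivePolys {P : (CInf Fq)[X]} (hP : P ∈ additivePolys Fq) :
    P.comp 0 = 0 := by
  have := comp_add_of_mem_additivePolys hP 0 0
  rwa [add_zero, left_eq_add] at this

theorem comp_neg_of_mem_additivePolys {P : (CInf Fq)[X]} (hP : P ∈ additivePolys Fq)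
    (R : (CInf Fq)[X]) : P.comp (-R) = -P.comp R := by
  rw [eq_neg_iff_add_eq_zero, ← comp_add_of_mem_additivePolys hP, neg_add_cancel,
    comp_zero_of_mem_additivePolys hP]

/-- Each generator is a left multiple of the other; an additive polynomial is divisible by `X`, so
composition turns this into ordinary divisibility. -/
theorem IsMonicGenerator.unique {S : Set (CInf Fq)[X]} {G G' : (CInf Fq)[X]}
    (h : IsMonicGenerator S G) (h' : IsMonicGenerator S G') : G = G' := by
  have key : ∀ {G G' : (CInf Fq)[X]}, IsMonicGenerator S G → IsMonicGenerator S G' → G ∣ G' := by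
    intro G G' h h'
    have h1 : G' ∈ {R | ∃ P ∈ additivePolys Fq, R = P.comp G'} := ⟨X, X_mem_additivePolys, by simp⟩
    rw [← h'.2.2, h.2.2] at h1
    obtain ⟨P, hP, h1⟩ := h1
    rw [h1]
    exact dvd_comp_of_mem_additivePolys hP G
  exact eq_of_monic_of_associated h.1 h'.1 (associated_of_dvd_dvd (key h h') (key h' h))

section

variable {S : Set (CInf Fq)[X]}

theorem subset_leftIdeal {s : (CInf Fq)[X]} (hs : s ∈ S) : s ∈ leftIdeal S :=
  AddSubgroup.subset_closure ⟨X, X_mem_additivePolys, s, hs, by simp⟩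

theorem comp_mem_leftIdeal {P R : (CInf Fq)[X]} (hP : P ∈ additivePolys Fq)
    (hR : R ∈ leftIdeal S) : P.comp R ∈ leftIdeal S := by
  induction hR using AddSubgroup.closure_induction with
  | mem R hR =>
    obtain ⟨P', hP', s, hs, rfl⟩ := hR
    rw [← comp_assoc]
    exact AddSubgroup.subset_closure ⟨_, comp_mem_additivePolys hP hP', s, hs, rfl⟩
  | zero =>
    rw [comp_zero_of_mem_additivePolys hP]
    exact zero_mem _
  | add R R' _ _ h h' =>
    rw [comp_add_of_mem_additivePolys hP]
    exact add_mem h h'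
  | neg R _ h =>
    rw [comp_neg_of_mem_additivePolys hP]
    exact neg_mem h

theorem mem_additivePolys_of_mem_leftIdeal (hS : S ⊆ additivePolys Fq) {R : (CInf Fq)[X]}
    (hR : R ∈ leftIdeal S) : R ∈ additivePolys Fq := by
  induction hR using AddSubgroup.closure_induction with
  | mem R hR =>
    obtain ⟨P', hP', s, hs, rfl⟩ := hR
    exact comp_mem_additivePolys hP' (hS hs)
  | zero => exact zero_mem _
  | add R R' _ _ h h' => exact add_mem h h'
  | neg R _ h => exact neg_mem h

theorem mem_comp_of_mem_leftIdeal {G : (CInf Fq)[X]}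
    (hS : ∀ s ∈ S, ∃ P ∈ additivePolys Fq, s = P.comp G) {R : (CInf Fq)[X]}
    (hR : R ∈ leftIdeal S) : ∃ P ∈ additivePolys Fq, R = P.comp G := by
  induction hR using AddSubgroup.closure_induction with
  | mem R hR =>
    obtain ⟨P', hP', s, hs, rfl⟩ := hR
    obtain ⟨P, hP, rfl⟩ := hS s hs
    exact ⟨_, comp_mem_additivePolys hP' hP, (comp_assoc _ _ _).symm⟩
  | zero => exact ⟨0, zero_mem _, by simp⟩
  | add R R' _ _ h h' =>
    obtain ⟨P, hP, rfl⟩ := h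
    obtain ⟨P', hP', rfl⟩ := h'
    exact ⟨_, add_mem hP hP', add_comp.symm⟩
  | neg R _ h =>
    obtain ⟨P, hP, rfl⟩ := h
    exact ⟨_, neg_mem hP, neg_comp.symm⟩

/-- A nonzero left ideal contains a monic common right divisor of its elements. -/
theorem exists_monic_mem_leftIdeal (hS : S ⊆ additivePolys Fq) {s₀ : (CInf Fq)[X]} (hs₀ : s₀ ∈ S)
    (h0 : s₀ ≠ 0) : ∃ H ∈ leftIdeal S, H.Monic ∧ ∀ s ∈ S, H ∣ s := by
  classical
  have hex : ∃ n, ∃ R ∈ leftIdeal S, R ≠ 0 ∧ R.natDegree = n :=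
    ⟨_, s₀, subset_leftIdeal hs₀, h0, rfl⟩
  obtain ⟨R, hR, hR0, hn⟩ := Nat.find_spec hex
  have hc : R.leadingCoeff ≠ 0 := leadingCoeff_ne_zero.2 hR0
  set H : (CInf Fq)[X] := (C R.leadingCoeff⁻¹ * X).comp R with hH
  have hHR : H = C R.leadingCoeff⁻¹ * R := by rw [hH, mul_comp, C_comp, X_comp]
  have hHI : H ∈ leftIdeal S := comp_mem_leftIdeal (C_mul_mem_additivePolys _ X_mem_additivePolys) hR
  have hHm : H.Monic := by
    rw [Monic, hHR, leadingCoeff_mul, leadingCoeff_C, inv_mul_cancel₀ hc]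
  have hHa := mem_additivePolys_of_mem_leftIdeal hS hHI
  refine ⟨H, hHI, hHm, fun s hs => ?_⟩
  obtain ⟨P, hP, hlt⟩ := exists_eq_comp_add_of_monic hHa hHm (hS hs)
  have hr : s - P.comp H ∈ leftIdeal S := sub_mem (subset_leftIdeal hs) (comp_mem_leftIdeal hP hHI)
  have hr0 : s - P.comp H = 0 := by
    by_contra hne
    have h1 := Nat.find_min' hex ⟨_, hr, hne, rfl⟩
    rw [← hn] at h1
    have hHd : H.natDegree = R.natDegree := by rw [hHR, natDegree_C_mul (inv_ne_zero hc)]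
    have h2 := natDegree_lt_natDegree hne hlt
    rw [hHd] at h2
    exact absurd h1 h2.not_ge
  rw [sub_eq_zero.1 hr0]
  exact dvd_comp_of_mem_additivePolys hP H

/-- If the elements of `S` are multiples of polynomials of vector spaces with intersection `V`,
then the polynomial of `V` generates the left ideal generated by `S`. -/
theorem isMonicGenerator_subspacePoly {V : Submodule Fq (CInf Fq)}
    (hS : ∀ s ∈ S, ∃ (c : CInf Fq) (W : Submodule Fq (CInf Fq)), (W : Set (CInf Fq)).Finite ∧
      V ≤ W ∧ s = C c * subspacePoly W)
    (hV : ∀ x, (∀ s ∈ S, s.eval x = 0) → x ∈ V) (hne : ∃ s ∈ S, s ≠ 0) :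
    IsMonicGenerator S (subspacePoly V) := by
  obtain ⟨s₀, hs₀, h0⟩ := hne
  have hSa : S ⊆ additivePolys Fq := by
    intro s hs
    obtain ⟨c, W, hW, -, rfl⟩ := hS s hs
    exact C_mul_mem_additivePolys c (subspacePoly_mem_additivePolys hW)
  have hScomp : ∀ s ∈ S, ∃ P ∈ additivePolys Fq, s = P.comp (subspacePoly V) := by
    intro s hs
    obtain ⟨c, W, hW, hVW, rfl⟩ := hS s hs
    obtain ⟨P, hP, hPV⟩ := exists_subspacePoly_eq_comp hVW hW
    exact ⟨C c * P, C_mul_mem_additivePolys c hP, by rw [mul_comp, C_comp, hPV]⟩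
  obtain ⟨c, W, hW, hVW, hs₀W⟩ := hS s₀ hs₀
  have hVf : (V : Set (CInf Fq)).Finite := hW.subset hVW
  have hc : c ≠ 0 := by
    rintro rfl
    exact h0 (by rw [hs₀W, map_zero, zero_mul])
  obtain ⟨H, hHI, hHm, hHdvd⟩ := exists_monic_mem_leftIdeal hSa hs₀ h0
  have hHW : H ∣ subspacePoly W := by
    have := hHdvd s₀ hs₀
    rwa [hs₀W, ((isUnit_C.2 hc.isUnit).dvd_mul_left)] at this
  have hHV : H ∣ subspacePoly V := by
    have hsplit : H.Splits := by
      refine Splits.of_dvd ?_ (monic_subspacePoly hW).ne_zero hHW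
      rw [subspacePoly_eq_prod hW]
      exact Splits.prod fun v _ => Splits.X_sub_C v
    have hnodup : H.roots.Nodup := by
      have h1 := Polynomial.roots.le_of_dvd (monic_subspacePoly hW).ne_zero hHW
      refine Multiset.nodup_of_le h1 ?_
      rw [subspacePoly_eq_prod hW, roots_prod_X_sub_C]
      exact Finset.nodup _
    rw [hsplit.eq_prod_roots_of_monic hHm, subspacePoly_eq_prod hVf]
    refine Multiset.prod_dvd_prod_of_le (Multiset.map_le_map ?_)
    rw [Multiset.le_iff_subset hnodup]
    intro x hx
    have hx0 : H.IsRoot x := (mem_roots'.1 hx).2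
    have := hV x fun s hs => hx0.dvd (hHdvd s hs)
    simpa using this
  obtain ⟨P, hP, hHP⟩ := mem_comp_of_mem_leftIdeal hScomp hHI
  have hVH : subspacePoly V = H := by
    refine eq_of_monic_of_associated (monic_subspacePoly hVf) hHm (associated_of_dvd_dvd ?_ hHV)
    rw [hHP]
    exact dvd_comp_of_mem_additivePolys hP _
  refine ⟨monic_subspacePoly hVf, subspacePoly_mem_additivePolys hVf, ?_⟩
  ext R
  constructor
  · exact fun hR => mem_comp_of_mem_leftIdeal hScomp hR
  · rintro ⟨P, hP, rfl⟩
    rw [hVH]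
    exact comp_mem_leftIdeal hP hHI

end

/-! ### Infinite products in complete ultrametric fields -/

section Ultra

variable {L : Type*} [NormedField L] [IsUltrametricDist L] {ι : Type*}

theorem norm_le_one_of_norm_sub_one_le {x : L} (h : ‖x - 1‖ ≤ 1) : ‖x‖ ≤ 1 := by
  rw [← sub_add_cancel x 1]
  refine (IsUltrametricDist.norm_add_le_max _ _).trans (max_le h ?_)
  rw [norm_one]

/-- Beyond a finite set of indices all finite products are within `δ` of `1`, because the `1`-units
of a given level are closed under products. This is the Cauchy criterion. -/
theorem multipliable_of_forall_finite [CompleteSpace L] {f : ι → L}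
    (hf : ∀ δ > 0, {i | ¬ ‖f i - 1‖ ≤ δ}.Finite) : Multipliable f := by
  classical
  have hcau : CauchySeq fun s : Finset ι => ∏ i ∈ s, f i := by
    rw [Metric.cauchySeq_iff']
    intro ε hε
    -- Only the factors indexed by `S₁` can have norm above `1`, so `K` bounds every finite product
    -- over a set containing `S₁`.
    set S₁ := (hf 1 one_pos).toFinset with hS₁
    set K := ‖∏ i ∈ S₁, f i‖ with hK
    have hK0 : 0 ≤ K := norm_nonneg _
    set δ := min 1 (ε / (2 * (K + 1))) with hδ
    have hδ0 : 0 < δ := lt_min one_pos (by positivity)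
    refine ⟨(hf δ hδ0).toFinset, fun s hs => ?_⟩
    set N := (hf δ hδ0).toFinset with hN
    have hsub : S₁ ⊆ N := by
      intro i hi
      simp only [hS₁, hN, Set.Finite.mem_toFinset, Set.mem_ofPred_eq] at hi ⊢
      exact fun h => hi (h.trans (min_le_left _ _))
    have h1 : ‖∏ i ∈ N, f i‖ ≤ K := by
      rw [← Finset.prod_sdiff hsub, norm_mul, norm_prod]
      refine mul_le_of_le_one_left hK0 (Finset.prod_le_one (fun _ _ => norm_nonneg _) fun i hi => ?_)
      refine norm_le_one_of_norm_sub_one_le ?_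
      have := (Finset.mem_sdiff.1 hi).2
      simpa [hS₁] using this
    have h2 : ‖∏ i ∈ s \ N, f i - 1‖ ≤ δ := by
      refine norm_prod_sub_one_le hδ0.le (min_le_left _ _) fun i hi => ?_
      have := (Finset.mem_sdiff.1 hi).2
      simpa [hN] using this
    have hs : N ⊆ s := hs
    rw [dist_eq_norm, ← Finset.prod_sdiff hs, ← sub_one_mul, norm_mul]
    calc _ ≤ δ * K := mul_le_mul h2 h1 (norm_nonneg _) hδ0.le
      _ ≤ ε / (2 * (K + 1)) * K := mul_le_mul_of_nonneg_right (min_le_right _ _) hK0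
      _ < ε := by
        rw [div_mul_eq_mul_div, div_lt_iff₀ (by positivity)]
        nlinarith
  obtain ⟨a, ha⟩ := cauchySeq_tendsto_of_complete hcau
  exact ⟨a, ha⟩

variable {lam : ι → L} (hfin : ∀ R : ℝ, {i | ‖lam i‖ ≤ R}.Finite)
include hfin

theorem multipliable_one_sub_div [CompleteSpace L] (z : L) : Multipliable fun i => 1 - z / lam i := by
  refine multipliable_of_forall_finite fun δ hδ => (hfin (‖z‖ / δ)).subset fun i hi => ?_
  have hi : ¬ ‖1 - z / lam i - 1‖ ≤ δ := hi
  rw [sub_sub_cancel_left, norm_neg, norm_div, not_le] at hi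
  have h0 : 0 < ‖lam i‖ := by
    by_contra! h
    rw [le_antisymm h (norm_nonneg _), div_zero] at hi
    exact absurd hi hδ.not_gt
  rw [lt_div_iff₀ h0] at hi
  change ‖lam i‖ ≤ ‖z‖ / δ
  rw [le_div_iff₀ hδ]
  linarith

theorem tendsto_prod_ball [CompleteSpace L] (z : L) :
    Tendsto (fun n : ℕ => ∏ i ∈ (hfin n).toFinset, (1 - z / lam i)) atTop
      (𝓝 (∏' i, (1 - z / lam i))) := by
  have h1 : Tendsto (fun s : Finset ι => ∏ i ∈ s, (1 - z / lam i)) atTop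
      (𝓝 (∏' i, (1 - z / lam i))) := (multipliable_one_sub_div hfin z).hasProd
  refine h1.comp (tendsto_atTop_finset_of_monotone (fun n m hnm i hi => ?_) fun i => ?_)
  · simp only [Set.Finite.mem_toFinset, Set.mem_ofPred_eq] at hi ⊢
    exact hi.trans (by exact_mod_cast hnm)
  · obtain ⟨n, hn⟩ := exists_nat_ge ‖lam i‖
    exact ⟨n, by simpa using hn⟩

/-- The factors with `|λ| > |z|` have norm `1`, so the norms of the partial products are eventually
constant, and nonzero. -/
theorem tprod_one_sub_div_ne_zero [CompleteSpace L] (h0 : ∀ i, lam i ≠ 0) {z : L}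
    (hz : ∀ i, lam i ≠ z) : ∏' i, (1 - z / lam i) ≠ 0 := by
  classical
  obtain ⟨N, hN⟩ := exists_nat_ge ‖z‖
  have hfac : ∀ i, 1 - z / lam i ≠ 0 := by
    intro i h
    rw [sub_eq_zero, eq_comm, div_eq_one_iff_eq (h0 i)] at h
    exact hz i h.symm
  have key : ∀ n ≥ N, ‖∏ i ∈ (hfin n).toFinset, (1 - z / lam i)‖ =
      ‖∏ i ∈ (hfin N).toFinset, (1 - z / lam i)‖ := by
    intro n hn
    have hsub : (hfin N).toFinset ⊆ (hfin n).toFinset := by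
      intro i hi
      simp only [Set.Finite.mem_toFinset, Set.mem_ofPred_eq] at hi ⊢
      exact hi.trans (by exact_mod_cast hn)
    rw [← Finset.prod_sdiff hsub, norm_mul, norm_prod, Finset.prod_eq_one, one_mul]
    intro i hi
    have hi : (N : ℝ) < ‖lam i‖ := by simpa using (Finset.mem_sdiff.1 hi).2
    have hlt : ‖-(z / lam i)‖ < ‖(1 : L)‖ := by
      rw [norm_neg, norm_div, norm_one, div_lt_one (norm_pos_iff.2 (h0 i))]
      exact hN.trans_lt hi
    rw [sub_eq_add_neg, norm_add_of_norm_lt hlt, norm_one]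
  have hlim := (tendsto_prod_ball hfin z).norm
  have hconst : Tendsto (fun n : ℕ => ‖∏ i ∈ (hfin n).toFinset, (1 - z / lam i)‖) atTop
      (𝓝 ‖∏ i ∈ (hfin N).toFinset, (1 - z / lam i)‖) :=
    tendsto_const_nhds.congr' (by filter_upwards [eventually_ge_atTop N] with n hn; rw [key n hn])
  rw [← norm_ne_zero_iff, tendsto_nhds_unique hlim hconst, norm_ne_zero_iff]
  exact Finset.prod_ne_zero_iff.2 fun i _ => hfac i

/-- The products `∏ (1 - z / λ)` depend continuously on `z` and on the family of the `λ`. -/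
theorem tendsto_tprod_one_sub_div [CompleteSpace L] (h0 : ∀ i, lam i ≠ 0) {lam' : ℕ → ι → L}
    {δ : ℕ → ℝ} (hδ : Tendsto δ atTop (𝓝 0))
    (hle : ∀ᶠ N in atTop, ∀ i, ‖lam' N i - lam i‖ ≤ δ N * ‖lam i‖) {z : L} {zs : ℕ → L}
    (hzs : Tendsto zs atTop (𝓝 z)) :
    Tendsto (fun N => ∏' i, (1 - zs N / lam' N i)) atTop (𝓝 (∏' i, (1 - z / lam i))) := by
  classical
  rcases isEmpty_or_nonempty ι with hι | hι
  · simp only [tprod_empty]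
    exact tendsto_const_nhds
  set R := ‖z‖ + 1 with hR
  have hR0 : 0 < R := by positivity
  obtain ⟨c, hc0, hc⟩ : ∃ c : ℝ, 0 < c ∧ ∀ i, c ≤ ‖lam i‖ := by
    obtain ⟨j⟩ := hι
    have hne : (hfin ‖lam j‖).toFinset.Nonempty := ⟨j, by simp⟩
    obtain ⟨k, hk, hmin⟩ := Finset.exists_min_image _ (fun i => ‖lam i‖) hne
    refine ⟨‖lam k‖, norm_pos_iff.2 (h0 k), fun i => ?_⟩
    rcases le_total ‖lam i‖ ‖lam j‖ with h | h
    · exact hmin i (by simpa using h)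
    · exact le_trans (by simpa using hk) h
  -- `B i` bounds the factors `1 - w / λ` for `|w| ≤ R`, and it is `1` for all but finitely many
  -- `i`; so `K` bounds its product over any finite set.
  set B : ι → ℝ := fun i => max 1 (R / ‖lam i‖) with hB
  have hB1 : ∀ i, 1 ≤ B i := fun i => le_max_left _ _
  set K := ∏ i ∈ (hfin R).toFinset, B i with hK
  have hK1 : 1 ≤ K := by
    simpa using Finset.prod_le_prod (f := fun _ => (1 : ℝ)) (fun _ _ => zero_le_one)
      fun i (_ : i ∈ (hfin R).toFinset) => hB1 i
  have hBK : ∀ s : Finset ι, ∏ i ∈ s, B i ≤ K := by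
    intro s
    have h1 : ∏ i ∈ s, B i ≤ ∏ i ∈ s ∪ (hfin R).toFinset, B i :=
      Finset.prod_le_prod_of_subset_of_one_le Finset.subset_union_left
        (fun i _ => zero_le_one.trans (hB1 i)) fun i _ _ => hB1 i
    refine h1.trans (le_of_eq ?_)
    refine (Finset.prod_subset Finset.subset_union_right fun i _ hi => ?_).symm
    have hi : R < ‖lam i‖ := by simpa using hi
    exact max_eq_left ((div_le_one (hR0.trans hi)).2 hi.le)
  have hnorm : ∀ w : L, ‖w‖ ≤ R → ∀ x : L, ∀ i, ‖x‖ = ‖lam i‖ → ‖1 - w / x‖ ≤ B i := by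
    intro w hw x i hx
    refine (norm_sub_le_max_of_ultra _ _).trans (max_le_max norm_one.le ?_)
    rw [norm_div, hx]
    exact div_le_div_of_nonneg_right hw (norm_nonneg _)
  rw [tendsto_iff_norm_sub_tendsto_zero]
  have hbound : Tendsto (fun N => (‖zs N - z‖ + R * δ N) / c * K) atTop (𝓝 0) := by
    have h1 := tendsto_iff_norm_sub_tendsto_zero.1 hzs
    have h2 := (((h1.add (hδ.const_mul R)).div_const c).mul_const K)
    simpa using h2
  refine squeeze_zero' (Eventually.of_forall fun _ => norm_nonneg _) ?_ hbound
  have hδ1 : ∀ᶠ N in atTop, δ N < 1 := hδ.eventually_lt_const one_pos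
  have hzR : ∀ᶠ N in atTop, ‖zs N‖ < R := hzs.norm.eventually_lt_const (by linarith)
  filter_upwards [hle, hδ1, hzR] with N hle hδ1 hzR
  -- A relative error below `1` does not change norms, so the bounds `B i` serve both families.
  have hnl : ∀ i, ‖lam' N i‖ = ‖lam i‖ := fun i =>
    norm_eq_of_norm_sub_lt ((hle i).trans_lt
      (mul_lt_of_lt_one_left (norm_pos_iff.2 (h0 i)) hδ1))
  have h0' : ∀ i, lam' N i ≠ 0 := fun i => by
    rw [← norm_ne_zero_iff, hnl, norm_ne_zero_iff]
    exact h0 i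
  have hfin' : ∀ R : ℝ, {i | ‖lam' N i‖ ≤ R}.Finite := by simpa only [hnl] using hfin
  have hδN : 0 ≤ δ N := by
    obtain ⟨i⟩ := hι
    have := (norm_nonneg _).trans (hle i)
    exact nonneg_of_mul_nonneg_left this (norm_pos_iff.2 (h0 i))
  have hdiff : ∀ i, ‖(1 - zs N / lam' N i) - (1 - z / lam i)‖ ≤ (‖zs N - z‖ + R * δ N) / c := by
    intro i
    have h1 : (1 - zs N / lam' N i) - (1 - z / lam i) =
        -((zs N - z) / lam i) + zs N * (lam' N i - lam i) / (lam' N i * lam i) := by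
      have := h0 i
      have := h0' i
      field_simp
      ring
    have hpos : 0 < ‖lam i‖ := norm_pos_iff.2 (h0 i)
    rw [h1]
    refine (norm_add_le _ _).trans ?_
    rw [norm_neg, norm_div, norm_div, norm_mul, norm_mul, hnl, add_div]
    refine add_le_add ?_ ?_
    · exact div_le_div_of_nonneg_left (norm_nonneg _) hc0 (hc i)
    · calc _ ≤ R * (δ N * ‖lam i‖) / (‖lam i‖ * ‖lam i‖) := by
            refine div_le_div_of_nonneg_right ?_ (by positivity)
            exact mul_le_mul hzR.le (hle i) (norm_nonneg _) hR0.le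
        _ = R * δ N / ‖lam i‖ := by
            field_simp
        _ ≤ R * δ N / c := div_le_div_of_nonneg_left (by positivity) hc0 (hc i)
  have hnn : 0 ≤ (‖zs N - z‖ + R * δ N) / c := by positivity
  have hlim : Tendsto (fun s : Finset ι => ∏ i ∈ s, (1 - zs N / lam' N i) - ∏ i ∈ s, (1 - z / lam i))
      atTop (𝓝 (∏' i, (1 - zs N / lam' N i) - ∏' i, (1 - z / lam i))) :=
    Tendsto.sub (multipliable_one_sub_div hfin' (zs N)).hasProd
      (multipliable_one_sub_div hfin z).hasProd
  refine le_of_tendsto hlim.norm (Eventually.of_forall fun s => ?_)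
  refine (norm_prod_sub_prod_le hnn (fun i _ => hB1 i) (fun i _ => hnorm _ hzR.le _ i (hnl i))
    (fun i _ => hnorm _ (by linarith) _ i rfl) fun i _ => hdiff i).trans ?_
  exact mul_le_mul_of_nonneg_left (hBK s) hnn

end Ultra

/-! ### Exponentials of lattices -/

theorem expLat_eq_of_injective {ι : Type*} {Λ : Set (CInf Fq)} {lam : ι → CInf Fq}
    (hinj : Function.Injective lam) (hr : Set.range lam = {x | x ∈ Λ ∧ x ≠ 0}) (z : CInf Fq) :
    expLat Λ z = z * ∏' i, (1 - z / lam i) := by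
  exact congr_arg (z * ·) (Equiv.tprod_eq ((Equiv.ofInjective lam hinj).trans (Equiv.setCongr hr))
    fun x : {x | x ∈ Λ ∧ x ≠ 0} => 1 - z / (x : CInf Fq)).symm

theorem expLat_zero (Λ : Set (CInf Fq)) : expLat Λ 0 = 0 := zero_mul _

section

variable (Λ : Submodule Fq (CInf Fq))

/-- The elements of `Λ` in the ball of radius `n`. -/
def ballSubmodule (n : ℕ) : Submodule Fq (CInf Fq) where
  carrier := {x | x ∈ Λ ∧ ‖x‖ ≤ n}
  add_mem' {x y} hx hy := ⟨add_mem hx.1 hy.1,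
    (IsUltrametricDist.norm_add_le_max _ _).trans (max_le hx.2 hy.2)⟩
  zero_mem' := ⟨zero_mem _, by simp⟩
  smul_mem' c x hx := ⟨Λ.smul_mem c hx.1, by
    refine le_trans ?_ hx.2
    rw [Algebra.smul_def, norm_mul]
    exact mul_le_of_le_one_left (norm_nonneg _)
      (by rw [algebraMap_CInf, norm_toC]; exact norm_algebraMap_le_one c)⟩

variable {Λ} (hΛ : ∀ R : ℝ, {x | x ∈ Λ ∧ ‖x‖ ≤ R}.Finite)
include hΛ

theorem finite_subtype_ball (R : ℝ) :
    {i : {x : CInf Fq // x ∈ (Λ : Set (CInf Fq)) ∧ x ≠ 0} | ‖(i : CInf Fq)‖ ≤ R}.Finite :=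
  Set.Finite.of_finite_image ((hΛ R).subset (by
    rintro _ ⟨i, hi, rfl⟩
    exact ⟨i.2.1, hi⟩)) Subtype.val_injective.injOn

theorem finite_ballSubmodule (n : ℕ) : (ballSubmodule Λ n : Set (CInf Fq)).Finite := hΛ n

/-- The exponential is a limit of multiples of the polynomials of the finite spaces `Λ ∩ {|x| ≤ n}`,
from which it inherits additivity and `𝔽_q`-linearity. -/
theorem exists_tendsto_expLat : ∃ c : ℕ → CInf Fq, ∀ z, Tendsto
    (fun n => c n * (subspacePoly (ballSubmodule Λ n)).eval z) atTop (𝓝 (expLat Λ z)) := by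
  classical
  refine ⟨fun n => ∏ v ∈ (finite_ballSubmodule hΛ n).toFinset.erase 0, (-v⁻¹), fun z => ?_⟩
  refine ((tendsto_prod_ball (finite_subtype_ball hΛ) z).const_mul z).congr fun n => ?_
  have h0 : (0 : CInf Fq) ∈ (finite_ballSubmodule hΛ n).toFinset := by simp
  rw [eval_subspacePoly (finite_ballSubmodule hΛ n), ← Finset.mul_prod_erase _ _ h0, sub_zero,
    mul_left_comm, ← Finset.prod_mul_distrib]
  congr 1
  refine Finset.prod_nbij Subtype.val ?_ Subtype.val_injective.injOn ?_ ?_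
  · intro i hi
    simp only [Set.Finite.mem_toFinset, Set.mem_ofPred_eq] at hi
    simp only [Finset.mem_erase, Set.Finite.mem_toFinset]
    exact ⟨i.2.2, i.2.1, hi⟩
  · intro x hx
    simp only [Finset.coe_erase, Set.mem_sdiff, Set.Finite.coe_toFinset, Set.mem_singleton_iff] at hx
    exact ⟨⟨x, hx.1.1, hx.2⟩, by simpa using hx.1.2, rfl⟩
  · intro i _
    have := i.2.2
    field_simp
    ring

theorem expLat_add (x y : CInf Fq) : expLat Λ (x + y) = expLat Λ x + expLat Λ y := by
  obtain ⟨c, hc⟩ := exists_tendsto_expLat hΛ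
  refine tendsto_nhds_unique (hc (x + y)) (((hc x).add (hc y)).congr fun n => ?_)
  rw [eval_add_of_mem_additivePolys (subspacePoly_mem_additivePolys (finite_ballSubmodule hΛ n)),
    mul_add]

theorem expLat_smul (a : Fq) (x : CInf Fq) : expLat Λ (a • x) = a • expLat Λ x := by
  obtain ⟨c, hc⟩ := exists_tendsto_expLat hΛ
  rw [Algebra.smul_def, Algebra.smul_def]
  refine tendsto_nhds_unique (hc _) (((hc x).const_mul _).congr fun n => ?_)
  rw [eval_algebraMap_mul_of_mem_additivePolys
    (subspacePoly_mem_additivePolys (finite_ballSubmodule hΛ n)), mul_left_comm]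

/-- The exponential of a lattice as a linear map. -/
def expLinear : CInf Fq →ₗ[Fq] CInf Fq where
  toFun := expLat Λ
  map_add' := expLat_add hΛ
  map_smul' := expLat_smul hΛ

theorem expLinear_apply (x : CInf Fq) : expLinear hΛ x = expLat Λ x := rfl

theorem expLat_eq_zero_iff {z : CInf Fq} : expLat Λ z = 0 ↔ z ∈ Λ := by
  constructor
  · intro h
    by_contra hz
    rcases mul_eq_zero.1 h with rfl | h
    · exact hz (zero_mem _)
    · refine tprod_one_sub_div_ne_zero (finite_subtype_ball hΛ) (fun i => i.2.2) (fun i hi => ?_) h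
      exact hz (hi ▸ i.2.1)
  · intro hz
    by_cases h0 : z = 0
    · rw [h0, expLat_zero]
    · rw [expLat, tprod_of_exists_eq_zero ⟨⟨z, hz, h0⟩, by simp [h0]⟩, mul_zero]

theorem expLat_add_of_mem {z x : CInf Fq} (hx : x ∈ Λ) : expLat Λ (z + x) = expLat Λ z := by
  rw [expLat_add hΛ, (expLat_eq_zero_iff hΛ).2 hx, add_zero]

theorem expLat_eq_iff {x y : CInf Fq} : expLat Λ x = expLat Λ y ↔ x - y ∈ Λ := by
  rw [← expLat_eq_zero_iff hΛ, ← expLinear_apply hΛ, ← expLinear_apply hΛ, ← expLinear_apply hΛ,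
    map_sub, sub_eq_zero]

end

/-- Indexing by the nonzero polynomials gives all lattices the same index set, so their products can
be compared factor by factor. -/
theorem expLat_range {Λ : Set (CInf Fq)} {lam : Fq[X] → CInf Fq} (hinj : Function.Injective lam)
    (h0 : lam 0 = 0) (hr : Set.range lam = Λ) (z : CInf Fq) :
    expLat Λ z = z * ∏' i : {p : Fq[X] // p ≠ 0}, (1 - z / lam i) := by
  refine expLat_eq_of_injective (hinj.comp Subtype.val_injective) ?_ z
  ext x
  constructor
  · rintro ⟨p, rfl⟩
    refine ⟨hr ▸ Set.mem_range_self _, fun h => p.2 (hinj ?_)⟩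
    rw [h0]
    exact h
  · rintro ⟨hx, hx0⟩
    rw [← hr] at hx
    obtain ⟨p, rfl⟩ := hx
    exact ⟨⟨p, fun h => hx0 (by rw [h, h0])⟩, rfl⟩

/-- Continuity of the exponential in the lattice and in the argument. -/
theorem tendsto_expLat {Λ : Set (CInf Fq)} {lam : Fq[X] → CInf Fq} (hinj : Function.Injective lam)
    (h0 : lam 0 = 0) (hr : Set.range lam = Λ) (hfin : ∀ R : ℝ, {p | ‖lam p‖ ≤ R}.Finite)
    {Λ' : ℕ → Set (CInf Fq)} {lam' : ℕ → Fq[X] → CInf Fq} {δ : ℕ → ℝ}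
    (hinj' : ∀ᶠ N in atTop, Function.Injective (lam' N)) (h0' : ∀ᶠ N in atTop, lam' N 0 = 0)
    (hr' : ∀ᶠ N in atTop, Set.range (lam' N) = Λ' N) (hδ : Tendsto δ atTop (𝓝 0))
    (hle : ∀ᶠ N in atTop, ∀ p, ‖lam' N p - lam p‖ ≤ δ N * ‖lam p‖) {z : CInf Fq}
    {zs : ℕ → CInf Fq} (hzs : Tendsto zs atTop (𝓝 z)) :
    Tendsto (fun N => expLat (Λ' N) (zs N)) atTop (𝓝 (expLat Λ z)) := by
  rw [expLat_range hinj h0 hr]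
  have h1 : ∀ R : ℝ, {i : {p : Fq[X] // p ≠ 0} | ‖lam i‖ ≤ R}.Finite := fun R =>
    Set.Finite.of_finite_image ((hfin R).subset (by
      rintro _ ⟨i, hi, rfl⟩
      exact hi)) Subtype.val_injective.injOn
  have h2 : ∀ i : {p : Fq[X] // p ≠ 0}, lam i ≠ 0 := fun i h => i.2 (hinj (h.trans h0.symm))
  have h3 := tendsto_tprod_one_sub_div (lam' := fun N (i : {p : Fq[X] // p ≠ 0}) => lam' N i)
    h1 h2 hδ (hle.mono fun N h i => h i) hzs
  refine (hzs.mul h3).congr' ?_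
  filter_upwards [hinj', h0', hr'] with N a b c
  rw [expLat_range a b c]

theorem toC_injective : Function.Injective (toC (Fq := Fq)) :=
  RingHom.injective (toC (Fq := Fq))

theorem IsGraded.finite_norm_le {g : ℕ → KInf Fq} {m : ℕ → ℕ} (hg : IsGraded g m) (R : ℝ) :
    {p : Fq[X] | ‖seqEval g p‖ ≤ R}.Finite := by
  obtain ⟨r, hr⟩ := pow_unbounded_of_one_lt R (one_lt_card_real (Fq := Fq))
  refine (polysLT Fq r).finite_toSet.subset fun p hp => ?_
  rw [Finset.mem_coe, mem_polysLT]
  by_contra! h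
  have hp0 : p ≠ 0 := by
    rintro rfl
    simp at h
  rw [degree_eq_natDegree hp0] at h
  have h1 : r ≤ p.natDegree := by exact_mod_cast h
  have h2 : ‖seqEval g p‖ ≤ R := hp
  rw [hg.norm_seqEval hp0] at h2
  exact absurd (hr.trans_le ((pow_le_pow_right₀ one_lt_card_real.le
    (h1.trans (hg.strictMono.id_le _))).trans h2)) (lt_irrefl _)

theorem IsGraded.finite_norm_mul_toC_le {g : ℕ → KInf Fq} {m : ℕ → ℕ} (hg : IsGraded g m)
    {ξ : CInf Fq} (hξ : ξ ≠ 0) (R : ℝ) : {p : Fq[X] | ‖ξ * toC (seqEval g p)‖ ≤ R}.Finite := by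
  refine (hg.finite_norm_le (R / ‖ξ‖)).subset fun p hp => ?_
  have hp : ‖ξ * toC (seqEval g p)‖ ≤ R := hp
  rw [norm_mul, norm_toC] at hp
  change ‖seqEval g p‖ ≤ R / ‖ξ‖
  rw [le_div_iff₀ (norm_pos_iff.2 hξ)]
  linarith

theorem IsGraded.mul_toC_injective {g : ℕ → KInf Fq} {m : ℕ → ℕ} (hg : IsGraded g m)
    {ξ : CInf Fq} (hξ : ξ ≠ 0) : Function.Injective fun p : Fq[X] => ξ * toC (seqEval g p) :=
  fun _ _ h => hg.seqEval_injective (toC_injective (mul_left_cancel₀ hξ h))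

/-- The `𝔽_q`-subspace of `C_∞` spanned by a scaled sequence. -/
def seqLattice (ξ : CInf Fq) (g : ℕ → KInf Fq) : Submodule Fq (CInf Fq) where
  carrier := Set.range fun p : Fq[X] => ξ * toC (seqEval g p)
  add_mem' := by
    rintro _ _ ⟨p, rfl⟩ ⟨p', rfl⟩
    exact ⟨p + p', by simp only [map_add, mul_add]⟩
  zero_mem' := ⟨0, by simp⟩
  smul_mem' := by
    rintro c _ ⟨p, rfl⟩
    refine ⟨C c * p, ?_⟩
    simp only [seqEval_C_mul, map_mul, Algebra.smul_def, algebraMap_CInf]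
    ring

theorem coe_seqLattice (ξ : CInf Fq) (g : ℕ → KInf Fq) :
    (seqLattice ξ g : Set (CInf Fq)) = scale ξ (Set.range (seqEval (Fq := Fq) g)) := by
  rw [scale, ← Set.range_comp]
  rfl

theorem mem_seqLattice {ξ : CInf Fq} {g : ℕ → KInf Fq} {x : CInf Fq} :
    x ∈ seqLattice ξ g ↔ ∃ r ∈ (seqEval (Fq := Fq) g).range, x = ξ * toC r := by
  constructor
  · rintro ⟨p, rfl⟩
    exact ⟨_, ⟨p, rfl⟩, rfl⟩
  · rintro ⟨_, ⟨p, rfl⟩, rfl⟩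
    exact ⟨p, rfl⟩

theorem mul_toC_mem_seqLattice_iff {ξ : CInf Fq} (hξ : ξ ≠ 0) {g : ℕ → KInf Fq} {r : KInf Fq} :
    ξ * toC r ∈ seqLattice ξ g ↔ r ∈ (seqEval (Fq := Fq) g).range := by
  rw [mem_seqLattice]
  constructor
  · rintro ⟨r', hr', h⟩
    rwa [toC_injective (mul_left_cancel₀ hξ h)]
  · exact fun h => ⟨r, h, rfl⟩

theorem IsGraded.finite_seqLattice {g : ℕ → KInf Fq} {m : ℕ → ℕ} (hg : IsGraded g m)
    {ξ : CInf Fq} (hξ : ξ ≠ 0) (R : ℝ) : {x | x ∈ seqLattice ξ g ∧ ‖x‖ ≤ R}.Finite := by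
  refine ((hg.finite_norm_mul_toC_le hξ R).image fun p => ξ * toC (seqEval g p)).subset ?_
  rintro _ ⟨⟨p, rfl⟩, hp⟩
  exact ⟨p, hp, rfl⟩

/-! ### The polynomials `ρ_α` -/

/-- The space of zeros of `ρ_α`. -/
def torsion {Λ : Submodule Fq (CInf Fq)} (hΛ : ∀ R : ℝ, {x | x ∈ Λ ∧ ‖x‖ ≤ R}.Finite)
    (α : CInf Fq) : Submodule Fq (CInf Fq) :=
  (Λ.comap (LinearMap.mulLeft Fq α)).map (expLinear hΛ)

theorem mem_torsion {Λ : Submodule Fq (CInf Fq)} {hΛ : ∀ R : ℝ, {x | x ∈ Λ ∧ ‖x‖ ≤ R}.Finite}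
    {α μ : CInf Fq} : μ ∈ torsion hΛ α ↔ ∃ y, α * y ∈ Λ ∧ expLat Λ y = μ := Iff.rfl

/-- Since `1 - X/μ = -μ⁻¹ (X - μ)`, the polynomial `ρ_α` is a constant times the monic polynomial of
its kernel. -/
theorem exists_drinfeldPoly_eq {Λ : Submodule Fq (CInf Fq)}
    (hΛ : ∀ R : ℝ, {x | x ∈ Λ ∧ ‖x‖ ≤ R}.Finite) (α : CInf Fq)
    (hfin : (torsion hΛ α : Set (CInf Fq)).Finite) :
    ∃ c : CInf Fq, (α ≠ 0 → c ≠ 0) ∧ drinfeldPoly Λ α = C c * subspacePoly (torsion hΛ α) := by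
  classical
  have hset : {μ | μ ≠ 0 ∧ ∃ y, α * y ∈ (Λ : Set (CInf Fq)) ∧ μ = expLat Λ y} =
      (hfin.toFinset.erase 0 : Finset (CInf Fq)) := by
    ext μ
    simp only [Finset.coe_erase, Set.Finite.coe_toFinset, Set.mem_sdiff, Set.mem_singleton_iff,
      SetLike.mem_coe, mem_torsion, Set.mem_ofPred_eq]
    rw [and_comm]
    simp only [eq_comm]
  refine ⟨α * ∏ μ ∈ hfin.toFinset.erase 0, (-μ⁻¹), fun hα => mul_ne_zero hα ?_, ?_⟩
  · refine Finset.prod_ne_zero_iff.2 fun μ hμ => ?_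
    exact neg_ne_zero.2 (inv_ne_zero (Finset.ne_of_mem_erase hμ))
  · rw [drinfeldPoly, hset, finprod_mem_coe_finset, subspacePoly_eq_prod hfin,
      ← Finset.mul_prod_erase _ _ (show (0 : CInf Fq) ∈ hfin.toFinset by simp), C_mul, map_prod,
      C_0, sub_zero]
    have h : ∀ μ ∈ hfin.toFinset.erase 0,
        (1 - C μ⁻¹ * X : (CInf Fq)[X]) = C (-μ⁻¹) * (X - C μ) := by
      intro μ hμ
      rw [mul_sub, ← C_mul, neg_mul, inv_mul_cancel₀ (Finset.ne_of_mem_erase hμ), C_neg, C_neg, C_1]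
      ring
    rw [Finset.prod_congr rfl h, Finset.prod_mul_distrib]
    ring

/-! ### Arithmetic of the ideals: cocompactness of `𝔞_0`, products and quotients. -/

namespace QuadraticUnit

variable (U : QuadraticUnit Fq)

/-- `𝔞_0` has elements of sign `1` of every degree at least `2d`, so leading terms can be cancelled
successively. -/
theorem exists_norm_sub_lt (n : ℕ) {x : KInf Fq}
    (hx : ‖x‖ < (Fintype.card Fq : ℝ) ^ (2 * U.d + n)) :
    ∃ r ∈ U.idealA 0, ‖x - r‖ < (Fintype.card Fq : ℝ) ^ (2 * U.d) := by
  induction n generalizing x with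
  | zero => exact ⟨0, zero_mem _, by simpa using hx⟩
  | succ n ih =>
    rcases lt_or_ge ‖x‖ ((Fintype.card Fq : ℝ) ^ (2 * U.d + n)) with h | h
    · exact ih h
    · have hx0 : x ≠ 0 := by
        rintro rfl
        rw [norm_zero] at h
        exact absurd h (pow_pos (zero_lt_one.trans one_lt_card_real) _).not_ge
      have hnorm : ‖x‖ = (Fintype.card Fq : ℝ) ^ (2 * U.d + n) := by
        refine le_antisymm ?_ h
        rw [← zpow_natCast] at hx
        refine (norm_le_of_norm_lt hx).trans (le_of_eq ?_)
        rw [← zpow_natCast]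
        congr 1
        push_cast
        ring
      have hd := U.d_pos
      have hs := U.isGraded_idealSeq U.d_pos
      have hsgn : sgn x ≠ 0 := fun h => hx0 (sgn_eq_zero.1 h)
      have hlt := norm_sub_lt_of_sgn_eq (y := algebraMap Fq (KInf Fq) (sgn x) * U.idealSeq 0 (n + 1))
        hx0 (by
          rw [norm_mul, norm_algebraMap_KInf hsgn, one_mul, hs.norm_eq, hnorm,
            U.idealDeg_eq_add hd _ (by omega)]
          congr 1
          omega) (by rw [sgn_mul, sgn_algebraMap, hs.sgn_eq, mul_one])
      obtain ⟨r, hr, hr'⟩ := ih (hlt.trans_eq hnorm)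
      refine ⟨algebraMap Fq (KInf Fq) (sgn x) * U.idealSeq 0 (n + 1) + r,
        add_mem (U.algebraMap_mul_mem_idealA _ (U.idealSeq_mem_idealA hd _)) hr, ?_⟩
      rwa [← sub_sub]

/-- On generators the product is `f² T^{k+l}` with `k + l ≤ d`, which lies in `𝔞_0`. -/
theorem mul_mem_idealA_zero {i j : ℕ} (hij : i + j ≤ U.d) {x y : KInf Fq} (hx : x ∈ U.idealA i)
    (hy : y ∈ U.idealA j) : x * y ∈ U.idealA 0 := by
  induction hx using Submodule.span_induction with
  | mem x hx =>
    obtain ⟨k, hk, rfl⟩ := hx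
    induction hy using Submodule.span_induction with
    | mem y hy =>
      obtain ⟨l, hl, rfl⟩ := hy
      have hk : k ≤ i := hk
      have hl : l ≤ j := hl
      have h : U.f * T Fq ^ k * (U.f * T Fq ^ l) = U.f ^ 2 * T Fq ^ (k + l) := by ring
      change U.f * T Fq ^ k * (U.f * T Fq ^ l) ∈ _
      rw [h, U.mem_idealA_iff U.d_pos]
      exact U.f_pow_mul_T_pow_mem_range U.d_pos _ 2 (by omega) (by omega)
    | zero =>
      rw [mul_zero]
      exact zero_mem _
    | add y y' _ _ h h' =>
      rw [mul_add]
      exact add_mem h h'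
    | smul r y _ h =>
      have : U.f * T Fq ^ k * (r • y) = (r : KInf Fq) * (U.f * T Fq ^ k * y) := mul_left_comm _ _ _
      change U.f * T Fq ^ k * (r • y) ∈ _
      rw [this]
      exact U.mul_mem_idealA r.2 h
  | zero =>
    rw [zero_mul]
    exact zero_mem _
  | add x x' _ _ h h' =>
    rw [add_mul]
    exact add_mem h h'
  | smul r x _ h =>
    have : r • x * y = (r : KInf Fq) * (x * y) := mul_assoc _ _ _
    rw [this]
    exact U.mul_mem_idealA r.2 h

theorem mem_idealA_zero {x : KInf Fq} : x ∈ U.idealA 0 ↔ ∃ r ∈ U.ringA, x = U.f * r := by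
  have h : (fun j : ℕ => U.f * T Fq ^ j) '' {j | j ≤ 0} = {U.f} := by
    ext y
    simp
  rw [idealA, h, Submodule.mem_span_singleton]
  constructor
  · rintro ⟨r, rfl⟩
    exact ⟨r, r.2, mul_comm _ _⟩
  · rintro ⟨r, hr, rfl⟩
    exact ⟨⟨r, hr⟩, mul_comm _ _⟩

theorem idealA_mono {i j : ℕ} (hij : i ≤ j) : U.idealA i ≤ U.idealA j :=
  Submodule.span_mono (Set.image_mono fun _ h => le_trans h hij)

/-- The quotient ideal `(𝔞_0 : 𝔞_i)` is contained in `𝔞_{d-i}`. -/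
theorem mem_idealA_sub {i : ℕ} (hi : i < U.d) {r : KInf Fq}
    (hr : ∀ j ≤ i, U.f * T Fq ^ j * r ∈ U.idealA 0) : r ∈ U.idealA (U.d - i) := by
  have hsub : U.idealA 0 ≤ U.idealA (U.d - i) := U.idealA_mono (Nat.zero_le _)
  obtain ⟨s, hs, h⟩ := U.mem_idealA_zero.1 (hr i le_rfl)
  have hs' : T Fq ^ i * r ∈ U.ringA := by
    rw [mul_assoc] at h
    rwa [mul_left_cancel₀ U.f_ne_zero h]
  -- For `j ≥ i` write `f T^j r = (T^i r) (f T^{j-i})`, where `T^i r` lies in the ring and `j - i ≤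
  -- d - i`.
  have hT : ∀ j, i ≤ j → j ≤ U.d → U.f * T Fq ^ j * r ∈ U.idealA (U.d - i) := by
    intro j hij hj
    have := U.mul_mem_idealA hs' (U.f_mul_T_pow_mem_idealA (show j - i ≤ U.d - i by omega))
    have h2 : T Fq ^ i * r * (U.f * T Fq ^ (j - i)) = U.f * T Fq ^ j * r := by
      rw [← Nat.sub_add_cancel hij, pow_add, Nat.add_sub_cancel]
      ring
    rwa [h2] at this
  have hj : ∀ j ≤ U.d, U.f * T Fq ^ j * r ∈ U.idealA (U.d - i) := by
    intro j hj
    rcases le_total j i with h | h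
    · exact hsub (hr j h)
    · exact hT j h hj
  -- The relation for `f T^d`, multiplied by `r` and solved for `b r`; since `b` is a nonzero
  -- constant, `r` itself is recovered.
  have hb : algebraMap Fq (KInf Fq) U.b * r = U.f * (U.f * T Fq ^ 0 * r) - U.f * T Fq ^ U.d * r -
      ∑ j ∈ Finset.range U.d, algebraMap Fq (KInf Fq) (U.a.coeff j) * (U.f * T Fq ^ j * r) := by
    simp only [← mul_assoc _ _ r]
    rw [← Finset.sum_mul, U.f_mul_T_pow_d]
    ring
  have hbr : algebraMap Fq (KInf Fq) U.b * r ∈ U.idealA (U.d - i) := by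
    rw [hb]
    refine sub_mem (sub_mem (U.mul_mem_idealA U.f_mem_ringA (hj 0 (Nat.zero_le _)))
      (hj _ le_rfl)) (sum_mem fun j h => U.algebraMap_mul_mem_idealA _ (hj j ?_))
    exact (Finset.mem_range.1 h).le
  have h2 := U.algebraMap_mul_mem_idealA U.b⁻¹ hbr
  rwa [← mul_assoc, ← map_mul, inv_mul_cancel₀ U.b_ne_zero, map_one, one_mul] at h2

end QuadraticUnit

/-! ### The Hayes isogenies -/

namespace QuadraticUnit

variable (U : QuadraticUnit Fq)

theorem scale_idealA {i : ℕ} (hi : i < U.d) (ξ : CInf Fq) :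
    scale ξ (U.idealA i) = seqLattice ξ (U.idealSeq i) := by
  rw [coe_seqLattice, U.coe_idealA hi]

theorem mem_ringA_of_mem_idealA {i : ℕ} (hi : i < U.d) {α : KInf Fq} (hα : α ∈ U.idealA i) :
    α ∈ U.ringA := by
  induction hα using Submodule.span_induction with
  | mem x hx =>
    obtain ⟨j, hj, rfl⟩ := hx
    exact U.f_mul_T_pow_mem_ringA (lt_of_le_of_lt hj hi)
  | zero => exact zero_mem _
  | add x y _ _ h h' => exact add_mem h h'
  | smul r x _ h => exact mul_mem r.2 h

variable {ξ : CInf Fq} (hξ : ξ ≠ 0)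

include hξ in
theorem finite_idealLattice (R : ℝ) : {x | x ∈ seqLattice ξ (U.idealSeq 0) ∧ ‖x‖ ≤ R}.Finite :=
  (U.isGraded_idealSeq U.d_pos).finite_seqLattice hξ R

theorem mul_toC_mem_iff {i : ℕ} (hi : i < U.d) {ξ : CInf Fq} (hξ : ξ ≠ 0) {r : KInf Fq} :
    ξ * toC r ∈ seqLattice ξ (U.idealSeq i) ↔ r ∈ U.idealA i := by
  rw [mul_toC_mem_seqLattice_iff hξ, U.mem_idealA_iff hi]

theorem mem_idealLattice {i : ℕ} (hi : i < U.d) {ξ x : CInf Fq} :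
    x ∈ seqLattice ξ (U.idealSeq i) ↔ ∃ r ∈ U.idealA i, x = ξ * toC r := by
  simp only [mem_seqLattice, U.mem_idealA_iff hi]

/-- Every class of `α⁻¹Λ / Λ` has a representative in a fixed ball, by cocompactness of `𝔞_0`, and
the discrete set `α⁻¹Λ` meets that ball in finitely many points. -/
theorem finite_torsion {α : KInf Fq} (hα : α ∈ U.ringA) (hα0 : α ≠ 0) :
    (torsion (U.finite_idealLattice hξ) (toC α) : Set (CInf Fq)).Finite := by
  have hα0' : toC α ≠ 0 := (map_ne_zero_iff _ toC_injective).2 hα0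
  set B := ‖ξ‖ * (Fintype.card Fq : ℝ) ^ (2 * U.d) with hB
  have h1 : {y | toC α * y ∈ seqLattice ξ (U.idealSeq 0) ∧ ‖y‖ ≤ B}.Finite := by
    refine ((U.finite_idealLattice hξ (‖α‖ * B)).preimage
      ((mul_right_injective₀ hα0').injOn)).subset fun y hy => ⟨hy.1, ?_⟩
    rw [norm_mul, norm_toC]
    exact mul_le_mul_of_nonneg_left hy.2 (norm_nonneg _)
  refine (h1.image (expLat (seqLattice ξ (U.idealSeq 0)))).subset ?_
  rintro _ ⟨y, hy, rfl⟩
  have hy : toC α * y ∈ seqLattice ξ (U.idealSeq 0) := hy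
  obtain ⟨t, ht, h⟩ := (U.mem_idealLattice U.d_pos).1 hy
  obtain ⟨r, rfl⟩ : ∃ r, y = ξ * toC r := by
    refine ⟨t / α, ?_⟩
    rw [map_div₀]
    field_simp
    rw [mul_comm, h]
  obtain ⟨n, hn⟩ := pow_unbounded_of_one_lt ‖r‖ (one_lt_card_real (Fq := Fq))
  obtain ⟨s, hs, hlt⟩ := U.exists_norm_sub_lt n (hn.trans_le
    (pow_le_pow_right₀ one_lt_card_real.le (Nat.le_add_left n (2 * U.d))))
  have hs' := (U.mul_toC_mem_iff U.d_pos hξ).2 hs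
  refine ⟨ξ * toC (r - s), ⟨?_, ?_⟩, ?_⟩
  · rw [map_sub, mul_sub, mul_sub]
    refine sub_mem hy ?_
    rw [mul_left_comm, ← map_mul, U.mul_toC_mem_iff U.d_pos hξ]
    exact U.mul_mem_idealA hα hs
  · rw [norm_mul, norm_toC]
    exact mul_le_mul_of_nonneg_left hlt.le (norm_nonneg _)
  · rw [expLinear_apply, expLat_eq_iff (U.finite_idealLattice hξ), map_sub, mul_sub, sub_sub_cancel_left]
    exact neg_mem hs'

/-- The space `e_0(ξ 𝔞_i)`. -/
def kernelSpace (i : ℕ) : Submodule Fq (CInf Fq) :=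
  (seqLattice ξ (U.idealSeq i)).map (expLinear (U.finite_idealLattice hξ))

theorem kernelSpace_le_torsion {i : ℕ} (hi : 1 ≤ i) (hi' : i < U.d) {α : KInf Fq}
    (hα : α ∈ U.idealA i) :
    U.kernelSpace hξ (U.d - i) ≤ torsion (U.finite_idealLattice hξ) (toC α) := by
  refine Submodule.map_mono fun x hx => ?_
  obtain ⟨r, hr, rfl⟩ := (U.mem_idealLattice (by omega)).1 hx
  change toC α * (ξ * toC r) ∈ seqLattice ξ (U.idealSeq 0)
  rw [mul_left_comm, ← map_mul, U.mul_toC_mem_iff U.d_pos hξ]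
  exact U.mul_mem_idealA_zero (by omega) hα hr

theorem f_mem_idealA (i : ℕ) : U.f ∈ U.idealA i := by
  simpa using U.f_mul_T_pow_mem_idealA (Nat.zero_le i)

theorem finite_kernelSpace {i : ℕ} (hi : 1 ≤ i) (hi' : i < U.d) :
    (U.kernelSpace hξ i : Set (CInf Fq)).Finite := by
  have h := U.kernelSpace_le_torsion hξ (i := U.d - i) (by omega) (by omega) (U.f_mem_idealA _)
  rw [Nat.sub_sub_self hi'.le] at h
  exact (U.finite_torsion hξ U.f_mem_ringA U.f_ne_zero).subset h

/-- The generator `f` shows that the point is `e_0(ξ r)` with `r ∈ k_∞`; the other generators give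
`f T^j r ∈ 𝔞_0`, that is, `r ∈ (𝔞_0 : 𝔞_i)`. -/
theorem mem_kernelSpace_of_forall {i : ℕ} (hi : 1 ≤ i) (hi' : i < U.d) {x : CInf Fq}
    (hx : ∀ j ≤ i, x ∈ torsion (U.finite_idealLattice hξ) (toC (U.f * T Fq ^ j))) :
    x ∈ U.kernelSpace hξ (U.d - i) := by
  have hf : toC U.f ≠ 0 := (map_ne_zero_iff _ toC_injective).2 U.f_ne_zero
  obtain ⟨y, hy, rfl⟩ := hx 0 (Nat.zero_le _)
  rw [pow_zero, mul_one] at hy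
  obtain ⟨t, ht, h⟩ := (U.mem_idealLattice U.d_pos).1 (show toC U.f * y ∈ _ from hy)
  obtain ⟨r, rfl⟩ : ∃ r, y = ξ * toC r := by
    refine ⟨t / U.f, ?_⟩
    rw [map_div₀]
    field_simp
    rw [mul_comm, h]
  refine ⟨_, ?_, rfl⟩
  rw [SetLike.mem_coe, U.mul_toC_mem_iff (by omega) hξ]
  refine U.mem_idealA_sub hi' fun j hj => ?_
  -- The representative `y'` depends on `j`; it differs from `ξ r` by an element of `ξ 𝔞_0`, which
  -- stays in `ξ 𝔞_0` after multiplication by `f T^j`.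
  obtain ⟨y', hy', h'⟩ := mem_torsion.1 (hx j hj)
  rw [expLinear_apply, expLat_eq_iff (U.finite_idealLattice hξ)] at h'
  rw [← U.mul_toC_mem_iff U.d_pos hξ]
  obtain ⟨s, hs, hsub⟩ := (U.mem_idealLattice U.d_pos).1 h'
  have h3 : ξ * toC (U.f * T Fq ^ j * r) =
      toC (U.f * T Fq ^ j) * y' - ξ * toC (U.f * T Fq ^ j * s) := by
    rw [eq_add_of_sub_eq hsub, map_mul _ _ r, map_mul _ _ s]
    ring
  rw [h3]
  exact sub_mem hy' ((U.mul_toC_mem_iff U.d_pos hξ).2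
    (U.mul_mem_idealA (U.f_mul_T_pow_mem_ringA (by omega)) hs))

/-- The kernels of the `ρ_{0,α}`, `α ∈ 𝔞_i`, contain `e_0(ξ_0 𝔞_{d-i})` because `𝔞_i 𝔞_{d-i} ⊂ 𝔞_0`,
and those of the generators `f T^j` already intersect in it. -/
theorem isHayesIsogeny {ξ : ℕ → CInf Fq} (hξ : ξ 0 ≠ 0) {i : ℕ} (hi : 1 ≤ i) (hi' : i < U.d) :
    U.IsHayesIsogeny ξ i (subspacePoly (U.kernelSpace hξ (U.d - i))) := by
  have key : ∀ {α : KInf Fq}, α ∈ U.idealA i → α ≠ 0 → ∃ c : CInf Fq, c ≠ 0 ∧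
      drinfeldPoly (scale (ξ 0) (U.idealA 0)) (toC α) =
        C c * subspacePoly (torsion (U.finite_idealLattice hξ) (toC α)) := by
    intro α hα hα0
    obtain ⟨c, hc, h⟩ := exists_drinfeldPoly_eq (U.finite_idealLattice hξ) (toC α)
      (U.finite_torsion hξ (U.mem_ringA_of_mem_idealA hi' hα) hα0)
    rw [U.scale_idealA U.d_pos]
    exact ⟨c, hc ((map_ne_zero_iff _ toC_injective).2 hα0), h⟩
  refine isMonicGenerator_subspacePoly ?_ ?_ ?_
  · rintro _ ⟨α, hα, rfl⟩
    -- For `α = 0` the polynomial is zero, a multiple of any other with constant `0`; the formula by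
    -- the kernel needs `α ≠ 0`.
    rcases eq_or_ne α 0 with rfl | hα0
    · refine ⟨0, U.kernelSpace hξ (U.d - i), U.finite_kernelSpace hξ (by omega) (by omega), le_rfl, ?_⟩
      simp [drinfeldPoly]
    · obtain ⟨c, -, h⟩ := key hα hα0
      exact ⟨c, _, U.finite_torsion hξ (U.mem_ringA_of_mem_idealA hi' hα) hα0,
        U.kernelSpace_le_torsion hξ hi hi' hα, h⟩
  · intro x hx
    refine U.mem_kernelSpace_of_forall hξ hi hi' fun j hj => ?_
    have hα := U.f_mul_T_pow_mem_idealA hj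
    have hα0 : U.f * T Fq ^ j ≠ 0 := mul_ne_zero U.f_ne_zero (pow_ne_zero _ T_ne_zero)
    obtain ⟨c, hc, h⟩ := key hα hα0
    have h1 := hx _ ⟨_, hα, rfl⟩
    rw [h, eval_mul, eval_C] at h1
    exact (eval_subspacePoly_eq_zero_iff
      (U.finite_torsion hξ (U.mem_ringA_of_mem_idealA hi' hα) hα0)).1
        ((mul_eq_zero.1 h1).resolve_left hc)
  · obtain ⟨c, hc, h⟩ := key (U.f_mem_idealA i) U.f_ne_zero
    refine ⟨_, ⟨_, U.f_mem_idealA i, rfl⟩, ?_⟩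
    rw [h]
    exact mul_ne_zero (C_ne_zero.2 hc)
      (monic_subspacePoly (U.finite_torsion hξ U.f_mem_ringA U.f_ne_zero)).ne_zero

/-! ### The polynomials in `⟨T, …, T^i⟩` -/

theorem f_mul_polyToK_X_mul (p : Fq[X]) :
    U.f * polyToK (X * p) = seqEval (fun n => U.f * T Fq ^ (n + 1)) p := by
  rw [map_mul, polyToK_X, polyToK_eq_seqEval, seqEval_eq_sum, seqEval_eq_sum, Finset.mul_sum,
    Finset.mul_sum]
  refine Finset.sum_congr rfl fun n _ => ?_
  ring

theorem norm_f_mul_polyToK_X_mul {p : Fq[X]} (hp : p ≠ 0) :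
    ‖U.f * polyToK (X * p)‖ = (Fintype.card Fq : ℝ) ^ (U.d + 1 + p.natDegree) := by
  rw [norm_mul, norm_f, norm_polyToK (mul_ne_zero X_ne_zero hp), natDegree_X_mul hp, ← pow_add]
  congr 1
  omega

/-- A nonzero such element has degree strictly between `d` and `2d`, while nonzero elements of `𝔞_0`
have degree `d` or at least `2d`. -/
theorem eq_zero_of_f_mul_polyToK_mem {i : ℕ} (hi : i < U.d) {p : Fq[X]} (hp : p ∈ polysLT Fq i)
    (h : U.f * polyToK (X * p) ∈ U.idealA 0) : p = 0 := by
  by_contra hp0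
  obtain ⟨p', hp'⟩ := (U.mem_idealA_iff U.d_pos).1 h
  have h1 := U.norm_f_mul_polyToK_X_mul hp0
  rw [mem_polysLT, degree_eq_natDegree hp0] at hp
  have hp : p.natDegree < i := by exact_mod_cast hp
  have hp0' : p' ≠ 0 := by
    rintro rfl
    rw [← hp', map_zero, norm_zero] at h1
    exact (pow_pos (zero_lt_one.trans one_lt_card_real) _).ne h1
  rw [← hp', (U.isGraded_idealSeq U.d_pos).norm_seqEval hp0'] at h1
  have h2 := pow_right_injective₀ (zero_lt_one.trans one_lt_card_real) one_lt_card_real.ne' h1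
  unfold idealDeg at h2
  split_ifs at h2 <;> omega

/-- Of the basis of `𝔞_i` only the `f T^j` with `1 ≤ j ≤ i` are not in `𝔞_0`. -/
theorem exists_sub_mem_idealA_zero {i : ℕ} (hi : i < U.d) {x : KInf Fq} (hx : x ∈ U.idealA i) :
    ∃ p ∈ polysLT Fq i, x - U.f * polyToK (X * p) ∈ U.idealA 0 := by
  obtain ⟨p', rfl⟩ := (U.mem_idealA_iff hi).1 hx
  induction p' using Polynomial.induction_on' with
  | add p p' h h' =>
    obtain ⟨r, hr, h⟩ := h ((U.mem_idealA_iff hi).2 ⟨p, rfl⟩)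
    obtain ⟨r', hr', h'⟩ := h' ((U.mem_idealA_iff hi).2 ⟨p', rfl⟩)
    refine ⟨r + r', ?_, ?_⟩
    · rw [mem_polysLT] at hr hr' ⊢
      exact (degree_add_le _ _).trans_lt (max_lt hr hr')
    · have := add_mem h h'
      rwa [sub_add_sub_comm, ← mul_add, ← map_add, ← map_add, ← mul_add] at this
  | monomial n c =>
    rw [← C_mul_X_pow_eq_monomial, seqEval_monomial, idealSeq, ringElem]
    rcases U.idealDeg_div_mod (n := n) hi with ⟨h1, h2, h3⟩ | ⟨h1, h2⟩
    · rw [h2, h3, pow_one]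
      rcases n with _ | n
      · refine ⟨0, zero_mem_polysLT _, ?_⟩
        rw [mul_zero, map_zero, mul_zero, sub_zero]
        exact U.algebraMap_mul_mem_idealA _ (U.f_mul_T_pow_mem_idealA le_rfl)
      · refine ⟨C c * X ^ n, ?_, ?_⟩
        · rw [mem_polysLT]
          exact (degree_C_mul_X_pow_le n c).trans_lt (by exact_mod_cast h1)
        · have : algebraMap Fq (KInf Fq) c * (U.f * T Fq ^ (n + 1)) -
              U.f * polyToK (X * (C c * X ^ n)) = 0 := by
            rw [map_mul, map_mul, map_pow, polyToK_C, polyToK_X]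
            ring
          rw [this]
          exact zero_mem _
    · refine ⟨0, zero_mem_polysLT _, ?_⟩
      rw [mul_zero, map_zero, mul_zero, sub_zero]
      refine U.algebraMap_mul_mem_idealA _ ((U.mem_idealA_iff U.d_pos).2
        (U.f_pow_mul_T_pow_mem_range U.d_pos _ _ (by omega) ?_))
      have : 1 * U.d ≤ (U.idealDeg i n / U.d - 1) * U.d := Nat.mul_le_mul_right _ (by omega)
      omega

theorem f_mul_polyToK_X_mul_mem_idealA {i : ℕ} {p : Fq[X]} (hp : p ∈ polysLT Fq i) :
    U.f * polyToK (X * p) ∈ U.idealA i := by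
  rw [f_mul_polyToK_X_mul, seqEval_eq_sum]
  refine sum_mem fun n hn => U.algebraMap_mul_mem_idealA _ (U.f_mul_T_pow_mem_idealA ?_)
  rw [mem_polysLT] at hp
  have := (le_degree_of_mem_supp n hn).trans_lt hp
  exact_mod_cast this

theorem bijOn_kernelSpace {i : ℕ} (hi : i < U.d) :
    Set.BijOn (fun p : Fq[X] => expLat (seqLattice ξ (U.idealSeq 0)) (ξ * toC (U.f * polyToK (X * p))))
      (polysLT Fq i) (U.kernelSpace hξ i) := by
  refine ⟨fun p hp => ?_, fun p hp p' hp' h => ?_, ?_⟩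
  · exact ⟨_, (U.mul_toC_mem_iff hi hξ).2 (U.f_mul_polyToK_X_mul_mem_idealA hp), rfl⟩
  · change expLat _ _ = expLat _ _ at h
    rw [expLat_eq_iff (U.finite_idealLattice hξ), ← mul_sub, ← map_sub, U.mul_toC_mem_iff U.d_pos hξ,
      ← mul_sub, ← map_sub, ← mul_sub] at h
    refine sub_eq_zero.1 (U.eq_zero_of_f_mul_polyToK_mem hi ?_ h)
    rw [Finset.mem_coe, mem_polysLT] at hp hp'
    rw [mem_polysLT]
    exact (degree_sub_le _ _).trans_lt (max_lt hp hp')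
  · rintro _ ⟨x, hx, rfl⟩
    obtain ⟨r, hr, rfl⟩ := (U.mem_idealLattice hi).1 hx
    obtain ⟨p, hp, h⟩ := U.exists_sub_mem_idealA_zero hi hr
    refine ⟨p, hp, ?_⟩
    change expLat _ _ = _
    rw [expLinear_apply, eq_comm, expLat_eq_iff (U.finite_idealLattice hξ), ← mul_sub, ← map_sub]
    exact (U.mul_toC_mem_iff U.d_pos hξ).2 h

theorem eval_subspacePoly_kernelSpace {i : ℕ} (hi : i < U.d) (x : CInf Fq) :
    (subspacePoly (U.kernelSpace hξ i)).eval x = ∏ p ∈ polysLT Fq i,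
      (x - expLat (seqLattice ξ (U.idealSeq 0)) (ξ * toC (U.f * polyToK (X * p)))) := by
  have h := U.bijOn_kernelSpace hξ hi
  rw [subspacePoly, ← h.image_eq, finprod_mem_image h.injOn, finprod_mem_coe_finset, eval_prod]
  simp

end QuadraticUnit

/-! ### Periods of the ideals and of the spaces `Λ_ε(f)` -/

/-- The hypotheses give `|x - 1| < 1` and `(x - 1)^q = x - 1`, which forces `x = 1`. This makes the
coherent choice of roots unique. -/
theorem eq_one_of_pow_card_sub_one {x : KInf Fq} (h : x ^ (Fintype.card Fq - 1) = 1)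
    (hs : sgn x = 1) : x = 1 := by
  have hq := Fintype.one_lt_card (α := Fq)
  have hnorm : ‖x‖ = 1 := by
    have h1 := congr_arg norm h
    rw [norm_pow, norm_one] at h1
    exact (pow_eq_one_iff_of_nonneg (norm_nonneg _) (by omega)).1 h1
  have hlt : ‖x - 1‖ < 1 :=
    (norm_sub_one_le hnorm hs).trans_lt (inv_lt_one_of_one_lt₀ one_lt_card_real)
  have hpow : (x - 1) ^ Fintype.card Fq = x - 1 := by
    have h1 := add_pow_card (Fq := Fq) (x - 1) 1 1
    rw [sub_add_cancel, pow_one, one_pow] at h1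
    have h2 : x ^ Fintype.card Fq = x := by
      rw [← Nat.sub_add_cancel hq.le, pow_succ, h, one_mul]
    rw [h2] at h1
    exact (sub_eq_of_eq_add h1).symm
  by_contra hne
  have hpos : 0 < ‖x - 1‖ := norm_pos_iff.2 (sub_ne_zero.2 hne)
  have h1 := congr_arg norm hpow
  rw [norm_pow] at h1
  exact absurd h1 (pow_lt_self_of_lt_one₀ hpos hlt hq).ne

theorem exists_pow_eq_toC (x : KInf Fq) {n : ℕ} (hn : 0 < n) : ∃ ξ : CInf Fq, ξ ^ n = toC x := by
  obtain ⟨y, hy⟩ := IsAlgClosed.exists_pow_nat_eq (algebraMap (KInf Fq) (AlgClInf Fq) x) hn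
  refine ⟨(UniformSpace.Completion.coeRingHom (α := AlgClInf Fq)) y, ?_⟩
  rw [← map_pow, hy]
  rfl

namespace IsUniformizer

variable {U : QuadraticUnit Fq} {ϖ : KInf Fq}

theorem norm_eq (h : IsUniformizer U ϖ) : ‖ϖ‖ = (Fintype.card Fq : ℝ)⁻¹ := by
  have hq : (0 : ℝ) < Fintype.card Fq := zero_lt_one.trans one_lt_card_real
  have key : ∀ n ≠ 0, ‖ϖ‖ ^ n * (Fintype.card Fq : ℝ) ^ n = 1 → ‖ϖ‖ = (Fintype.card Fq : ℝ)⁻¹ := by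
    intro n hn h
    rw [← mul_pow, pow_eq_one_iff_of_nonneg (by positivity) hn] at h
    exact eq_inv_of_mul_eq_one_left h
  by_cases hc : Nat.Coprime U.d (ringChar Fq)
  · refine key U.d U.d_pos.ne' ?_
    rw [← U.norm_f, ← norm_pow, ← norm_mul, h.2.1 hc, norm_one]
  · refine key (U.d + 1) (Nat.succ_ne_zero _) ?_
    rw [pow_succ (Fintype.card Fq : ℝ), ← U.norm_f, ← norm_T, ← norm_pow, ← norm_mul, ← norm_mul,
      h.2.2 hc, norm_one]

end IsUniformizer

namespace QuadraticUnit

variable (U : QuadraticUnit Fq)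

theorem deg_scaleFactor {N : ℕ} (hN : 1 ≤ N) : deg (U.scaleFactor N) = -(U.d * (N - 1) : ℕ) := by
  have hq : (Fintype.card Fq : ℝ) ≠ 0 := (zero_lt_one.trans one_lt_card_real).ne'
  refine deg_eq_of_norm ?_
  rw [norm_scaleFactor, ← zpow_natCast, ← zpow_natCast, ← zpow_sub₀ hq]
  congr 1
  push_cast [Nat.cast_sub hN]
  ring

theorem scaleFactor_ne_zero (N : ℕ) : U.scaleFactor N ≠ 0 := ne_zero_of_sgn_eq_one (U.sgn_scaleFactor N)

/-- The periods of `𝔞_i` and of `Λ_{ε_{N,d-1-i}}(f)` are the roots of the same constant, up to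
elements of `k_∞` which are explicit up to `1`-units close to each other. -/
theorem exists_isPeriod_iff {ϖ : KInf Fq} (hϖ : IsUniformizer U ϖ) {i : ℕ} (hi : i < U.d) :
    ∃ (A u : KInf Fq) (u' : ℕ → KInf Fq), A ≠ 0 ∧ ‖u‖ = 1 ∧ sgn u = 1 ∧
      (∀ ξ, IsPeriod ϖ (U.idealA i : Set (KInf Fq)) ξ ↔
        ξ ^ (Fintype.card Fq - 1) = toC (A * u ^ (Fintype.card Fq - 1))) ∧
      ∀ N, 1 ≤ N → sgn (u' N) = 1 ∧ ‖u' N - u‖ ≤ (Fintype.card Fq : ℝ)⁻¹ ^ N ∧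
        ∀ ξ, IsPeriod ϖ (U.approx (U.eps N (U.d - 1 - i))) ξ ↔ ξ ^ (Fintype.card Fq - 1) =
          toC (A * (U.scaleFactor N * u' N) ^ (Fintype.card Fq - 1)) := by
  have hn := hϖ.norm_eq
  have hs := hϖ.1
  have hϖ0 : ϖ ≠ 0 := ne_zero_of_sgn_eq_one hs
  have hg := U.isGraded_idealSeq hi
  have hk := U.idealDeg_eq_add hi
  obtain ⟨u, hu⟩ := hg.exists_tendsto_unitProd hn hs
  have hex : ∀ N : ℕ, ∃ u' : KInf Fq, 1 ≤ N →
      Tendsto (unitProd ϖ fun n => U.scaleFactor N * U.approxSeq N i n) atTop (𝓝 u') := by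
    intro N
    by_cases hN : 1 ≤ N
    · obtain ⟨u', h⟩ := (U.isGraded_scaleFactor_mul hN hi).exists_tendsto_unitProd hn hs
      exact ⟨u', fun _ => h⟩
    · exact ⟨0, fun h => absurd h hN⟩
  choose u' hu' using hex
  refine ⟨algebraMap Fq (KInf Fq) (-1)⁻¹ *
      ϖ ^ (-zetaExponent Fq (U.idealDeg i) (i + 1) (2 * U.d - i - 1)), u, u',
    mul_ne_zero (algebraMap_ne_zero (by simp)) (zpow_ne_zero _ hϖ0),
    hg.norm_limit_eq_one hn hs hu, hg.sgn_limit_eq_one hn hs hu, fun ξ => ?_, fun N hN => ?_⟩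
  · rw [U.coe_idealA hi, hg.isPeriod_iff hk hu]
  · have hg' := U.isGraded_scaleFactor_mul hN hi
    have hga := U.isGraded_approxSeq N hi
    refine ⟨hg'.sgn_limit_eq_one hn hs (hu' N hN), ?_, fun ξ => ?_⟩
    · refine hg.norm_limit_sub_limit_le hn hs hg' (by positivity) (fun n => ?_) hu (hu' N hN)
      exact U.norm_scaleFactor_mul_approxSeq_sub_le hN i n
    · obtain ⟨v, hv⟩ := hga.exists_tendsto_unitProd hn hs
      have hv' := hga.limit_mul_eq hn hs (U.scaleFactor_ne_zero N) hv (hu' N hN)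
      rw [U.approx_eq hN (by omega), show U.d - 1 - (U.d - 1 - i) = i by omega,
        hga.isPeriod_iff (n₀ := i + 1) (k := 2 * U.d - i - 1 + U.d * (N - 1))
          (fun n h => by rw [hk n h, add_assoc]) hv, zetaExponent_shift, ← hv']
      -- The degrees of the two sequences differ by `d (N - 1)`; through `t` this contributes the
      -- `(q-1)`-th power of `ϖ^{d(N-1)}`.
      have h1 : ϖ ^ (-(zetaExponent Fq (U.idealDeg i) (i + 1) (2 * U.d - i - 1) -
            ((Fintype.card Fq : ℤ) - 1) * (U.d * (N - 1) : ℕ))) =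
          ϖ ^ (-zetaExponent Fq (U.idealDeg i) (i + 1) (2 * U.d - i - 1)) *
            (ϖ ^ (U.d * (N - 1))) ^ (Fintype.card Fq - 1) := by
        rw [← pow_mul, ← zpow_natCast ϖ (_ * (Fintype.card Fq - 1)), ← zpow_add₀ hϖ0]
        congr 1
        have := Fintype.card_pos (α := Fq)
        push_cast [Nat.cast_sub this]
        ring
      -- The factor `√D f^{-N}` has degree `-d(N-1)` and sign `1`, so the power of `ϖ` exactly
      -- restores it from its `1`-unit part.
      have h2 : ϖ ^ (U.d * (N - 1)) * oneUnit ϖ (U.scaleFactor N) = U.scaleFactor N := by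
        rw [oneUnit, U.deg_scaleFactor hN, U.sgn_scaleFactor, inv_one, map_one, mul_one, zpow_neg,
          zpow_natCast, mul_comm, mul_assoc, inv_mul_cancel₀ (pow_ne_zero _ hϖ0), mul_one]
      have h3 : ϖ ^ (U.d * (N - 1)) * (u' N * oneUnit ϖ (U.scaleFactor N)) =
          U.scaleFactor N * u' N := by rw [mul_left_comm, h2, mul_comm]
      rw [h1, ← mul_assoc (algebraMap Fq (KInf Fq) (-1)⁻¹), mul_assoc _ (_ ^ (Fintype.card Fq - 1))
        (_ ^ (Fintype.card Fq - 1)), ← mul_pow, h3]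

theorem exists_isPeriodSystem {ϖ : KInf Fq} (hϖ : IsUniformizer U ϖ) :
    ∃ (ξe : ℕ → ℕ → CInf Fq) (ξ : ℕ → CInf Fq), IsPeriodSystem U ϖ ξe ξ := by
  have hq : 0 < Fintype.card Fq - 1 := Nat.sub_pos_of_lt Fintype.one_lt_card
  have key : ∀ i, ∃ (x : CInf Fq) (c : ℕ → KInf Fq), i < U.d →
      IsPeriod ϖ (U.idealA i : Set (KInf Fq)) x ∧ ∀ N, 1 ≤ N → sgn (c N) = 1 ∧
        IsPeriod ϖ (U.approx (U.eps N (U.d - 1 - i))) (toC (c N) * x) := by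
    intro i
    by_cases hi : i < U.d
    · obtain ⟨A, u, u', -, hu, hs, h1, h2⟩ := U.exists_isPeriod_iff hϖ hi
      have hu0 : u ≠ 0 := ne_zero_of_sgn_eq_one hs
      obtain ⟨x, hx⟩ := exists_pow_eq_toC (A * u ^ (Fintype.card Fq - 1)) hq
      -- The ratio of the two explicit constants is the `(q-1)`-th power of this element of `k_∞`,
      -- which has sign `1`.
      refine ⟨x, fun N => U.scaleFactor N * u' N / u, fun _ => ⟨(h1 x).2 hx, fun N hN => ?_⟩⟩
      obtain ⟨hs', -, h2⟩ := h2 N hN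
      refine ⟨by rw [sgn_div, sgn_mul, U.sgn_scaleFactor, hs', hs, one_mul, div_one], (h2 _).2 ?_⟩
      rw [mul_pow, hx, ← map_pow, ← map_mul, div_pow, mul_left_comm,
        div_mul_cancel₀ _ (pow_ne_zero _ hu0)]
    · exact ⟨0, 0, fun h => absurd h hi⟩
  choose ξ c h using key
  refine ⟨fun N l => toC (c (U.d - 1 - l) N) * ξ (U.d - 1 - l), ξ, fun i hi => (h i hi).1,
    fun N hN l hl => ?_, fun N hN l hl => ⟨_, ((h _ (by omega)).2 N hN).1, rfl⟩⟩
  have := ((h (U.d - 1 - l) (by omega)).2 N hN).2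
  rwa [show U.d - 1 - (U.d - 1 - l) = l by omega] at this

end QuadraticUnit

namespace IsPeriodSystem

variable {U : QuadraticUnit Fq} {ϖ : KInf Fq} {ξe : ℕ → ℕ → CInf Fq} {ξ : ℕ → CInf Fq}

/-- The periods of the spaces `Λ_{ε_{N,l}}(f)` compared to the period of `𝔞_{d-1-l}`. -/
theorem exists_eq_mul (h : IsPeriodSystem U ϖ ξe ξ) (hϖ : IsUniformizer U ϖ) {l : ℕ} (hl : l < U.d) :
    ξ (U.d - 1 - l) ≠ 0 ∧ ∃ κ : ℕ → KInf Fq, ∀ N, 1 ≤ N →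
      ‖κ N - 1‖ ≤ (Fintype.card Fq : ℝ)⁻¹ ^ N ∧
        ξe N l = toC (U.scaleFactor N * κ N) * ξ (U.d - 1 - l) := by
  have hq : Fintype.card Fq - 1 ≠ 0 := (Nat.sub_pos_of_lt Fintype.one_lt_card).ne'
  obtain ⟨A, u, u', hA, hu, hs, h1, h2⟩ := U.exists_isPeriod_iff hϖ (i := U.d - 1 - l) (by omega)
  rw [show U.d - 1 - (U.d - 1 - l) = l by omega] at h2
  have hu0 : u ≠ 0 := ne_zero_of_sgn_eq_one hs
  have hx := (h1 _).1 (h.period_ideal _ (by omega))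
  have hx0 : ξ (U.d - 1 - l) ^ (Fintype.card Fq - 1) ≠ 0 := by
    rw [hx, Ne, map_eq_zero_iff _ toC_injective]
    exact mul_ne_zero hA (pow_ne_zero _ hu0)
  refine ⟨fun h0 => hx0 (by rw [h0, zero_pow hq]), fun N => u' N / u, fun N hN => ⟨?_, ?_⟩⟩
  · rw [div_sub_one hu0, norm_div, hu, div_one]
    exact (h2 N hN).2.1
  · obtain ⟨c, hc, hce⟩ := h.coherent N hN l hl
    have hxe := ((h2 N hN).2.2 _).1 (h.period_approx N hN l hl)
    have hF := U.scaleFactor_ne_zero N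
    have hu' : u' N ≠ 0 := ne_zero_of_sgn_eq_one (h2 N hN).1
    rw [hce, mul_pow, hx, ← map_pow, ← map_mul] at hxe
    -- The given ratio `c` and the explicit one have the same `(q-1)`-th power and the same sign,
    -- hence coincide.
    have h3 : (c * u / (U.scaleFactor N * u' N)) ^ (Fintype.card Fq - 1) = 1 := by
      rw [div_pow, div_eq_one_iff_eq (pow_ne_zero _ (mul_ne_zero hF hu'))]
      have := toC_injective hxe
      rw [mul_left_comm] at this
      rw [mul_pow]
      exact mul_left_cancel₀ hA this
    have h4 := eq_one_of_pow_card_sub_one h3 (by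
      rw [sgn_div, sgn_mul, sgn_mul, U.sgn_scaleFactor, hc, hs, (h2 N hN).1, one_mul, div_one])
    rw [div_eq_one_iff_eq (mul_ne_zero hF hu')] at h4
    rw [hce, ← mul_div_assoc, ← h4, mul_div_cancel_right₀ _ hu0]

end IsPeriodSystem

/-! ### Limits of the exponentials, the isogenies and the shifts -/

theorem tendsto_inv_card_pow : Tendsto (fun N : ℕ => (Fintype.card Fq : ℝ)⁻¹ ^ N) atTop (𝓝 0) :=
  tendsto_pow_atTop_nhds_zero_of_lt_one (inv_nonneg.2 (Nat.cast_nonneg _))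
    (inv_lt_one_of_one_lt₀ one_lt_card_real)

theorem inv_card_pow_le_one (N : ℕ) : (Fintype.card Fq : ℝ)⁻¹ ^ N ≤ 1 :=
  pow_le_one₀ (inv_nonneg.2 (Nat.cast_nonneg _)) (inv_lt_one_of_one_lt₀ one_lt_card_real).le

theorem norm_mul_sub_le_of_norm_sub_le {κ x y : KInf Fq} {δ : ℝ} (hδ : δ ≤ 1) (hκ : ‖κ - 1‖ ≤ δ)
    (h : ‖x - y‖ ≤ δ * ‖y‖) : ‖κ * x - y‖ ≤ δ * ‖y‖ := by
  have hx : ‖x‖ ≤ ‖y‖ := by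
    rw [← sub_add_cancel x y]
    refine (IsUltrametricDist.norm_add_le_max _ _).trans (max_le (h.trans ?_) le_rfl)
    exact mul_le_of_le_one_left (norm_nonneg _) hδ
  have h1 : κ * x - y = (κ - 1) * x + (x - y) := by ring
  rw [h1]
  refine (IsUltrametricDist.norm_add_le_max _ _).trans (max_le ?_ h)
  rw [norm_mul]
  exact mul_le_mul hκ hx (norm_nonneg _) ((norm_nonneg _).trans hκ)

namespace IsPeriodSystem

variable {U : QuadraticUnit Fq} {ϖ : KInf Fq} {ξe : ℕ → ℕ → CInf Fq} {ξ : ℕ → CInf Fq}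

theorem scaleFactor_mul_seqEval (N i : ℕ) (p : Fq[X]) :
    U.scaleFactor N * seqEval (U.approxSeq N i) p =
      seqEval (fun n => U.scaleFactor N * U.approxSeq N i n) p :=
  map_seqEval (AddMonoidHom.mulLeft (U.scaleFactor N)) (fun _ _ => mul_left_comm _ _ _) _ p

theorem breve_eq {N l : ℕ} (hN : 1 ≤ N) (hl : l < U.d) :
    U.breve ξe N l = seqLattice (ξe N l) (U.approxSeq N (U.d - 1 - l)) := by
  rw [QuadraticUnit.breve, U.approx_eq hN hl, coe_seqLattice]

section

variable (hξ : ξ 0 ≠ 0) {κ : ℕ → KInf Fq} (hκ : ∀ N, 1 ≤ N →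
  ‖κ N - 1‖ ≤ (Fintype.card Fq : ℝ)⁻¹ ^ N ∧
    ξe N (U.d - 1) = toC (U.scaleFactor N * κ N) * ξ 0)
include hκ

theorem tendsto_toC_factor : Tendsto (fun N => toC (κ N)) atTop (𝓝 1) := by
  rw [tendsto_iff_norm_sub_tendsto_zero]
  refine squeeze_zero' (Eventually.of_forall fun _ => norm_nonneg _) ?_
    (tendsto_inv_card_pow (Fq := Fq))
  filter_upwards [eventually_ge_atTop 1] with N hN
  rw [← map_one (toC (Fq := Fq)), ← map_sub, norm_toC]
  exact (hκ N hN).1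

theorem factor_ne_zero {N : ℕ} (hN : 1 ≤ N) : κ N ≠ 0 := by
  intro h
  have h1 := (hκ N hN).1
  rw [h, zero_sub, norm_neg, norm_one] at h1
  exact absurd h1 (pow_lt_one₀ (inv_nonneg.2 (Nat.cast_nonneg _))
    (inv_lt_one_of_one_lt₀ one_lt_card_real) (by omega)).not_ge

include hξ

theorem period_approx_ne_zero {N : ℕ} (hN : 1 ≤ N) : ξe N (U.d - 1) ≠ 0 := by
  rw [(hκ N hN).2]
  refine mul_ne_zero ((map_ne_zero_iff _ toC_injective).2 ?_) hξ
  exact mul_ne_zero (U.scaleFactor_ne_zero N) (factor_ne_zero hκ hN)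

theorem tendsto_expApprox {z : CInf Fq} {zs : ℕ → CInf Fq} (hzs : Tendsto zs atTop (𝓝 z)) :
    Tendsto (fun N => U.expApprox ξe N (U.d - 1) (zs N)) atTop (𝓝 (U.expIdeal ξ 0 z)) := by
  have hd := U.d_pos
  have hg := U.isGraded_idealSeq hd
  rw [QuadraticUnit.expIdeal, U.scale_idealA hd]
  refine tendsto_expLat (lam := fun p => ξ 0 * toC (seqEval (U.idealSeq 0) p))
    (lam' := fun N p => ξe N (U.d - 1) * toC (seqEval (U.approxSeq N 0) p))
    (δ := fun N => (Fintype.card Fq : ℝ)⁻¹ ^ N) (hg.mul_toC_injective hξ) (by simp) rfl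
    (hg.finite_norm_mul_toC_le hξ) ?_ (Eventually.of_forall fun _ => by simp) ?_
    tendsto_inv_card_pow ?_ hzs
  · filter_upwards [eventually_ge_atTop 1] with N hN
    exact (U.isGraded_approxSeq N hd).mul_toC_injective (period_approx_ne_zero hξ hκ hN)
  · filter_upwards [eventually_ge_atTop 1] with N hN
    rw [breve_eq hN (by omega), Nat.sub_self]
    rfl
  · filter_upwards [eventually_ge_atTop 1] with N hN p
    have h1 : ξe N (U.d - 1) * toC (seqEval (U.approxSeq N 0) p) - ξ 0 * toC (seqEval (U.idealSeq 0) p) =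
        ξ 0 * toC (κ N * seqEval (fun n => U.scaleFactor N * U.approxSeq N 0 n) p -
          seqEval (U.idealSeq 0) p) := by
      rw [(hκ N hN).2, ← scaleFactor_mul_seqEval, map_sub, map_mul, map_mul, map_mul]
      ring
    rw [h1, norm_mul, norm_mul, norm_toC, norm_toC, mul_left_comm]
    refine mul_le_mul_of_nonneg_left ?_ (norm_nonneg _)
    refine norm_mul_sub_le_of_norm_sub_le (inv_card_pow_le_one N) (hκ N hN).1 ?_
    exact hg.norm_seqEval_sub_le (by positivity)
      (fun n => U.norm_scaleFactor_mul_approxSeq_sub_le hN 0 n) p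

/-- The initial factor `f / √D` cancels `√D f^{-1}` in `ξ_{1,d-1}`, and the `f` in each shift
cancels the extra `f^{-1}` in the next period; only `κ_N` remains. -/
theorem shiftSeq_eq (z : CInf Fq) {N : ℕ} (hN : 1 ≤ N) :
    U.shiftSeq ξe (U.d - 1) z N = toC (κ N) * (ξ 0 * z) := by
  have hf : toC U.f ≠ 0 := (map_ne_zero_iff _ toC_injective).2 U.f_ne_zero
  have hD : toC U.sqrtD ≠ 0 := (map_ne_zero_iff _ toC_injective).2 U.sqrtD_ne_zero
  have hF : ∀ N, toC (U.scaleFactor N) = toC U.sqrtD / toC U.f ^ N := fun N => by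
    rw [QuadraticUnit.scaleFactor, map_div₀, map_pow]
  induction N, hN using Nat.le_induction with
  | base =>
    rw [QuadraticUnit.shiftSeq, (hκ 1 le_rfl).2, map_mul, hF]
    field_simp
  | succ N hN ih =>
    obtain ⟨M, rfl⟩ : ∃ M, N = M + 1 := ⟨N - 1, by omega⟩
    have hκ0 : toC (κ (M + 1)) ≠ 0 :=
      (map_ne_zero_iff _ toC_injective).2 (factor_ne_zero hκ hN)
    rw [QuadraticUnit.shiftSeq, QuadraticUnit.shift, ih, (hκ _ hN).2, (hκ (M + 2) (by omega)).2,
      map_mul, map_mul, hF, hF]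
    field_simp
    ring

/-- The lattice part `x N` of `y N` does not affect the exponential, and `y N - x N` tends to `ξ_0
z`, since `κ_N → 1` and `δ_N → 0`. -/
theorem tendsto_expApprox_representative {z : CInf Fq} {y : ℕ → CInf Fq}
    (hy : U.IsRepresentative ξe z y) :
    Tendsto (fun N => U.expApprox ξe N (U.d - 1) (y N)) atTop (𝓝 (U.expIdeal ξ 0 (ξ 0 * z))) := by
  have hd := U.d_pos
  obtain ⟨δ, hδ, h⟩ := hy
  choose! x hx hlt using h
  have hlim : Tendsto (fun N => y N - x N) atTop (𝓝 (ξ 0 * z)) := by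
    have h1 : Tendsto (fun N => toC (κ N) * (ξ 0 * z)) atTop (𝓝 (ξ 0 * z)) := by
      simpa using (tendsto_toC_factor hκ).mul_const (ξ 0 * z)
    have h2 : Tendsto (fun N => y N - x N - toC (κ N) * (ξ 0 * z)) atTop (𝓝 0) := by
      refine squeeze_zero_norm' ?_ hδ
      filter_upwards [eventually_ge_atTop 1] with N hN
      have := (hlt N hN).le
      rwa [shiftSeq_eq hξ hκ z hN, add_comm, ← sub_sub] at this
    simpa using h2.add h1
  refine (tendsto_expApprox hξ hκ hlim).congr' ?_
  filter_upwards [eventually_ge_atTop 1] with N hN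
  have hx := hx N hN
  rw [QuadraticUnit.expApprox, breve_eq hN (by omega)]
  rw [breve_eq hN (by omega)] at hx
  have := expLat_add_of_mem ((U.isGraded_approxSeq N (by omega)).finite_seqLattice
    (period_approx_ne_zero hξ hκ hN)) (z := y N - x N) hx
  rw [← this, sub_add_cancel]

/-- `Q_N` is the first basis element of `Λ_{ε_{N,d-1}}(f)` and corresponds to `f`, so `ξ_{N,d-1}
Q_N` tends to `ξ_0 f`. -/
theorem tendsto_expApprox_root (p : Fq[X]) :
    Tendsto (fun N => U.expApprox ξe N (U.d - 1) (ξe N (U.d - 1) * toC (polyToK (U.Q N * p)))) atTop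
      (𝓝 (U.expIdeal ξ 0 (ξ 0 * toC (U.f * polyToK p)))) := by
  refine tendsto_expApprox hξ hκ ?_
  rw [tendsto_iff_norm_sub_tendsto_zero]
  have hb : Tendsto (fun N : ℕ => ‖ξ 0‖ * ((Fintype.card Fq : ℝ)⁻¹ ^ N * ‖U.f‖ * ‖polyToK p‖)) atTop
      (𝓝 0) := by
    simpa using ((tendsto_inv_card_pow.mul_const ‖U.f‖).mul_const ‖polyToK p‖).const_mul ‖ξ 0‖
  refine squeeze_zero' (Eventually.of_forall fun _ => norm_nonneg _) ?_ hb
  filter_upwards [eventually_ge_atTop 1] with N hN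
  have h0 : U.approxSeq N 0 0 = polyToK (U.Q N) ∧ U.idealSeq 0 0 = U.f := by
    have hd := U.d_pos
    obtain ⟨M, rfl⟩ : ∃ M, N = M + 1 := ⟨N - 1, by omega⟩
    have h1 : U.idealDeg 0 0 = U.d := by simp [QuadraticUnit.idealDeg]
    have h2 : U.d + U.d * (M + 1 - 1) = U.d * (M + 1) := by rw [Nat.add_sub_cancel]; ring
    rw [QuadraticUnit.approxSeq, QuadraticUnit.idealSeq, h1, h2, QuadraticUnit.polyElem,
      QuadraticUnit.ringElem, Nat.mul_div_cancel_left _ hd, Nat.mul_mod_right, Nat.div_self hd,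
      Nat.mod_self]
    simp
  have h1 := U.norm_scaleFactor_mul_approxSeq_sub_le hN 0 0
  rw [h0.1, h0.2] at h1
  have h2 : ξe N (U.d - 1) * toC (polyToK (U.Q N * p)) - ξ 0 * toC (U.f * polyToK p) =
      ξ 0 * toC ((κ N * (U.scaleFactor N * polyToK (U.Q N)) - U.f) * polyToK p) := by
    rw [(hκ N hN).2]
    simp only [map_mul, map_sub]
    ring
  rw [h2, norm_mul, norm_toC, norm_mul]
  refine mul_le_mul_of_nonneg_left (mul_le_mul_of_nonneg_right ?_ (norm_nonneg _)) (norm_nonneg _)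
  exact norm_mul_sub_le_of_norm_sub_le (inv_card_pow_le_one N) (hκ N hN).1 h1

omit hξ hκ in
theorem mem_span_Q_mul_iff (N i : ℕ) (α : Fq[X]) :
    α ∈ Submodule.span Fq ((fun j : ℕ => U.Q N * X ^ j) '' {j | 1 ≤ j ∧ j ≤ i}) ↔
      ∃ p ∈ polysLT Fq i, α = U.Q N * (X * p) := by
  constructor
  · intro h
    induction h using Submodule.span_induction with
    | mem α hα =>
      obtain ⟨j, ⟨h1, h2⟩, rfl⟩ := hα
      obtain ⟨j, rfl⟩ : ∃ k, j = k + 1 := ⟨j - 1, by omega⟩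
      refine ⟨X ^ j, ?_, by simp only [pow_succ']⟩
      rw [mem_polysLT, degree_X_pow]
      exact_mod_cast h2
    | zero => exact ⟨0, zero_mem_polysLT _, by simp⟩
    | add α β _ _ h h' =>
      obtain ⟨p, hp, rfl⟩ := h
      obtain ⟨p', hp', rfl⟩ := h'
      refine ⟨p + p', ?_, by ring⟩
      rw [mem_polysLT] at hp hp' ⊢
      exact (degree_add_le _ _).trans_lt (max_lt hp hp')
    | smul c α _ h =>
      obtain ⟨p, hp, rfl⟩ := h
      refine ⟨c • p, ?_, by rw [mul_smul_comm, mul_smul_comm]⟩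
      rw [mem_polysLT] at hp ⊢
      exact (degree_smul_le _ _).trans_lt hp
  · rintro ⟨p, hp, rfl⟩
    rw [p.as_sum_support_C_mul_X_pow, Finset.mul_sum, Finset.mul_sum]
    refine sum_mem fun n hn => ?_
    rw [mem_polysLT] at hp
    have hn : n < i := by exact_mod_cast (le_degree_of_mem_supp n hn).trans_lt hp
    have h1 : U.Q N * (X * (C (p.coeff n) * X ^ n)) = p.coeff n • (U.Q N * X ^ (n + 1)) := by
      rw [smul_eq_C_mul]
      ring
    rw [h1]
    exact Submodule.smul_mem _ _ (Submodule.subset_span ⟨n + 1, ⟨by omega, by omega⟩, rfl⟩)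

omit hξ hκ in
theorem eval_approxIsogeny (N l : ℕ) (x : CInf Fq) :
    (U.approxIsogeny ξe N l).eval x = ∏ p ∈ polysLT Fq (U.d - 1 - l),
      (x - U.expApprox ξe N (U.d - 1) (ξe N (U.d - 1) * toC (polyToK (U.Q N * (X * p))))) := by
  classical
  have hQ : U.Q N ≠ 0 := (U.monic_Q_and_natDegree N).1.ne_zero
  have hinj : Function.Injective fun p : Fq[X] => U.Q N * (X * p) := fun p p' h =>
    mul_left_cancel₀ X_ne_zero (mul_left_cancel₀ hQ h)
  have hset : {α : Fq[X] | α ≠ 0 ∧ α ∈ Submodule.span Fq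
      ((fun j : ℕ => U.Q N * X ^ j) '' {j | 1 ≤ j ∧ j ≤ U.d - 1 - l})} =
      (fun p => U.Q N * (X * p)) '' ((polysLT Fq (U.d - 1 - l)).erase 0 : Finset Fq[X]) := by
    ext α
    simp only [Set.mem_ofPred_eq, mem_span_Q_mul_iff, Set.mem_image, Finset.coe_erase, Set.mem_sdiff,
      Finset.mem_coe, Set.mem_singleton_iff]
    constructor
    · rintro ⟨h0, p, hp, rfl⟩
      exact ⟨p, ⟨hp, fun h => h0 (by rw [h, mul_zero, mul_zero])⟩, rfl⟩
    · rintro ⟨p, ⟨hp, h0⟩, rfl⟩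
      exact ⟨mul_ne_zero hQ (mul_ne_zero X_ne_zero h0), p, hp, rfl⟩
  rw [QuadraticUnit.approxIsogeny, hset, finprod_mem_image hinj.injOn, finprod_mem_coe_finset, eval_mul,
    eval_X, eval_prod, ← Finset.mul_prod_erase _ _ (zero_mem_polysLT _)]
  simp [QuadraticUnit.expApprox, expLat_zero]

/-- In terms of the polynomials `p` the number of factors of the isogeny does not depend on `N`, so
the finite product may be taken to the limit factor by factor. -/
theorem tendsto_pointSeq {z : CInf Fq} {y : ℕ → CInf Fq} (hy : U.IsRepresentative ξe z y) {l : ℕ}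
    (hl : l < U.d) : Tendsto (fun N => U.pointSeq ξe y N l) atTop
      (𝓝 ((subspacePoly (U.kernelSpace hξ (U.d - 1 - l))).eval (U.expIdeal ξ 0 (ξ 0 * z)))) := by
  rw [U.eval_subspacePoly_kernelSpace hξ (by omega)]
  simp only [QuadraticUnit.pointSeq, eval_approxIsogeny]
  refine tendsto_finsetProd _ fun p _ => ?_
  refine (tendsto_expApprox_representative hξ hκ hy).sub ?_
  have := tendsto_expApprox_root hξ hκ (X * p)
  rwa [QuadraticUnit.expIdeal, U.scale_idealA U.d_pos] at this

end

end IsPeriodSystem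

namespace QuadraticUnit

variable (U : QuadraticUnit Fq)

/-- The space `e_0(ξ 𝔞_0)` is zero, so its polynomial is the identity: this is the case `l = d - 1`.
-/
theorem eval_subspacePoly_kernelSpace_zero {ξ : CInf Fq} (hξ : ξ ≠ 0) (x : CInf Fq) :
    (subspacePoly (U.kernelSpace hξ 0)).eval x = x := by
  rw [U.eval_subspacePoly_kernelSpace hξ U.d_pos]
  simp [polysLT, expLat_zero]

end QuadraticUnit

end QuantumDrinfeld

end

/-! ### The proposition. -/

open QuantumDrinfeld in
theorem mainTheorem9 {Fq : Type*} [Field Fq] [Fintype Fq] (U : QuadraticUnit Fq)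
    (ϖ : KInf Fq) (hϖ : IsUniformizer U ϖ) :
    (∃ (ξe : ℕ → ℕ → CInf Fq) (ξ : ℕ → CInf Fq), IsPeriodSystem U ϖ ξe ξ) ∧
    ∀ (ξe : ℕ → ℕ → CInf Fq) (ξ : ℕ → CInf Fq), IsPeriodSystem U ϖ ξe ξ →
      ∃ Φ : ℕ → (CInf Fq)[X],
        (∀ i, 1 ≤ i → i < U.d →
          U.IsHayesIsogeny ξ i (Φ i) ∧ ∀ G, U.IsHayesIsogeny ξ i G → G = Φ i) ∧
        ∀ z : CInf Fq, ∃ w : ℕ → CInf Fq,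
          w 0 = U.expIdeal ξ 0 (ξ 0 * z) ∧
          (∀ i, 1 ≤ i → i < U.d → w i = (Φ (U.d - i)).eval (w 0)) ∧
          ∀ y : ℕ → CInf Fq, U.IsRepresentative ξe z y →
            (∀ l < U.d, Tendsto (fun N => U.pointSeq ξe y N l) atTop (𝓝 (w (U.d - 1 - l)))) ∧
            U.quantumPoint ξe y =
              insert (w 0) {x | ∃ i, 1 ≤ i ∧ i < U.d ∧ x = (Φ i).eval (w 0)} := by
  refine ⟨U.exists_isPeriodSystem hϖ, fun ξe ξ h => ?_⟩
  have hd := U.d_pos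
  have hrel := h.exists_eq_mul hϖ (l := U.d - 1) (by omega)
  rw [Nat.sub_self] at hrel
  obtain ⟨hξ, κ, hκ⟩ := hrel
  have h0 := U.eval_subspacePoly_kernelSpace_zero hξ
  refine ⟨fun i => subspacePoly (U.kernelSpace hξ (U.d - i)), fun i hi hi' =>
    ⟨U.isHayesIsogeny hξ hi hi', fun G hG => hG.unique (U.isHayesIsogeny hξ hi hi')⟩, fun z =>
    ⟨fun i => (subspacePoly (U.kernelSpace hξ i)).eval (U.expIdeal ξ 0 (ξ 0 * z)), h0 _,
      fun i _ hi' => ?_, fun y hy => ?_⟩⟩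
  · simp only [h0, Nat.sub_sub_self hi'.le]
  · have hlim := fun l (hl : l < U.d) => IsPeriodSystem.tendsto_pointSeq hξ hκ hy hl
    refine ⟨hlim, Set.ext fun x => ?_⟩
    simp only [h0, Set.mem_insert_iff, Set.mem_ofPred_eq]
    constructor
    · rintro ⟨l, hl, hx⟩
      -- The limit with index `l` belongs to `𝔞_{d-1-l}`, hence to `Φ_{l+1}`; for `l = d - 1` it is
      -- `w_0` itself.
      have hx := tendsto_nhds_unique hx (hlim l hl)
      rcases eq_or_ne l (U.d - 1) with rfl | hne
      · left
        rw [hx, Nat.sub_self, h0]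
      · right
        refine ⟨l + 1, by omega, by omega, ?_⟩
        rw [hx, show U.d - (l + 1) = U.d - 1 - l by omega]
    · rintro (rfl | ⟨i, hi, hi', rfl⟩)
      · refine ⟨U.d - 1, by omega, ?_⟩
        have := hlim (U.d - 1) (by omega)
        rwa [Nat.sub_self, h0] at this
      · refine ⟨i - 1, by omega, ?_⟩
        have := hlim (i - 1) (by omega)
        rwa [show U.d - 1 - (i - 1) = U.d - i by omega] at this
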